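/- Model. A network is an $n$-vertex graph $G=(V,E)$, $n\ge 2$, whose nodes have unique $b$-bit identifiers (so $b\ge\log n$; $\log=\log_2$). A deterministic CONGEST algorithm with $B$-bit messages proceeds in synchronous rounds; in each round every node sends one $B$-bit message to each neighbor and then updates its state, local computation being unrestricted. Input. The vertices of $G$ are partitioned into clusters. Each cluster $\mathcal C$ has a unique $b$-bit identifier, a level $\mathrm{lev}(\mathcal C)\in\{1,2,\dots\}$ with $\mathrm{lev}(\mathcal C)=O(\log n)$, and a Steiner tree $T_{\mathcal C}$, that is, a rooted tree in $G$ of depth at most $R$ that contains all vertices of $\mathcal C$; every vertex of $G$ lies in $O(\log n)$ of these trees. Let $h\ge 1$ be real. Initially, every node knows $b$, $R$, the threshold $\lfloor h\log^2 n\rfloor$ and an upper bound on $n$ that is tight up to a polynomial; its own identifier and those of its neighbors; the identifier and the level of its own cluster; and, for each cluster whose Steiner tree contains it, the identifier of that cluster and its own depth, parent and children in that tree. Cluster graphs. Let $U_i$ be the set of vertices in clusters of level $i$ and $U_{i+}=\bigcup_{j\ge i}U_j$. The vertices of the cluster graph $G_i$ are the clusters of level $i$; two distinct ones are adjacent iff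 their distance in the induced subgraph $G[U_{i+}]$ is at most $h\log^2 n$. Claim. There is a deterministic CONGEST algorithm with $O(b)$-bit messages that, on every such input, after $O\big((R+h\log^2 n)\cdot\log^* b\big)$ rounds (where $\log^* b$ is replaced by $1$ if $b=1$) has computed a partial coloring of the clusters with colors red and blue, each node knowing the color of its own cluster (or that it is uncolored), such that for every level $i$: 1. every cluster that is alone in its connected component of $G_i$ is left uncolored; 2. in every connected component of $G_i$ with at least two clusters, every cluster is colored red or blue, at most $3/4$ of the clusters of the component are red, and at most $3/4$ of them are blue; consequently at most $3/4$ of all level-$i$ clusters are red, and at most $3/4$ of them are blue. The algorithm and its number of rounds depend only on the parameters that all nodes know, and the constants in the message size and in the number of rounds depend only on the constants hidden in the hypotheses. -/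

import Mathlib

namespace BalancedColoring

/-- The iterated logarithm to base 2: how often `log₂` has to be applied to `b` until the value is
at most 1. (Rounding up after every step does not change this number, because `x ≤ 2 ^ m` is
equivalent to `⌈log₂ x⌉ ≤ m` for natural `m`.) -/
noncomputable def logStar (b : ℕ) : ℕ :=
  sInf {k : ℕ | (Nat.clog 2)^[k] b ≤ 1}

/-- The two colors. -/
inductive Color : Type
  | red
  | blue

/-- A `b`-bit identifier. -/
abbrev Ident (b : ℕ) : Type := Fin (2 ^ b)

/-- A `B`-bit message. -/
abbrev Message (B : ℕ) : Type := Fin B → Bool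

/-! ### The deterministic CONGEST model -/

/-- A deterministic algorithm in the synchronous message passing model with `b`-bit identifiers
and `B`-bit messages. All nodes run the same local program; local computation is not restricted.
A node addresses its neighbors by their identifiers. In every round it sends one `B`-bit message to
each neighbor (`send`), and then updates its state with the messages that it received in this round
(`receive`); the argument of `receive` is `none` at an identifier that belongs to no neighbor. -/
structure CongestAlgorithm (b B : ℕ) (Input Output : Type) where
  State : Type
  init : Input → State
  send : State → Ident b → Message B
  receive : State → (Ident b → Option (Message B)) → State
  output : State → Output

open Classical in
/-- The state of each node after `t` rounds on the network `G`, where node `v` has the identifier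
`ident v` and starts with the local input `input v`. -/
noncomputable def CongestAlgorithm.run {b B : ℕ} {Input Output : Type}
    (A : CongestAlgorithm b B Input Output) {V : Type} (G : SimpleGraph V)
    (ident : V → Ident b) (input : V → Input) : ℕ → V → A.State
  | 0, v => A.init (input v)
  | t + 1, v =>
    A.receive (A.run G ident input t v) fun j =>
      if hu : ∃ u, G.Adj v u ∧ ident u = j then
        some (A.send (A.run G ident input t hu.choose) (ident v))
      else none

/-! ### Clusters, Steiner trees, levels -/

/-- A rooted tree in the graph `G`, given by parent pointers along edges of `G` and by the depths.
The values of `parent` and `depth` outside `verts`, and of `parent` at the root, are irrelevant. -/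
structure RootedTree {V : Type} (G : SimpleGraph V) where
  verts : Set V
  root : V
  parent : V → V
  depth : V → ℕ
  root_mem : root ∈ verts
  depth_root : depth root = 0
  parent_mem : ∀ v ∈ verts, v ≠ root → parent v ∈ verts
  adj_parent : ∀ v ∈ verts, v ≠ root → G.Adj v (parent v)
  depth_eq : ∀ v ∈ verts, v ≠ root → depth v = depth (parent v) + 1

/-- A network `G` with unique `b`-bit node identifiers whose vertices are partitioned into
(nonempty) clusters, indexed by `C`. Each cluster has a unique `b`-bit identifier, a level, and a
Steiner tree in `G` that contains all vertices of the cluster (and possibly others). -/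
structure ClusteredNetwork {V : Type} (G : SimpleGraph V) (C : Type) (b : ℕ) where
  ident : V → Ident b
  ident_injective : Function.Injective ident
  cluster : V → C
  cluster_surjective : Function.Surjective cluster
  clusterIdent : C → Ident b
  clusterIdent_injective : Function.Injective clusterIdent
  level : C → ℕ
  tree : C → RootedTree G
  mem_tree : ∀ v, v ∈ (tree (cluster v)).verts

/-- What a node knows about one Steiner tree that contains it: its depth in the tree and the
identifiers of its parent (`none` for the root) and of its children. -/
structure TreeView (b : ℕ) where
  depth : ℕ
  parent : Option (Ident b)
  children : Set (Ident b)

/-- What a node knows before the first round (besides the global parameters): its identifier and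
those of its neighbors, identifier and level of its own cluster, and, for the identifier of each
cluster whose Steiner tree contains the node, its view of that tree. -/
structure LocalInput (b : ℕ) where
  ident : Ident b
  neighbors : Set (Ident b)
  clusterIdent : Ident b
  level : ℕ
  trees : Ident b → Option (TreeView b)

namespace ClusteredNetwork

variable {V C : Type} {G : SimpleGraph V} {b : ℕ}

open Classical in
/-- The view of node `v` of the Steiner tree of cluster `κ`. -/
noncomputable def treeView (I : ClusteredNetwork G C b) (κ : C) (v : V) : TreeView b where
  depth := (I.tree κ).depth v
  parent := if v = (I.tree κ).root then none else some (I.ident ((I.tree κ).parent v))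
  children := {j | ∃ u ∈ (I.tree κ).verts,
    u ≠ (I.tree κ).root ∧ (I.tree κ).parent u = v ∧ I.ident u = j}

open Classical in
/-- The initial knowledge of node `v`. -/
noncomputable def localInput (I : ClusteredNetwork G C b) (v : V) : LocalInput b where
  ident := I.ident v
  neighbors := {j | ∃ u, G.Adj v u ∧ I.ident u = j}
  clusterIdent := I.clusterIdent (I.cluster v)
  level := I.level (I.cluster v)
  trees := fun j =>
    if hκ : ∃ κ, I.clusterIdent κ = j ∧ v ∈ (I.tree κ).verts then
      some (I.treeView hκ.choose v)
    else none

/-- The set `U_{i+}` of the vertices in clusters of level at least `i`. -/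
def upperSet (I : ClusteredNetwork G C b) (i : ℕ) : Set V :=
  {v | i ≤ I.level (I.cluster v)}

/-- The cluster graph `G_i`: its vertices are the clusters of level `i`, and two different ones are
adjacent iff their distance in the subgraph of `G` induced by `U_{i+}` is at most `θ`. -/
def clusterGraph (I : ClusteredNetwork G C b) (θ : ℝ) (i : ℕ) :
    SimpleGraph {κ : C // I.level κ = i} where
  Adj κ κ' := κ ≠ κ' ∧ ∃ u v : I.upperSet i, I.cluster u = κ ∧ I.cluster v = κ' ∧
    ∃ p : (G.induce (I.upperSet i)).Walk u v, (p.length : ℝ) ≤ θ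
  symm := ⟨by
    rintro κ κ' ⟨hne, u, v, hu, hv, p, hp⟩
    exact ⟨hne.symm, v, u, hv, hu, p.reverse, by simpa using hp⟩⟩
  loopless := ⟨fun _ h => h.1 rfl⟩

/-- The guarantees for a partial red/blue coloring of the clusters (`none`: left uncolored), for
the distance threshold `θ`. In each `G_i`, a cluster that is alone in its component is uncolored;
in a component with at least two clusters all clusters are colored, and each color is given to at
most 3/4 of the clusters of the component. Consequently, each color is given to at most 3/4 of all
clusters of level `i`, which is recorded as well. -/
structure IsBalanced (I : ClusteredNetwork G C b) (θ : ℝ) (χ : C → Option Color) : Prop where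
  uncolored : ∀ (i : ℕ) (P : (I.clusterGraph θ i).ConnectedComponent),
    P.supp.ncard = 1 → ∀ κ ∈ P.supp, χ κ = none
  colored : ∀ (i : ℕ) (P : (I.clusterGraph θ i).ConnectedComponent),
    2 ≤ P.supp.ncard → ∀ κ ∈ P.supp, χ κ ≠ none
  component_le : ∀ (i : ℕ) (P : (I.clusterGraph θ i).ConnectedComponent) (x : Color),
    2 ≤ P.supp.ncard →
      ({κ | κ ∈ P.supp ∧ χ κ = some x}.ncard : ℝ) ≤ 3 / 4 * (P.supp.ncard : ℝ)
  level_le : ∀ (i : ℕ) (x : Color),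
    ({κ | I.level κ = i ∧ χ κ = some x}.ncard : ℝ) ≤ 3 / 4 * ({κ | I.level κ = i}.ncard : ℝ)

end ClusteredNetwork

end BalancedColoring

namespace BalancedColoring

open Classical

noncomputable section

/-! ### Networks, knowledge and round complexity -/

/-! Each cluster is represented by one tree of a forest. On every level $i$, a breadth-first search
of depth $D=\lfloor h\log^2 n\rfloor$ in $G[U_{i+}]$ starts from all vertices of level-$i$ clusters
at once and assigns each reached vertex to one nearest cluster. Hanging these search trees below the
Steiner trees gives trees of depth at most $R+D+1$. If two clusters are adjacent in $G_i$, a short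
path between them has a first edge that leaves the cell of the first one. The cell entered there may
belong to a third cluster, but that cluster is again a $G_i$-neighbor of the first
(`exists_cross_of_walk`, `exists_of_cross`). So the edges between cells need not realize all of
$G_i$, but they show every non-isolated cluster some neighbor, and this is enough.

Every non-isolated tree elects a leader incident with such an edge and points along it. Pointers
give out-degree one, so $\log^* b$ Cole–Vishkin steps reduce the identifiers to 8 colors that differ
along pointers (`learn_coloring`). Going through the 8 colors, the unmatched trees of the current
color propose to the trees they point to, and each unmatched tree accepts one proposal; this yields
a maximal matching (`learn_matching`). In a matched pair the proposer becomes red and the acceptor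
blue. An unmatched tree points to a matched one, and the unmatched trees that point to the same tree
are split evenly up to one (`learn_split`), by passing parity tokens to the root and signs back. Of
$k$ such trees at most $\lfloor (k+1)/2\rfloor$ get a given color, and $4\lfloor (k+1)/2\rfloor\le
3k+1$. Adding up over the matched trees, of which half have each color, gives $3/4$
(`four_mul_card_le`). Pointers stay inside components of $G_i$, so the count applies to each
component.

For the congestion, an edge carries $S=O(\log n)$ channels, one per Steiner tree through it and one
per level. A channel transports one digit of about $b/S$ bits per round. A real message then has
$O(S+b)=O(b)$ bits, and a pipelined broadcast of an identifier takes $O(R+D+S)$ rounds, where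
$S=O(h\log^2 n)$. The algorithm is designed on the network of channels (`Net.virtual`) and
transferred back by `Solves.simulate`. Rounds are counted with `Solves`, which speaks about labels
known to the nodes; one local function must serve all instances, and a program is extracted only at
the end (`Solves.exists_algorithm`). -/

/-- A network whose nodes have unique addresses. -/
structure Net (Addr : Type) where
  V : Type
  G : SimpleGraph V
  addr : V → Addr
  inj : Function.Injective addr

/-- The messages received by `v` when every node `u` sends `m u a` to its neighbor of address
`a`. -/
def Net.inbox {Addr M : Type} (N : Net Addr) (m : N.V → Addr → M) (v : N.V) (j : Addr) :
    Option M :=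
  if h : ∃ u, N.G.Adj v u ∧ N.addr u = j then some (m h.choose (N.addr v)) else none

section Inbox

variable {Addr M : Type} (N : Net Addr)

theorem Net.inbox_adj (m : N.V → Addr → M) {v u : N.V} (h : N.G.Adj v u) :
    N.inbox m v (N.addr u) = some (m u (N.addr v)) := by
  have hex : ∃ w, N.G.Adj v w ∧ N.addr w = N.addr u := ⟨u, h, rfl⟩
  have : hex.choose = u := N.inj hex.choose_spec.2
  simp only [Net.inbox, dif_pos hex, this]

theorem Net.inbox_none (m : N.V → Addr → M) {v : N.V} {j : Addr}
    (h : ¬ ∃ u, N.G.Adj v u ∧ N.addr u = j) : N.inbox m v j = none := by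
  simp only [Net.inbox, dif_neg h]

theorem Net.inbox_eq_some (m : N.V → Addr → M) {v : N.V} {j : Addr} {x : M} :
    N.inbox m v j = some x ↔ ∃ u, N.G.Adj v u ∧ N.addr u = j ∧ m u (N.addr v) = x := by
  constructor
  · intro h
    by_cases hex : ∃ u, N.G.Adj v u ∧ N.addr u = j
    · obtain ⟨u, hu, rfl⟩ := hex
      rw [N.inbox_adj m hu] at h
      exact ⟨u, hu, rfl, by simpa using h⟩
    · rw [N.inbox_none m hex] at h
      cases h
  · rintro ⟨u, hu, rfl, rfl⟩
    exact N.inbox_adj m hu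

end Inbox

/-- A family of node labellings, one for every instance of a problem. -/
abbrev Fam {Addr : Type} {J : Type 1} (N : J → Net Addr) (α : Type) : Type 1 :=
  ∀ I, (N I).V → α

/-! ### Calculus of labels computable in a given number of rounds -/

section Solves

variable {Addr : Type} {J : Type 1} {N : J → Net Addr} {Msg : Type} {α β γ δ : Type}

/-- The label `g` can be computed from the label `f` without communication. -/
def Det (f : Fam N α) (g : Fam N β) : Prop :=
  ∃ h : α → β, ∀ I v, g I v = h (f I v)

variable (Msg) in
/-- Nodes that know the label `f` can compute the label `g` in `t` rounds with messages in
`Msg`. -/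
def Solves : ℕ → ∀ {α β : Type}, Fam N α → Fam N β → Prop
  | 0, _, _, f, g => Det f g
  | t + 1, α, _, f, g =>
    ∃ (γ : Type) (m : α → Addr → Msg) (u : α → (Addr → Option Msg) → γ),
      Solves t (fun I v => u (f I v) ((N I).inbox (fun w => m (f I w)) v) : Fam N γ) g

variable (Msg) in
/-- Nodes that know `f` can compute `g` in `t` rounds, and still know `f` afterwards. -/
def Learn (t : ℕ) (f : Fam N α) (g : Fam N β) : Prop :=
  Solves Msg t f (fun I v => (f I v, g I v))

variable {f : Fam N α} {g : Fam N β} {k : Fam N γ}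

theorem Det.refl (f : Fam N α) : Det f f := ⟨id, fun _ _ => rfl⟩

theorem Det.trans (h₁ : Det f g) (h₂ : Det g k) : Det f k := by
  obtain ⟨a, ha⟩ := h₁
  obtain ⟨b, hb⟩ := h₂
  exact ⟨b ∘ a, fun I v => by rw [hb, ha]; rfl⟩

theorem Det.const (x : β) : Det f (fun _ _ => x : Fam N β) := ⟨fun _ => x, fun _ _ => rfl⟩

theorem Det.map (h : Det f g) (φ : β → γ) : Det f (fun I v => φ (g I v) : Fam N γ) := by
  obtain ⟨a, ha⟩ := h
  exact ⟨φ ∘ a, fun I v => by simp only [ha]; rfl⟩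

theorem Det.map₂ (h : Det f g) (h' : Det f k) (φ : β → γ → δ) :
    Det f (fun I v => φ (g I v) (k I v) : Fam N δ) := by
  obtain ⟨a, ha⟩ := h
  obtain ⟨b, hb⟩ := h'
  exact ⟨fun x => φ (a x) (b x), fun I v => by simp only [ha, hb]⟩

theorem Det.map₃ {ε : Type} {l : Fam N δ} (h : Det f g) (h' : Det f k) (h'' : Det f l)
    (φ : β → γ → δ → ε) : Det f (fun I v => φ (g I v) (k I v) (l I v) : Fam N ε) :=
  (h.map₂ h' φ).map₂ h'' fun x y => x y

theorem Det.pair (h : Det f g) (h' : Det f k) : Det f (fun I v => (g I v, k I v) : Fam N _) :=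
  h.map₂ h' Prod.mk

theorem Det.fst : Det (fun I v => (f I v, g I v) : Fam N _) f := ⟨Prod.fst, fun _ _ => rfl⟩

theorem Det.snd : Det (fun I v => (f I v, g I v) : Fam N _) g := ⟨Prod.snd, fun _ _ => rfl⟩

theorem Det.mono (h : Det f g) : Det (fun I v => (f I v, k I v) : Fam N _) g := Det.fst.trans h

/-- Local computation between the two stages is free: it is absorbed into the first message and the
first update of the second stage. -/
theorem Solves.comp {s t : ℕ} (h₁ : Solves Msg s f g) (h₂ : Solves Msg t g k) :
    Solves Msg (s + t) f k := by
  induction s generalizing α with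
  | zero =>
    obtain ⟨a, ha⟩ := h₁
    have hg : g = fun I v => a (f I v) := by funext I v; exact ha I v
    subst hg
    rw [Nat.zero_add]
    cases t with
    | zero => exact Det.trans (g := fun I v => a (f I v)) ⟨a, fun _ _ => rfl⟩ h₂
    | succ t =>
      obtain ⟨η, m, u, h⟩ := h₂
      exact ⟨η, fun x => m (a x), fun x => u (a x), h⟩
  | succ s ih =>
    obtain ⟨η, m, u, h⟩ := h₁
    rw [Nat.succ_add]
    exact ⟨η, m, u, ih h⟩

theorem Solves.pre {t : ℕ} (h₁ : Det f g) (h₂ : Solves Msg t g k) : Solves Msg t f k := by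
  have := Solves.comp (Msg := Msg) (s := 0) h₁ h₂
  rwa [Nat.zero_add] at this

theorem Solves.post {t : ℕ} (h₁ : Solves Msg t f g) (h₂ : Det g k) : Solves Msg t f k :=
  Solves.comp (t := 0) h₁ h₂

/-- Memory is unrestricted, so any further label can be carried along. This is what turns `Solves`
into the cumulative `Learn`. -/
theorem Solves.frame {t : ℕ} (h : Solves Msg t f g) (e : Fam N δ) :
    Solves Msg t (fun I v => (e I v, f I v) : Fam N _) (fun I v => (e I v, g I v) : Fam N _) := by
  induction t generalizing α with
  | zero =>
    obtain ⟨a, ha⟩ := h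
    exact ⟨fun x => (x.1, a x.2), fun I v => by simp only [ha]⟩
  | succ t ih =>
    obtain ⟨η, m, u, h⟩ := h
    exact ⟨δ × η, fun x => m x.2, fun x y => (x.1, u x.2 y), ih h⟩

theorem Learn.of {t : ℕ} (h₁ : Det f g) (h₂ : Solves Msg t g k) : Learn Msg t f k :=
  Solves.pre ((Det.refl f).pair h₁) (h₂.frame f)

theorem Learn.det {t : ℕ} {l : Fam N δ} (h : Learn Msg t f g)
    (h' : Det (fun I v => (f I v, g I v) : Fam N _) l) : Learn Msg t f l :=
  Solves.post h (Det.fst.pair h')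

theorem Learn.trans {s t : ℕ} (h₁ : Learn Msg s f g)
    (h₂ : Learn Msg t (fun I v => (f I v, g I v) : Fam N _) k) :
    Learn Msg (s + t) f (fun I v => (g I v, k I v) : Fam N _) :=
  (Solves.comp h₁ h₂).post ⟨fun x => (x.1.1, x.1.2, x.2), fun _ _ => rfl⟩

/-- One round of communication. -/
theorem Learn.inbox (m : Fam N (Addr → Msg)) (hm : Det f m) :
    Learn Msg 1 f (fun I v => (N I).inbox (m I) v) := by
  refine Learn.of hm ?_
  exact ⟨_, fun x => x, fun _ y => y, Det.refl _⟩

theorem Solves.exists_algorithm {b B t : ℕ} {N : J → Net (Ident b)} {f : Fam N α} {g : Fam N β}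
    (h : Solves (Message B) t f g) :
    ∃ A : CongestAlgorithm b B α β,
      ∀ I v, A.output (A.run (N I).G (N I).addr (f I) t v) = g I v := by
  induction t generalizing α with
  | zero =>
    obtain ⟨a, ha⟩ := h
    exact ⟨⟨α, id, fun _ _ _ => false, fun s _ => s, a⟩, fun I v => (ha I v).symm⟩
  | succ t ih =>
    obtain ⟨η, m, u, h⟩ := h
    obtain ⟨A, hA⟩ := ih h
    -- The first round differs from the later ones, so the state is a sum: the initial knowledge
    -- before that round, a state of the algorithm for the remaining rounds after it.
    let A' : CongestAlgorithm b B α β :=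
      { State := α ⊕ A.State
        init := Sum.inl
        send := Sum.elim m A.send
        receive := fun s x =>
          Sum.inr (Sum.elim (fun a => A.init (u a x)) (fun s => A.receive s x) s)
        output := Sum.elim (fun a => A.output (A.init (u a fun _ => none))) A.output }
    have key : ∀ I t v, A'.run (N I).G (N I).addr (f I) (t + 1) v =
        Sum.inr (A.run (N I).G (N I).addr
          (fun v => u (f I v) ((N I).inbox (fun w => m (f I w)) v)) t v) := by
      intro I t
      induction t with
      | zero => intro v; rfl
      | succ t iht =>
        intro v
        rw [CongestAlgorithm.run]
        simp only [iht]
        rfl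
    refine ⟨A', fun I v => ?_⟩
    rw [key]
    exact hA I v

end Solves

/-! ### Communication primitives -/

/-- The values received by `v`, with a default value at addresses of no neighbor. -/
def Net.recv {Addr M : Type} [Inhabited M] (N : Net Addr) (m : N.V → Addr → M) (v : N.V)
    (a : Addr) : M :=
  (N.inbox m v a).getD default

theorem Net.recv_adj {Addr M : Type} [Inhabited M] (N : Net Addr) (m : N.V → Addr → M)
    {v u : N.V} (h : N.G.Adj v u) : N.recv m v (N.addr u) = m u (N.addr v) := by
  rw [Net.recv, N.inbox_adj m h, Option.getD_some]

/-- The addresses of the neighbors that send a positive bit to `v`. -/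
def Net.heard {Addr : Type} (N : Net Addr) (m : N.V → Addr → Prop) (v : N.V) : Set Addr :=
  {a | ∃ u, N.G.Adj v u ∧ N.addr u = a ∧ m u (N.addr v)}

/-- A rooted forest in a network, given by parent pointers along edges. -/
structure Forest {Addr : Type} (N : Net Addr) where
  par : N.V → Option N.V
  root : N.V → N.V
  depth : N.V → ℕ
  par_adj : ∀ {x y}, par x = some y → N.G.Adj x y
  depth_none : ∀ {x}, par x = none → depth x = 0
  depth_some : ∀ {x y}, par x = some y → depth x = depth y + 1
  root_none : ∀ {x}, par x = none → root x = x
  root_some : ∀ {x y}, par x = some y → root x = root y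

/-! ### Rooted forests: induction along parents and construction from a rank -/

namespace Forest

variable {Addr : Type} {N : Net Addr}

/-- The address of the parent. -/
def parAddr (F : Forest N) (x : N.V) : Option Addr := (F.par x).map N.addr

theorem induct (F : Forest N) {P : N.V → Prop} (h₁ : ∀ x, F.par x = none → P x)
    (h₂ : ∀ x y, F.par x = some y → P y → P x) (x : N.V) : P x := by
  induction hd : F.depth x generalizing x with
  | zero =>
    cases hx : F.par x with
    | none => exact h₁ x hx
    | some y => have := F.depth_some hx; omega
  | succ d ih =>
    cases hx : F.par x with
    | none => exact h₁ x hx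
    | some y => exact h₂ x y hx (ih y (by have := F.depth_some hx; omega))

theorem par_root (F : Forest N) (x : N.V) : F.par (F.root x) = none :=
  F.induct (P := fun x => F.par (F.root x) = none)
    (fun x h => by rw [F.root_none h, h]) (fun x y h ih => by rw [F.root_some h, ih]) x

theorem root_root (F : Forest N) (x : N.V) : F.root (F.root x) = F.root x :=
  F.root_none (F.par_root x)

theorem parAddr_eq_none (F : Forest N) {x : N.V} : F.parAddr x = none ↔ F.par x = none := by
  simp [parAddr]

theorem parAddr_eq_some (F : Forest N) {x y : N.V} :
    F.parAddr x = some (N.addr y) ↔ F.par x = some y := by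
  simp only [parAddr, Option.map_eq_some_iff]
  constructor
  · rintro ⟨z, hz, h⟩
    rw [hz, N.inj h]
  · intro h
    exact ⟨y, h, rfl⟩

/-- The root reached by at most `n` parent steps, and the number of these steps. -/
def climb (par : N.V → Option N.V) : ℕ → N.V → N.V × ℕ
  | 0, x => (x, 0)
  | n + 1, x =>
    match par x with
    | none => (x, 0)
    | some y => ((climb par n y).1, (climb par n y).2 + 1)

theorem climb_none {par : N.V → Option N.V} {x : N.V} (h : par x = none) (n : ℕ) :
    climb par n x = (x, 0) := by
  cases n with
  | zero => rfl
  | succ n => rw [climb, h]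

theorem climb_some {par : N.V → Option N.V} {x y : N.V} (h : par x = some y) (n : ℕ) :
    climb par (n + 1) x = ((climb par n y).1, (climb par n y).2 + 1) := by
  rw [climb, h]

/-- The rank bounds the number of parent steps, so any step budget of at least the rank already
reaches the root. -/
theorem climb_congr {par : N.V → Option N.V} {rank : N.V → ℕ}
    (hrank : ∀ {x y}, par x = some y → rank y < rank x) {m n : ℕ} {x : N.V} (hm : rank x ≤ m)
    (hn : rank x ≤ n) : climb par m x = climb par n x := by
  induction m generalizing n x with
  | zero =>
    cases hx : par x with
    | none => rw [climb_none hx, climb_none hx]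
    | some y => have := hrank hx; omega
  | succ m ih =>
    cases hx : par x with
    | none => rw [climb_none hx, climb_none hx]
    | some y =>
      have := hrank hx
      obtain ⟨n, rfl⟩ : ∃ k, n = k + 1 := ⟨n - 1, by omega⟩
      rw [climb_some hx, climb_some hx, ih (n := n) (by omega) (by omega)]

/-- Parent pointers along which a rank decreases define a forest. -/
def ofRank (par : N.V → Option N.V) (rank : N.V → ℕ)
    (hadj : ∀ {x y}, par x = some y → N.G.Adj x y)
    (hrank : ∀ {x y}, par x = some y → rank y < rank x) : Forest N where
  par := par
  root x := (climb par (rank x) x).1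
  depth x := (climb par (rank x) x).2
  par_adj := hadj
  depth_none h := by rw [climb_none h]
  depth_some {x y} h := by
    have h1 := hrank h
    rw [climb_congr hrank le_rfl (Nat.le_succ (rank x)), climb_some h,
      climb_congr hrank h1.le le_rfl]
  root_none h := by rw [climb_none h]
  root_some {x y} h := by
    have h1 := hrank h
    rw [climb_congr hrank le_rfl (Nat.le_succ (rank x)), climb_some h,
      climb_congr hrank h1.le le_rfl]

theorem ofRank_depth_le (par : N.V → Option N.V) (rank : N.V → ℕ)
    (hadj : ∀ {x y}, par x = some y → N.G.Adj x y)
    (hrank : ∀ {x y}, par x = some y → rank y < rank x) (x : N.V) :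
    (ofRank par rank hadj hrank).depth x ≤ rank x := by
  refine (ofRank par rank hadj hrank).induct (P := fun x => _ ≤ rank x) (fun x h => ?_)
    (fun x y h ih => ?_) x
  · rw [Forest.depth_none _ h]
    exact Nat.zero_le _
  · rw [Forest.depth_some _ h]
    exact lt_of_le_of_lt ih (hrank h)

end Forest

/-- Values in `M` can be written with `q` digits in `W`. -/
def Fits (q : ℕ) (W M : Type) : Prop := ∃ e : M → Fin q → W, Function.Injective e

section Primitives

variable {Addr : Type} {J : Type 1} {N : J → Net Addr} {W : Type} {α : Type} {f : Fam N α}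

/-- Every node sends a value to each neighbor, one digit per round. -/
theorem Learn.recv {q : ℕ} {M : Type} [Inhabited M] (hM : Fits q W M) (hq : 0 < q)
    (m : Fam N (Addr → M)) (hm : Det f m) :
    Learn (Option W) q f (fun I v => (N I).recv (m I) v) := by
  obtain ⟨e, he⟩ := hM
  let digit : M → ℕ → Option W := fun x k => if h : k < q then some (e x ⟨k, h⟩) else none
  -- The digits received in the first `t` rounds; digit `k` travels in round `k`.
  let K : ℕ → Fam N (ℕ → Addr → Option (Option W)) := fun t I v k a =>
    if k < t then (N I).inbox (fun u a => digit (m I u a) k) v a else none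
  have step : ∀ t, Learn (Option W) t f (K t) := by
    intro t
    induction t with
    | zero => exact ⟨fun x => (x, fun _ _ => none), fun I v => by simp [K]⟩
    | succ t ih =>
      have h1 := Learn.inbox (f := fun I v => (f I v, K t I v))
        (fun I v a => digit (m I v a) t : Fam N (Addr → Option W))
        ((hm.map fun x a => digit (x a) t).mono)
      refine (ih.trans h1).det ?_
      refine ⟨fun x k => if k = t then x.2.2 else x.2.1 k, fun I v => ?_⟩
      funext k a
      by_cases hk : k = t
      · subst hk
        simp [K]
      · have : k < t + 1 ↔ k < t := by omega
        simp [K, hk, this]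
  refine (step q).det ?_
  let dec : (ℕ → Option (Option W)) → M := fun y =>
    if h : ∃ x : M, ∀ k < q, y k = some (digit x k) then h.choose else default
  refine ⟨fun x a => dec fun k => x.2 k a, fun I v => ?_⟩
  funext a
  by_cases hex : ∃ u, (N I).G.Adj v u ∧ (N I).addr u = a
  · obtain ⟨u, hu, rfl⟩ := hex
    show (N I).recv (m I) v ((N I).addr u) = dec fun k => K q I v k ((N I).addr u)
    rw [Net.recv_adj _ _ hu]
    have hK : ∀ k < q, K q I v k ((N I).addr u) = some (digit (m I u ((N I).addr v)) k) := by
      intro k hk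
      simp only [K, if_pos hk, Net.inbox_adj _ _ hu]
    have hx : ∃ x : M, ∀ k < q, K q I v k ((N I).addr u) = some (digit x k) := ⟨_, hK⟩
    simp only [dec, dif_pos hx]
    apply he
    funext k
    have h1 := hx.choose_spec k k.2
    rw [hK k k.2] at h1
    simpa [digit] using h1
  · show (N I).recv (m I) v a = dec fun k => K q I v k a
    rw [Net.recv, Net.inbox_none _ _ hex]
    -- Here `0 < q` matters: without any digit, silence from a non-neighbor would decode to some
    -- value instead of the default.
    have hx : ¬ ∃ x : M, ∀ k < q, K q I v k a = some (digit x k) := by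
      rintro ⟨x, hx⟩
      have := hx 0 hq
      simp [K, hq, Net.inbox_none _ _ hex] at this
    simp only [dec, dif_neg hx, Option.getD_none]

/-- Pipelined broadcast of a value from the roots of a forest. -/
theorem Learn.broadcast {q H : ℕ} {M : Type} [Nonempty M] (hM : Fits q W M)
    (F : ∀ I, Forest (N I)) (hH : ∀ I v, (F I).depth v ≤ H)
    (hF : Det f (fun I v => (F I).parAddr v)) (val : Fam N M) (hval : Det f val) :
    Learn (Option W) (H + q) f (fun I v => val I ((F I).root v)) := by
  obtain ⟨e, he⟩ := hM
  let D : Fam N (List W) := fun I v => List.ofFn (e (val I ((F I).root v)))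
  -- The pipelining invariant: after `t` rounds a node at depth `d` holds the first `t + 1 - d`
  -- digits. It always forwards its last digit, which is exactly the next one its children lack.
  let K : ℕ → Fam N (List W) := fun t I v => (D I v).take (t + 1 - (F I).depth v)
  have hlen : ∀ I v, (D I v).length = q := fun I v => by simp [D]
  have hroot : ∀ I v, (F I).parAddr v = none → ∀ t, K t I v =
      (List.ofFn (e (val I v))).take (t + 1) := by
    intro I v h t
    rw [Forest.parAddr_eq_none] at h
    simp only [K, D, (F I).root_none h, (F I).depth_none h, Nat.sub_zero]
  have step : ∀ t, Learn (Option W) t f (K t) := by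
    intro t
    induction t with
    | zero =>
      refine (Det.refl f).pair ((hF.map₂ hval fun p x =>
        if p = none then (List.ofFn (e x)).take 1 else []).trans ⟨id, fun I v => ?_⟩)
      by_cases h : (F I).parAddr v = none
      · simp [h, hroot I v h]
      · simp only [if_neg h, id]
        rw [Forest.parAddr_eq_none, ← ne_eq, Option.ne_none_iff_exists'] at h
        obtain ⟨y, hy⟩ := h
        simp [K, (F I).depth_some hy]
    | succ t ih =>
      have h1 := Learn.inbox (f := fun I v => (f I v, K t I v))
        (fun I v _ => (K t I v).getLast? : Fam N (Addr → Option W))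
        (Det.snd.map fun (x : List W) _ => x.getLast?)
      refine (ih.trans h1).det ?_
      have h2 : Det (fun I v => (f I v, K t I v, (N I).inbox
          (fun v _ => (K t I v).getLast?) v)) (fun I v => (F I).parAddr v) := hF.mono
      have h3 : Det (fun I v => (f I v, K t I v, (N I).inbox
          (fun v _ => (K t I v).getLast?) v)) val := hval.mono
      refine (h2.map₃ h3 Det.snd fun p x y => match p with
        | none => (List.ofFn (e x)).take (t + 2)
        | some a => if y.1.length < q then y.1 ++ (y.2 a).join.toList else y.1).trans
          ⟨id, fun I v => ?_⟩
      cases hp : (F I).par v with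
      | none =>
        rw [← Forest.parAddr_eq_none] at hp
        simp [hp, hroot I v hp]
      | some y =>
        have hpa := (F I).parAddr_eq_some.2 hp
        have hd := (F I).depth_some hp
        have hD : D I v = D I y := by simp only [D, (F I).root_some hp]
        simp only [hpa, id, Net.inbox_adj _ _ ((F I).par_adj hp)]
        simp only [K, hD, hd, Option.join_some]
        by_cases h1 : t < (F I).depth y
        · have e1 : t + 1 + 1 - ((F I).depth y + 1) = 0 := by omega
          have e2 : t + 1 - ((F I).depth y + 1) = 0 := by omega
          have e3 : t + 1 - (F I).depth y = 0 := by omega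
          simp [e1, e2, e3]
        · obtain ⟨s, rfl⟩ : ∃ s, t = (F I).depth y + s := ⟨t - (F I).depth y, by omega⟩
          have e1 : (F I).depth y + s + 1 + 1 - ((F I).depth y + 1) = s + 1 := by omega
          have e2 : (F I).depth y + s + 1 - ((F I).depth y + 1) = s := by omega
          have e3 : (F I).depth y + s + 1 - (F I).depth y = s + 1 := by omega
          rw [e1, e2, e3]
          -- Once all `q` digits have arrived, the parent repeats its last one and the child must
          -- not append it.
          by_cases hs : s < q
          · have hs' : s < (D I y).length := by rw [hlen]; exact hs
            rw [if_pos (by rw [List.length_take]; omega), List.take_succ_eq_append_getElem hs',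
              List.getLast?_concat]
            rfl
          · rw [if_neg (by rw [List.length_take, hlen]; omega),
              List.take_of_length_le (by rw [hlen]; omega),
              List.take_of_length_le (by rw [hlen]; omega)]
  refine (step (H + q)).det (Det.trans (g := D) ?_ ?_)
  · refine Det.snd.trans ⟨id, fun I v => ?_⟩
    simp only [K, id]
    rw [List.take_of_length_le]
    rw [hlen]
    have := hH I v
    omega
  · refine ⟨Function.invFun fun x => List.ofFn (e x), fun I v => ?_⟩
    exact (Function.leftInverse_invFun (f := fun x => List.ofFn (e x))
      (List.ofFn_injective.comp he) _).symm

variable [Nonempty W]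

/-- One bit, as a message. -/
def bitMsg (W : Type) [Nonempty W] (p : Prop) : Option W :=
  if p then some (Classical.arbitrary W) else none

theorem bitMsg_eq_none {p : Prop} : bitMsg W p = none ↔ ¬ p := by
  unfold bitMsg
  split_ifs with h <;> simp [h]

/-- The addresses of the children of `v` that satisfy `g`. -/
def Forest.childSet {N : Net Addr} (F : Forest N) (g : N.V → Prop) (v : N.V) : Set Addr :=
  {a | ∃ y, F.par y = some v ∧ N.addr y = a ∧ g y}

/-- One round in which every node sends one bit to each neighbor. -/
theorem Learn.heard (m : Fam N (Addr → Prop)) (hm : Det f m) :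
    Learn (Option W) 1 f (fun I v => (N I).heard (m I) v) := by
  have h1 := Learn.inbox (Msg := Option W) (f := f) (fun I v a => bitMsg W (m I v a))
    (hm.map fun x a => bitMsg W (x a))
  refine h1.det (Det.snd.trans ⟨fun y => {a | ∃ w : W, y a = some (some w)}, fun I v => ?_⟩)
  ext a
  simp only [Net.heard, Set.mem_ofPred_eq, Net.inbox_eq_some]
  constructor
  · rintro ⟨y, hy, rfl, hg⟩
    exact ⟨Classical.arbitrary W, y, hy, rfl, by rw [bitMsg, if_pos hg]⟩
  · rintro ⟨w, u, h, rfl, hu⟩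
    have : ¬ (bitMsg W (m I u ((N I).addr v)) = none) := by rw [hu]; simp
    rw [bitMsg_eq_none, not_not] at this
    exact ⟨u, h, rfl, this⟩

/-- One round in which every node sends one bit to its parent. -/
theorem Learn.childSet (F : ∀ I, Forest (N I)) (hF : Det f (fun I v => (F I).parAddr v))
    (g : Fam N Prop) (hg : Det f g) :
    Learn (Option W) 1 f (fun I v => (F I).childSet (g I) v) := by
  have h1 := Learn.heard (W := W) (f := f) (fun I v a => (F I).parAddr v = some a ∧ g I v)
    (hF.map₂ hg fun p x a => p = some a ∧ x)
  refine h1.det (Det.snd.trans ⟨id, fun I v => ?_⟩)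
  ext a
  simp only [Forest.childSet, Net.heard, Set.mem_ofPred_eq, id]
  refine exists_congr fun y => ?_
  rw [(F I).parAddr_eq_some]
  exact ⟨fun h => ⟨((F I).par_adj h.1).symm, h.2.1, h.1, h.2.2⟩, fun h => ⟨h.2.2.1, h.2.1, h.2.2.2⟩⟩

/-- Aggregation of one bit per node from the leaves of a forest to the roots. -/
theorem Learn.up {H : ℕ} (F : ∀ I, Forest (N I)) (hH : ∀ I v, (F I).depth v ≤ H)
    (hF : Det f (fun I v => (F I).parAddr v)) (φ : Fam N (Set Addr → Prop)) (hφ : Det f φ) :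
    ∃ g : Fam N Prop, (∀ I v, g I v = φ I v ((F I).childSet (g I) v)) ∧
      Learn (Option W) (H + 2) f (fun I v => (F I).childSet (g I) v) := by
  -- The recursion is iterated from the arbitrary start `False`. Values settle from the leaves
  -- upwards, and after `H + 1` iterations they form a fixed point; the last round only reports them
  -- to the parents.
  obtain ⟨a, ha_zero, ha⟩ : ∃ a : ℕ → Fam N Prop, (∀ I v, a 0 I v = False) ∧
      ∀ t I v, a (t + 1) I v = φ I v ((F I).childSet (a t I) v) :=
    ⟨fun t I => t.rec (fun _ => False) fun _ g v => φ I v ((F I).childSet g v),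
      fun _ _ => rfl, fun _ _ _ => rfl⟩
  have stable : ∀ I t v, H < t + (F I).depth v → a (t + 1) I v = a t I v := by
    intro I t
    induction t with
    | zero => intro v hv; have := hH I v; omega
    | succ t ih =>
      intro v hv
      rw [ha, ha]
      congr 1
      ext b
      simp only [Forest.childSet, Set.mem_ofPred_eq]
      refine exists_congr fun y => and_congr_right fun hy => and_congr_right fun _ => ?_
      rw [ih y (by rw [(F I).depth_some hy]; omega)]
  have step : ∀ t, Learn (Option W) t f (a t) := by
    intro t
    induction t with
    | zero => exact ⟨fun x => (x, False), fun I v => by simp only [ha_zero]⟩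
    | succ t ih =>
      have h1 := Learn.childSet (W := W) (f := fun I v => (f I v, a t I v)) F hF.mono (a t) Det.snd
      refine (ih.trans h1).det ?_
      rw [show a (t + 1) = fun I v => φ I v ((F I).childSet (a t I) v) from
        funext fun I => funext fun v => ha t I v]
      exact (hφ.mono).map₂ (Det.snd.map Prod.snd) fun x y => x y
  refine ⟨a (H + 1), fun I v => ?_, ?_⟩
  · exact (stable I (H + 1) v (by omega)).symm.trans (ha _ _ _)
  · have h1 := Learn.childSet (W := W) (f := fun I v => (f I v, a (H + 1) I v)) F hF.mono
      (a (H + 1)) Det.snd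
    exact ((step (H + 1)).trans h1).det (Det.snd.map Prod.snd)

/-- Distribution of one bit per node from the roots of a forest to the leaves. -/
theorem Learn.down {H : ℕ} (F : ∀ I, Forest (N I)) (hH : ∀ I v, (F I).depth v ≤ H)
    (hF : Det f (fun I v => (F I).parAddr v)) (base : Fam N Prop) (hbase : Det f base)
    (ψ : Fam N (Prop → Addr → Prop)) (hψ : Det f ψ) :
    ∃ g : Fam N Prop, (∀ I v, (F I).par v = none → g I v = base I v) ∧
      (∀ I v p, (F I).par v = some p → g I v = ψ I p (g I p) ((N I).addr v)) ∧
      Learn (Option W) (H + 1) f g := by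
  obtain ⟨a, ha_zero, ha0, ha1⟩ : ∃ a : ℕ → Fam N Prop, (∀ I v, a 0 I v = False) ∧
      (∀ t I v, (F I).par v = none → a (t + 1) I v = base I v) ∧
      ∀ t I v p, (F I).par v = some p → a (t + 1) I v = ψ I p (a t I p) ((N I).addr v) := by
    refine ⟨fun t I => t.rec (fun _ => False) fun _ g v =>
      match (F I).par v with
      | none => base I v
      | some p => ψ I p (g p) ((N I).addr v), fun _ _ => rfl, fun t I v h => ?_,
      fun t I v p h => ?_⟩
    · simp only [h]
    · simp only [h]
  -- The arbitrary start value is forgotten from the root downwards, one depth per round.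
  have stable : ∀ I t v, (F I).depth v < t → a (t + 1) I v = a t I v := by
    intro I t
    induction t with
    | zero => intro v hv; omega
    | succ t ih =>
      intro v hv
      cases h : (F I).par v with
      | none => rw [ha0 _ _ _ h, ha0 _ _ _ h]
      | some p =>
        rw [ha1 _ _ _ _ h, ha1 _ _ _ _ h, ih]
        have := (F I).depth_some h
        omega
  have step : ∀ t, Learn (Option W) t f (a t) := by
    intro t
    induction t with
    | zero => exact ⟨fun x => (x, False), fun I v => by simp only [ha_zero]⟩
    | succ t ih =>
      have h1 := Learn.inbox (Msg := Option W) (f := fun I v => (f I v, a t I v))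
        (fun I v b => bitMsg W (ψ I v (a t I v) b))
        (hψ.mono.map₂ Det.snd fun x y b => bitMsg W (x y b))
      refine (ih.trans h1).det ?_
      refine ((hF.mono).map₃ (hbase.mono) (Det.snd.map Prod.snd) fun p x y => match p with
        | none => x
        | some b => y b ≠ some none).trans ⟨id, fun I v => ?_⟩
      cases h : (F I).par v with
      | none =>
        rw [ha0 _ _ _ h]
        rw [← Forest.parAddr_eq_none] at h
        simp [h]
      | some p =>
        rw [ha1 _ _ _ _ h]
        simp [(F I).parAddr_eq_some.2 h, Net.inbox_adj _ _ ((F I).par_adj h), bitMsg_eq_none]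
  refine ⟨a (H + 1), fun I v h => ha0 _ _ _ h, fun I v p h => ?_, step _⟩
  rw [ha1 _ _ _ _ h]
  rw [stable I H p]
  have := (F I).depth_some h
  have := hH I v
  omega

end Primitives

/-! ### Leaders of trees -/

/-- An element of a set, if there is one. -/
def pick {A : Type} (S : Set A) : Option A := if h : S.Nonempty then some h.choose else none

theorem pick_mem {A : Type} {S : Set A} {a : A} (h : pick S = some a) : a ∈ S := by
  unfold pick at h
  split_ifs at h with hS
  · cases h
    exact hS.choose_spec

theorem exists_pick {A : Type} {S : Set A} (h : S.Nonempty) : ∃ a ∈ S, pick S = some a :=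
  ⟨h.choose, h.choose_spec, by rw [pick, dif_pos h]⟩

/-- The leader of the tree of `v` in `F`: the node that is reached from the root of this tree along
the parent pointers of `P`. -/
def lead {Addr : Type} {N : Net Addr} (F P : Forest N) (v : N.V) : N.V := P.root (F.root v)

theorem lead_congr {Addr : Type} {N : Net Addr} {F P : Forest N} {v w : N.V}
    (h : F.root v = F.root w) : lead F P v = lead F P w := by rw [lead, h, lead]

section Leaders

variable {Addr : Type} {J : Type 1} {N : J → Net Addr} {W : Type} {α : Type} {f : Fam N α}

/-- Pipelined broadcast of a value from the leaders to all nodes of their trees. -/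
theorem Learn.leadcast {q H : ℕ} {M : Type} [Nonempty M] (hM : Fits q W M)
    {F P : ∀ I, Forest (N I)} (hH : ∀ I v, (F I).depth v ≤ H) (hP : ∀ I v, (P I).depth v ≤ H)
    (hFa : Det f (fun I v => (F I).parAddr v)) (hPa : Det f (fun I v => (P I).parAddr v))
    (val : Fam N M) (hval : Det f val) :
    Learn (Option W) (2 * (H + q)) f (fun I v => val I (lead (F I) (P I) v)) := by
  have h1 := Learn.broadcast hM P hP hPa val hval
  have h2 := Learn.broadcast (f := fun I v => (f I v, val I ((P I).root v))) hM F hH hFa.mono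
    (fun I v => val I ((P I).root v)) Det.snd
  rw [two_mul]
  exact (h1.trans h2).det (Det.snd.map Prod.snd)

/-- Every tree that contains an item selects one of them as its leader. -/
theorem Learn.select [Nonempty W] {H : ℕ} {F : ∀ I, Forest (N I)}
    (hH : ∀ I v, (F I).depth v ≤ H) (hFa : Det f (fun I v => (F I).parAddr v))
    (item : Fam N Prop) (hitem : Det f item) :
    ∃ P : ∀ I, Forest (N I), (∀ I v, (P I).depth v ≤ H) ∧
      (∀ I v, (F I).root (lead (F I) (P I) v) = (F I).root v) ∧
      (∀ I v, item I v → item I (lead (F I) (P I) v)) ∧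
      Learn (Option W) (2 * H + 3) f (fun I v => ((P I).parAddr v,
        (item I v ∧ lead (F I) (P I) v = v : Prop))) := by
  -- `g` says that the subtree below the node contains an item.
  obtain ⟨g, hg, hup⟩ := Learn.up (W := W) F hH hFa (fun I v S => item I v ∨ S.Nonempty)
    (hitem.map fun x (S : Set Addr) => x ∨ S.Nonempty)
  let S : Fam N (Set Addr) := fun I v => (F I).childSet (g I) v
  have hS : Det (fun I v => (f I v, S I v)) S := Det.snd
  have hi : Det (fun I v => (f I v, S I v)) item := hitem.mono
  -- A token starts at each root whose tree contains an item. A holder that is no item passes it to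
  -- one child with an item below, so the token stops at an item, the leader.
  obtain ⟨tok, ht0, ht1, hdown⟩ := Learn.down (W := W) (f := fun I v => (f I v, S I v)) F hH
    hFa.mono g ((hi.map₂ hS fun x S => x ∨ S.Nonempty).trans ⟨id, fun I v => hg I v⟩)
    (fun I v x a => x ∧ ¬ item I v ∧ pick (S I v) = some a)
    (hi.map₂ hS fun y S x a => x ∧ ¬ y ∧ pick S = some a)
  -- The route of the token, taken as parent pointers of a second forest: the leader is then the
  -- root that the old root reaches in it. The rank `H - depth` decreases because these pointers
  -- lead downwards.
  let par : ∀ I, (N I).V → Option (N I).V := fun I v =>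
    if h : tok I v ∧ ¬ item I v ∧ ∃ y, (F I).par y = some v ∧ pick (S I v) = some ((N I).addr y)
    then some h.2.2.choose else none
  have par_iff : ∀ I v y, par I v = some y ↔ tok I v ∧ ¬ item I v ∧ (F I).par y = some v ∧
      pick (S I v) = some ((N I).addr y) := by
    intro I v y
    simp only [par]
    split_ifs with h
    · have hc := h.2.2.choose_spec
      constructor
      · intro e
        cases e
        exact ⟨h.1, h.2.1, hc⟩
      · rintro ⟨-, -, -, h4⟩
        rw [hc.2] at h4
        rw [(N I).inj (Option.some.inj h4)]
    · constructor
      · intro e; cases e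
      · rintro ⟨h1, h2, h3, h4⟩
        exact (h ⟨h1, h2, y, h3, h4⟩).elim
  have memS : ∀ I v y, pick (S I v) = some ((N I).addr y) → (F I).par y = some v ∧ g I y := by
    intro I v y h
    obtain ⟨z, hz, hzy, hgz⟩ := pick_mem h
    cases (N I).inj hzy
    exact ⟨hz, hgz⟩
  have hrank : ∀ I {x y}, par I x = some y → H - (F I).depth y < H - (F I).depth x := by
    intro I x y h
    have h1 := (F I).depth_some ((par_iff I x y).1 h).2.2.1
    have h2 := hH I y
    omega
  let P : ∀ I, Forest (N I) := fun I => Forest.ofRank (par I) (fun v => H - (F I).depth v)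
    (fun h => ((F I).par_adj ((par_iff I _ _).1 h).2.2.1).symm) (hrank I)
  have hPpar : ∀ I v, (P I).par v = par I v := fun _ _ => rfl
  have rootP : ∀ I v, (F I).root ((P I).root v) = (F I).root v := by
    intro I
    refine (P I).induct (fun x h => by rw [(P I).root_none h]) (fun x y h ih => ?_)
    rw [(P I).root_some h, ih, (F I).root_some ((par_iff I x y).1 h).2.2.1]
  have groot : ∀ I v, g I v → g I ((F I).root v) := by
    intro I
    refine (F I).induct (fun x h => by rw [(F I).root_none h]; exact id) (fun x y h ih hx => ?_)
    rw [(F I).root_some h]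
    apply ih
    rw [hg]
    exact Or.inr ⟨_, x, h, rfl, hx⟩
  have tokitem : ∀ I v, tok I v ∧ g I v → tok I ((P I).root v) ∧ item I ((P I).root v) := by
    intro I
    refine (P I).induct (fun x h hx => ?_) (fun x y h ih hx => ?_)
    · rw [(P I).root_none h]
      refine ⟨hx.1, ?_⟩
      by_contra hni
      have h2 := hx.2
      rw [hg] at h2
      obtain ⟨a, ⟨z, hz, rfl, -⟩, ha⟩ := exists_pick (h2.resolve_left hni)
      rw [hPpar, (par_iff I x z).2 ⟨hx.1, hni, hz, ha⟩] at h
      cases h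
    · rw [(P I).root_some h]
      obtain ⟨h1, h2, h3, h4⟩ := (par_iff I x y).1 h
      apply ih
      rw [ht1 I y x h3]
      exact ⟨⟨h1, h2, h4⟩, (memS I x y h4).2⟩
  -- All holders in a tree lie on a single route from its root. Hence an item is the leader exactly
  -- when it holds the token.
  have tokroot : ∀ I v, tok I v → (P I).root ((F I).root v) = (P I).root v := by
    intro I
    refine (F I).induct (fun x h _ => by rw [(F I).root_none h]) (fun x y h ih hx => ?_)
    rw [ht1 I x y h] at hx
    rw [(F I).root_some h, ih hx.1, (P I).root_some
      ((par_iff I y x).2 ⟨hx.1, hx.2.1, h, hx.2.2⟩)]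
  have gitem : ∀ I v, item I v → g I v := fun I v h => by rw [hg]; exact Or.inl h
  have leaditem : ∀ I v, item I v → tok I (lead (F I) (P I) v) ∧ item I (lead (F I) (P I) v) := by
    intro I v h
    have h1 := groot I v (gitem I v h)
    refine tokitem I _ ⟨?_, h1⟩
    rw [ht0 I _ ((F I).par_root v)]
    exact h1
  refine ⟨P, fun I v => (Forest.ofRank_depth_le _ _ _ _ v).trans (Nat.sub_le _ _), ?_, ?_, ?_⟩
  · intro I v
    rw [lead, rootP, (F I).root_root]
  · exact fun I v h => (leaditem I v h).2
  · rw [show 2 * H + 3 = H + 2 + (H + 1) by ring]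
    refine (hup.trans hdown).det ?_
    have d1 : Det (fun I v => (f I v, S I v, tok I v)) item := hitem.mono
    have d2 : Det (fun I v => (f I v, S I v, tok I v)) S := Det.snd.map Prod.fst
    have d3 : Det (fun I v => (f I v, S I v, tok I v)) tok := Det.snd.map Prod.snd
    refine (d1.map₃ d2 d3 fun x S t => (if t ∧ ¬ x then pick S else none, (t ∧ x : Prop))).trans
      ⟨id, fun I v => ?_⟩
    simp only [id, Prod.mk.injEq]
    constructor
    · split_ifs with h
      · cases hp : pick (S I v) with
        | none =>
          rw [Forest.parAddr_eq_none, hPpar]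
          simp [par, hp]
        | some a =>
          obtain ⟨y, hy, rfl, -⟩ := pick_mem hp
          rw [Forest.parAddr_eq_some, hPpar]
          exact (par_iff I v y).2 ⟨h.1, h.2, hy, hp⟩
      · rw [Forest.parAddr_eq_none, hPpar]
        simp only [par]
        rw [dif_neg fun h' => h ⟨h'.1, h'.2.1⟩]
    · apply propext
      constructor
      · rintro ⟨h1, h2⟩
        refine ⟨?_, h1⟩
        rw [← h2]
        exact (leaditem I v h1).1
      · rintro ⟨h1, h2⟩
        refine ⟨h2, ?_⟩
        rw [lead, tokroot I v h1]
        apply (P I).root_none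
        rw [hPpar]
        simp only [par]
        rw [dif_neg fun h' => h'.2.1 h2]

end Leaders

/-! ### Deterministic color reduction -/

/-- A position in which the binary expansions of `x` and `y` differ (0 if there is none). -/
def diffIndex (x y : ℕ) : ℕ := if h : ∃ i, x.testBit i ≠ y.testBit i then h.choose else 0

theorem diffIndex_spec {x y : ℕ} (h : x ≠ y) :
    x.testBit (diffIndex x y) ≠ y.testBit (diffIndex x y) := by
  have hex : ∃ i, x.testBit i ≠ y.testBit i := by
    by_contra hc
    push Not at hc
    exact h (Nat.eq_of_testBit_eq hc)
  rw [diffIndex, dif_pos hex]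
  exact hex.choose_spec

/-- The color that a node of color `x` with a successor of color `y` takes in one step of the
Cole–Vishkin color reduction. -/
def coleVishkin (x y : ℕ) : ℕ := 2 * diffIndex x y + (x.testBit (diffIndex x y)).toNat

/-- Equal new colors would mean the same index and the same bit there, but `x` and `y` differ at the
index chosen by `x`. Nothing is needed of `z`, so properness along pointers alone is preserved. -/
theorem coleVishkin_ne {x y : ℕ} (h : x ≠ y) (z : ℕ) : coleVishkin x y ≠ coleVishkin y z := by
  intro he
  have h1 := Bool.toNat_lt (x.testBit (diffIndex x y))
  have h2 := Bool.toNat_lt (y.testBit (diffIndex y z))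
  unfold coleVishkin at he
  have hi : diffIndex x y = diffIndex y z := by omega
  have hb : (x.testBit (diffIndex x y)).toNat = (y.testBit (diffIndex y z)).toNat := by omega
  rw [← hi] at hb
  apply diffIndex_spec h
  revert hb
  cases x.testBit (diffIndex x y) <;> cases y.testBit (diffIndex x y) <;> simp

theorem coleVishkin_lt {x y m : ℕ} (hx : x < 2 ^ m) (hy : y < 2 ^ m) (h : x ≠ y) :
    coleVishkin x y < 2 * m := by
  have h1 := Bool.toNat_lt (x.testBit (diffIndex x y))
  have h2 : diffIndex x y < m := by
    by_contra hc
    push Not at hc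
    apply diffIndex_spec h
    rw [Nat.testBit_lt_two_pow (hx.trans_le (Nat.pow_le_pow_right two_pos hc)),
      Nat.testBit_lt_two_pow (hy.trans_le (Nat.pow_le_pow_right two_pos hc))]
  unfold coleVishkin
  omega

/-- The number of bits of the colors after `k` steps of color reduction. -/
def colorBits (b k : ℕ) : ℕ := (fun m => Nat.clog 2 m + 1)^[k] b

theorem colorBits_succ (b k : ℕ) : colorBits b (k + 1) = Nat.clog 2 (colorBits b k) + 1 :=
  Function.iterate_succ_apply' _ _ _

theorem clog_add_one_le {m : ℕ} (hm : 1 ≤ m) : Nat.clog 2 m + 1 ≤ m := by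
  obtain ⟨k, rfl⟩ : ∃ k, m = k + 1 := ⟨m - 1, by omega⟩
  have : Nat.clog 2 (k + 1) ≤ k := Nat.clog_le_of_le_pow (Nat.lt_two_pow_self)
  omega

theorem colorBits_bounds {b : ℕ} (hb : 1 ≤ b) (k : ℕ) : 1 ≤ colorBits b k ∧ colorBits b k ≤ b := by
  induction k with
  | zero => exact ⟨hb, le_rfl⟩
  | succ k ih =>
    rw [colorBits_succ]
    exact ⟨by omega, (clog_add_one_le ih.1).trans ih.2⟩

/-- The set in the definition must be nonempty, as an empty infimum would be 0. Each application of
`Nat.clog 2` lowers a positive value by at least 1, so `b` iterations suffice. -/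
theorem logStar_spec (b : ℕ) : (Nat.clog 2)^[logStar b] b ≤ 1 := by
  have : ∀ k, (Nat.clog 2)^[k] b ≤ max 1 (b - k) := by
    intro k
    induction k with
    | zero => simp
    | succ k ih =>
      rw [Function.iterate_succ_apply']
      set y := (Nat.clog 2)^[k] b
      by_cases hy : 1 ≤ y
      · have := clog_add_one_le hy
        omega
      · have : y = 0 := by omega
        rw [this]
        simp
  have h : (Nat.clog 2)^[b] b ≤ 1 := by simpa using this b
  exact Nat.sInf_mem (s := {k : ℕ | (Nat.clog 2)^[k] b ≤ 1}) ⟨b, h⟩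

/-- The extra `+ 1` in each reduction step costs at most 2 bits in total compared with the iterated
logarithm: while the iterate $y$ exceeds 1, $y+2\le 2y$, so $\lceil\log(y+2)\rceil+1\le\lceil\log
y\rceil+2$. -/
theorem colorBits_logStar (b : ℕ) : colorBits b (logStar b) ≤ 3 := by
  have key : ∀ k ≤ logStar b, colorBits b k ≤ (Nat.clog 2)^[k] b + 2 := by
    intro k
    induction k with
    | zero => intro _; simp [colorBits]
    | succ k ih =>
      intro hk
      have ih := ih (by omega)
      have hgt : ¬ (Nat.clog 2)^[k] b ≤ 1 := fun h =>
        absurd (Nat.sInf_le (s := {k : ℕ | (Nat.clog 2)^[k] b ≤ 1}) h) (by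
          rw [← logStar]; omega)
      rw [colorBits_succ, Function.iterate_succ_apply']
      set y := (Nat.clog 2)^[k] b
      have h1 : Nat.clog 2 (colorBits b k) ≤ Nat.clog 2 y + 1 := by
        apply Nat.clog_le_of_le_pow
        have := Nat.le_pow_clog (b := 2) one_lt_two y
        rw [pow_succ]
        omega
      omega
  have := key _ le_rfl
  have := logStar_spec b
  omega

theorem colorBits_step {b k x y : ℕ} (hx : x < 2 ^ colorBits b k)
    (hy : y < 2 ^ colorBits b k) (h : x ≠ y) : coleVishkin x y < 2 ^ colorBits b (k + 1) := by
  refine (coleVishkin_lt hx hy h).trans_le ?_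
  rw [colorBits_succ, pow_succ, mul_comm]
  exact Nat.mul_le_mul_right _ (Nat.le_pow_clog one_lt_two _)

/-! ### Forests whose leaders point to other trees -/

/-- A forest with leaders, a set of active trees, and for each active tree a neighbor of its leader
in a different active tree. -/
structure Pointed {Addr : Type} {J : Type 1} {N : J → Net Addr} (F : ∀ I, Forest (N I))
    (H : ℕ) where
  depth_le : ∀ I v, (F I).depth v ≤ H
  P : ∀ I, Forest (N I)
  depth_le' : ∀ I v, (P I).depth v ≤ H
  root_lead : ∀ I v, (F I).root (lead (F I) (P I) v) = (F I).root v
  act : Fam N Prop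
  act_congr : ∀ I v w, (F I).root v = (F I).root w → act I v = act I w
  out : ∀ I, (N I).V → (N I).V
  adj : ∀ I v, act I v → (N I).G.Adj (lead (F I) (P I) v) (out I (lead (F I) (P I) v))
  act_out : ∀ I v, act I v → act I (out I (lead (F I) (P I) v))
  out_ne : ∀ I v, act I v → (F I).root (out I (lead (F I) (P I) v)) ≠ (F I).root v

section Pointed

variable {Addr : Type} {J : Type 1} {N : J → Net Addr} {F : ∀ I, Forest (N I)} {H : ℕ}
  (X : Pointed F H)

namespace Pointed

/-- The leader of the tree of a node. -/
def led (I : J) (v : (N I).V) : (N I).V := lead (F I) (X.P I) v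

/-- The node to which the tree of a node points. -/
def nxt (I : J) (v : (N I).V) : (N I).V := X.out I (X.led I v)

/-- Every node knows its parents in both forests, whether its tree is active, whether it is the
leader of an active tree, and, if so, the address of the node it points to. -/
def info : Fam N (Option Addr × Option Addr × Prop × Option Addr) := fun I v =>
  ((F I).parAddr v, (X.P I).parAddr v, X.act I v,
    if X.act I v ∧ X.led I v = v then some ((N I).addr (X.out I v)) else none)

variable {X}

theorem root_led (I : J) (v : (N I).V) : (F I).root (X.led I v) = (F I).root v := X.root_lead I v

theorem led_congr {I : J} {v w : (N I).V} (h : (F I).root v = (F I).root w) :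
    X.led I v = X.led I w := lead_congr h

theorem nxt_congr {I : J} {v w : (N I).V} (h : (F I).root v = (F I).root w) :
    X.nxt I v = X.nxt I w := by rw [nxt, led_congr h, nxt]

theorem led_led (I : J) (v : (N I).V) : X.led I (X.led I v) = X.led I v := led_congr (root_led I v)

theorem act_led (I : J) (v : (N I).V) : X.act I (X.led I v) = X.act I v :=
  X.act_congr I _ _ (root_led I v)

theorem out_led (I : J) (v : (N I).V) : X.out I (X.led I v) = X.nxt I v := rfl

theorem root_eq_of_led {I : J} {v w : (N I).V} (h : X.led I v = X.led I w) :
    (F I).root v = (F I).root w := by rw [← root_led I v, h, root_led]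

variable {W α : Type} {f : Fam N α} {q : ℕ}

theorem known_par (h : Det f X.info) : Det f (fun I v => (F I).parAddr v) := h.map fun x => x.1

theorem known_parP (h : Det f X.info) : Det f (fun I v => (X.P I).parAddr v) := h.map fun x => x.2.1

theorem known_act (h : Det f X.info) : Det f X.act := h.map fun x => x.2.2.1

theorem known_out (h : Det f X.info) : Det f (fun I v =>
    if X.act I v ∧ X.led I v = v then some ((N I).addr (X.out I v)) else none) :=
  h.map fun x => x.2.2.2

/-- Broadcast from the leaders. -/
theorem learn_lead {M : Type} [Nonempty M] (hM : Fits q W M) (hX : Det f X.info) (val : Fam N M)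
    (hval : Det f val) :
    Learn (Option W) (2 * (H + q)) f (fun I v => val I (X.led I v)) :=
  Learn.leadcast hM X.depth_le X.depth_le' (known_par hX) (known_parP hX) val hval

/-- The nodes of active trees learn a function of a label of their leader and of the label of
the node it points to. -/
theorem learn_next {M : Type} [Inhabited M] (hq : 0 < q) (hM : Fits q W M) (hX : Det f X.info)
    (val : Fam N M) (hval : Det f val) (ψ : M → M → M) :
    Learn (Option W) (q + 2 * (H + q)) f (fun I v =>
      if X.act I v then ψ (val I (X.led I v)) (val I (X.nxt I v)) else default) := by
  have h1 := Learn.recv hM hq (f := f) (fun I v _ => val I v : Fam N (Addr → M))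
    (hval.map fun x _ => x)
  let r : Fam N (Addr → M) := fun I v => (N I).recv (fun v _ => val I v) v
  -- Only a leader knows where its tree points, so only its value is meaningful; the broadcast from
  -- the leaders keeps that one.
  let val' : Fam N M := fun I v =>
    match (if X.act I v ∧ X.led I v = v then some ((N I).addr (X.out I v)) else none) with
    | none => default
    | some a => ψ (val I v) (r I v a)
  have h2 := learn_lead (f := fun I v => (f I v, r I v)) hM hX.mono val' (by
    refine ((known_out hX).mono.map₃ hval.mono Det.snd fun x y z => match x with
      | none => default
      | some a => ψ y (z a)).trans ⟨id, fun I v => rfl⟩)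
  refine (h1.trans h2).det ((Det.snd.map Prod.snd).trans ⟨id, fun I v => ?_⟩)
  show _ = val' I (X.led I v)
  simp only [val']
  rw [act_led, led_led]
  by_cases h : X.act I v
  · rw [if_pos h, if_pos ⟨h, rfl⟩]
    simp only [r, out_led]
    rw [Net.recv_adj]
    exact X.adj I v h
  · rw [if_neg h, if_neg fun h' => h h'.1]

/-- The addresses of the leaders of active trees with the property `p` that point to `y`. -/
def requests (X : Pointed F H) (p : Fam N Prop) (I : J) (y : (N I).V) : Set Addr :=
  {a | ∃ v, X.act I v ∧ p I v ∧ X.nxt I v = y ∧ (N I).addr (X.led I v) = a}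

/-- The leader sends one bit across the edge it points along. It can decide `p` for the whole tree
because `p` is constant on trees. -/
theorem learn_requests [Nonempty W] (hX : Det f X.info) (p : Fam N Prop) (hp : Det f p)
    (hc : ∀ I v w, (F I).root v = (F I).root w → p I v = p I w) :
    Learn (Option W) 1 f (X.requests p) := by
  have h1 := Learn.heard (W := W) (f := f) (fun I v a => p I v ∧
    (if X.act I v ∧ X.led I v = v then some ((N I).addr (X.out I v)) else none) = some a)
    (hp.map₂ (known_out hX) fun x y a => x ∧ y = some a)
  refine h1.det (Det.snd.trans ⟨id, fun I v => ?_⟩)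
  ext a
  simp only [requests, Net.heard, Set.mem_ofPred_eq, id]
  constructor
  · rintro ⟨x, h1, h2, h3, rfl⟩
    refine ⟨X.led I x, ?_, rfl, ?_, ?_⟩
    · rw [← h3]
      exact (X.adj I x h1).symm
    · rwa [hc I _ _ (root_led I x)]
    · rw [act_led, led_led, if_pos ⟨h1, rfl⟩, out_led, h3]
  · rintro ⟨x, h1, rfl, h2, h3⟩
    split_ifs at h3 with h
    refine ⟨x, h.1, h2, ?_, ?_⟩
    · rw [nxt, h.2]
      exact (N I).inj (Option.some.inj h3)
    · rw [h.2]

/-- The trees learn the answers of the nodes they point to. -/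
theorem learn_answer [Nonempty W] (hM : Fits q W Prop) (hX : Det f X.info)
    (ans : Fam N (Addr → Prop)) (hans : Det f ans) :
    Learn (Option W) (1 + 2 * (H + q)) f (fun I v =>
      (X.act I v ∧ ans I (X.nxt I v) ((N I).addr (X.led I v)) : Prop)) := by
  have h1 := Learn.heard (W := W) (f := f) ans hans
  let r : Fam N (Set Addr) := fun I v => (N I).heard (ans I) v
  let val' : Fam N Prop := fun I v => ∃ a ∈ r I v,
    (if X.act I v ∧ X.led I v = v then some ((N I).addr (X.out I v)) else none) = some a
  have h2 := learn_lead (f := fun I v => (f I v, r I v)) hM hX.mono val'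
    ((Det.snd (f := f) (g := r)).map₂ (known_out hX).mono fun y z => ∃ a ∈ y, z = some a)
  refine (h1.trans h2).det ((Det.snd.map Prod.snd).trans ⟨id, fun I v => ?_⟩)
  show _ = val' I (X.led I v)
  simp only [val']
  rw [act_led, led_led]
  apply propext
  constructor
  · rintro ⟨h1, h2⟩
    refine ⟨(N I).addr (X.nxt I v), ⟨X.nxt I v, X.adj I v h1, rfl, h2⟩, ?_⟩
    rw [if_pos ⟨h1, rfl⟩]
    rfl
  · rintro ⟨a, ⟨y, hy, rfl, h⟩, h3⟩
    split_ifs at h3 with hact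
    refine ⟨hact.1, ?_⟩
    have := (N I).inj (Option.some.inj h3)
    rw [nxt, this]
    exact h

/-- Color reduction: neighboring trees are given different colors among eight. -/
theorem learn_coloring {b : ℕ} (hb : 1 ≤ b) (hq : 0 < q) (hM : Fits q W (Ident b))
    (hX : Det f X.info) (cid : Fam N (Ident b)) (hcid : Det f cid)
    (hc : ∀ I v w, (F I).root v = (F I).root w → cid I v = cid I w)
    (hne : ∀ I v, X.act I v → cid I v ≠ cid I (X.nxt I v)) :
    ∃ col : Fam N (Ident b), (∀ I v w, (F I).root v = (F I).root w → col I v = col I w) ∧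
      (∀ I v, X.act I v → col I v ≠ col I (X.nxt I v)) ∧
      (∀ I v, X.act I v → (col I v : ℕ) < 8) ∧
      Learn (Option W) (logStar b * (q + 2 * (H + q))) f col := by
  have : Inhabited (Ident b) := ⟨⟨0, by positivity⟩⟩
  have key : ∀ k, ∃ col : Fam N (Ident b),
      (∀ I v w, (F I).root v = (F I).root w → col I v = col I w) ∧
      (∀ I v, X.act I v → col I v ≠ col I (X.nxt I v)) ∧
      (∀ I v, X.act I v → (col I v : ℕ) < 2 ^ colorBits b k) ∧
      Learn (Option W) (k * (q + 2 * (H + q))) f col := by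
    intro k
    induction k with
    | zero =>
      refine ⟨cid, hc, hne, fun I v _ => (cid I v).2, ?_⟩
      rw [Nat.zero_mul]
      exact (Det.refl f).pair hcid
    | succ k ih =>
      obtain ⟨col, h1, h2, h3, h4⟩ := ih
      -- The reduction modulo `2 ^ b` only keeps the color in its type; by `colorBits_bounds` it
      -- never changes the value on active trees.
      let ψ : Ident b → Ident b → Ident b := fun x y =>
        ⟨coleVishkin x y % 2 ^ b, Nat.mod_lt _ (by positivity)⟩
      have h5 := learn_next (f := fun I v => (f I v, col I v)) hq hM hX.mono col Det.snd ψ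
      let col' : Fam N (Ident b) := fun I v =>
        if X.act I v then ψ (col I (X.led I v)) (col I (X.nxt I v)) else default
      have hval : ∀ I v, X.act I v →
          (col' I v : ℕ) = coleVishkin (col I v) (col I (X.nxt I v)) ∧
          coleVishkin (col I v) (col I (X.nxt I v)) < 2 ^ colorBits b (k + 1) := by
        intro I v hv
        have hlt := colorBits_step (h3 I v hv) (h3 I _ (X.act_out I v hv))
          (fun h => h2 I v hv (Fin.ext h))
        refine ⟨?_, hlt⟩
        simp only [col', if_pos hv, ψ, h1 I _ _ (root_led I v)]
        exact Nat.mod_eq_of_lt (hlt.trans_le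
          (Nat.pow_le_pow_right two_pos (colorBits_bounds hb _).2))
      refine ⟨col', ?_, ?_, ?_, ?_⟩
      · intro I v w h
        simp only [col', X.act_congr I v w h, led_congr h, nxt_congr h]
      · intro I v hv h
        have e := congrArg (fun x : Ident b => (x : ℕ)) h
        simp only [(hval I v hv).1] at e
        rw [(hval I (X.nxt I v) (X.act_out I v hv)).1] at e
        exact coleVishkin_ne (fun h => h2 I v hv (Fin.ext h)) _ e
      · intro I v hv
        rw [(hval I v hv).1]
        exact (hval I v hv).2
      · rw [Nat.succ_mul]
        exact (h4.trans h5).det (Det.snd.map Prod.snd)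
  obtain ⟨col, h1, h2, h3, h4⟩ := key (logStar b)
  refine ⟨col, h1, h2, fun I v hv => (h3 I v hv).trans_le ?_, h4⟩
  calc 2 ^ colorBits b (logStar b) ≤ 2 ^ 3 := Nat.pow_le_pow_right two_pos (colorBits_logStar b)
    _ = 8 := by norm_num

end Pointed

end Pointed

/-! ### Maximal matching of trees -/

section Pointed

variable {Addr : Type} {J : Type 1} {N : J → Net Addr} {F : ∀ I, Forest (N I)} {H : ℕ}
  {X : Pointed F H} {W α : Type} {f : Fam N α} {q : ℕ}

namespace Pointed

/-- A matching of trees along their pointers, given by the status of each tree: unmatched (`0`),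
matched to the tree that it points to (`1`), or matched to a tree that points to it (`2`). -/
structure IsMatching (X : Pointed F H) (st : Fam N (Fin 3)) : Prop where
  congr : ∀ I v w, (F I).root v = (F I).root w → st I v = st I w
  nxt_eq_two : ∀ I v, st I v = 1 → X.act I v ∧ st I (X.nxt I v) = 2
  inj : ∀ I v w, st I v = 1 → st I w = 1 → (F I).root (X.nxt I v) = (F I).root (X.nxt I w) →
    (F I).root v = (F I).root w
  surj : ∀ I w, st I w = 2 → ∃ v, st I v = 1 ∧ (F I).root (X.nxt I v) = (F I).root w

/-- The unmatched trees of color `j` propose to the trees they point to, and every unmatched tree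
accepts one of the proposals it receives. -/
theorem learn_matching_step [Nonempty W] {K : Type} (hP : Fits q W Prop) (hX : Det f X.info)
    (col : Fam N K) (hcol : Det f col)
    (hcc : ∀ I v w, (F I).root v = (F I).root w → col I v = col I w)
    (hne : ∀ I v, X.act I v → col I v ≠ col I (X.nxt I v)) (j : K)
    (st : Fam N (Fin 3)) (hst : Det f st) (hm : X.IsMatching st) :
    ∃ st' : Fam N (Fin 3), X.IsMatching st' ∧ (∀ I v, st I v ≠ 0 → st' I v ≠ 0) ∧
      (∀ I v, X.act I v → col I v = j → st' I v ≠ 0 ∨ st' I (X.nxt I v) ≠ 0) ∧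
      Learn (Option W) (6 * H + 4 * q + 5) f st' := by
  let p : Fam N Prop := fun I v => st I v = 0 ∧ col I v = j
  have hpc : ∀ I v w, (F I).root v = (F I).root w → p I v = p I w := fun I v w h => by
    simp only [p, hm.congr I v w h, hcc I v w h]
  have hp : Det f p := hst.map₂ hcol fun x y => x = 0 ∧ y = j
  have l1 := learn_requests (W := W) hX p hp hpc
  let R : Fam N (Set Addr) := X.requests p
  let f1 := (fun I v => (f I v, R I v) : Fam N _)
  have d1 : Det f1 f := Det.fst
  have dR1 : Det f1 R := Det.snd
  -- An unmatched tree accepts by electing one node that received a proposal; this node then picks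
  -- one of its proposals.
  let item : Fam N Prop := fun I v => st I v = 0 ∧ (R I v).Nonempty
  have hitem : Det f1 item :=
    (d1.trans hst).map₂ dR1 fun x (y : Set Addr) => x = 0 ∧ y.Nonempty
  obtain ⟨P', hP', hroot, hsel, l2⟩ := Learn.select (W := W) X.depth_le
    (known_par (d1.trans hX)) item hitem
  let sel : Fam N Prop := fun I v => item I v ∧ lead (F I) (P' I) v = v
  let f2 := (fun I v => (f1 I v, ((P' I).parAddr v, sel I v)) : Fam N _)
  have d21 : Det f2 f1 := Det.fst
  have d2 : Det f2 f := d21.trans d1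
  have dsel : Det f2 sel := Det.snd.map Prod.snd
  have dP' : Det f2 (fun I v => (P' I).parAddr v) := Det.snd.map Prod.fst
  let ans : Fam N (Addr → Prop) := fun I v a => sel I v ∧ pick (R I v) = some a
  have dans : Det f2 ans :=
    dsel.map₂ (d21.trans dR1) fun x (y : Set Addr) a => x ∧ pick y = some a
  have l3 := learn_answer hP (d2.trans hX) ans dans
  let newp : Fam N Prop := fun I v => X.act I v ∧ ans I (X.nxt I v) ((N I).addr (X.led I v))
  let f3 := (fun I v => (f2 I v, newp I v) : Fam N _)
  have d32 : Det f3 f2 := Det.fst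
  have l4 := Learn.leadcast (f := f3) hP X.depth_le hP' (known_par ((d32.trans d2).trans hX))
    (d32.trans dP') item ((d32.trans d21).trans hitem)
  let newa : Fam N Prop := fun I v => item I (lead (F I) (P' I) v)
  let f4 := (fun I v => (f3 I v, newa I v) : Fam N _)
  let upd : Fin 3 → Prop → Prop → Fin 3 := fun x y z =>
    if x = 0 then (if y then 1 else if z then 2 else 0) else x
  let st' : Fam N (Fin 3) := fun I v => upd (st I v) (newp I v) (newa I v)
  have l5 : Learn (Option W) (6 * H + 4 * q + 5) f st' := by
    have := (((l1.comp l2).comp l3).comp l4 : Solves (Option W) _ f f4)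
    rw [show 1 + (2 * H + 3) + (1 + 2 * (H + q)) + 2 * (H + q) = 6 * H + 4 * q + 5 by ring] at this
    refine this.post ?_
    have d4 : Det f4 f := (Det.fst (f := f3)).trans (d32.trans d2)
    refine d4.pair ?_
    exact (d4.trans hst).map₃ ((Det.fst (f := f3)).trans (Det.snd (g := newp))) Det.snd upd
  have newp_spec : ∀ I v, newp I v → X.act I v ∧ p I v ∧ item I (X.nxt I v) ∧
      lead (F I) (P' I) (X.nxt I v) = X.nxt I v ∧
      pick (R I (X.nxt I v)) = some ((N I).addr (X.led I v)) := by
    rintro I v ⟨h1, ⟨h2, h3⟩, h4⟩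
    refine ⟨h1, ?_, h2, h3, h4⟩
    obtain ⟨w, -, hw, -, hwv⟩ := pick_mem h4
    rwa [hpc I v w (root_eq_of_led ((N I).inj hwv).symm)]
  have newa_of : ∀ I v y, (F I).root y = (F I).root v → item I y → newa I v := by
    intro I v y h hy
    have := hsel I y hy
    rwa [lead_congr h] at this
  have st'_old : ∀ I v, st I v ≠ 0 → st' I v = st I v := fun I v h => if_neg h
  have st'_new : ∀ I v, st I v = 0 → st' I v = if newp I v then 1 else if newa I v then 2 else 0 :=
    fun I v h => (if_pos h).trans (by congr)
  have one_cases : ∀ I v, st' I v = 1 → st I v = 1 ∨ (st I v = 0 ∧ newp I v) := by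
    intro I v h
    by_cases h0 : st I v = 0
    · rw [st'_new I v h0] at h
      right
      refine ⟨h0, ?_⟩
      by_contra hc
      rw [if_neg hc] at h
      split_ifs at h <;> simp at h
    · left
      rwa [st'_old I v h0] at h
  have two_cases : ∀ I v, st' I v = 2 → st I v = 2 ∨ (st I v = 0 ∧ newa I v) := by
    intro I v h
    by_cases h0 : st I v = 0
    · rw [st'_new I v h0] at h
      right
      refine ⟨h0, ?_⟩
      split_ifs at h with h1 h2
      · simp at h
      · exact h2
      · simp at h
    · left
      rwa [st'_old I v h0] at h
  have newp_congr : ∀ I v w, (F I).root v = (F I).root w → newp I v = newp I w := by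
    intro I v w h
    simp only [newp, X.act_congr I v w h, nxt_congr h, led_congr h]
  refine ⟨st', ⟨?_, ?_, ?_, ?_⟩, ?_, ?_, l5⟩
  · intro I v w h
    simp only [st', hm.congr I v w h, newp_congr I v w h, newa, lead_congr h]
  · intro I v h
    rcases one_cases I v h with h1 | ⟨h0, h1⟩
    · obtain ⟨h2, h3⟩ := hm.nxt_eq_two I v h1
      refine ⟨h2, ?_⟩
      rw [st'_old I _ (by rw [h3]; simp), h3]
    · obtain ⟨ha, hpv, hi, hl, -⟩ := newp_spec I v h1
      refine ⟨ha, ?_⟩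
      -- No tree acquires both roles in one step: an acceptor that was also an accepted proposer
      -- would have color `j`, like the tree that points to it.
      have hn : ¬ newp I (X.nxt I v) := by
        intro hn
        apply hne I v ha
        rw [hpv.2, (newp_spec I _ hn).2.1.2]
      rw [st'_new I _ hi.1, if_neg hn, if_pos (newa_of I _ _ rfl hi)]
  · intro I v w hv hw h
    rcases one_cases I v hv with h1 | ⟨h0, h1⟩ <;> rcases one_cases I w hw with h2 | ⟨h0', h2⟩
    · exact hm.inj I v w h1 h2 h
    · have e1 := (hm.nxt_eq_two I v h1).2
      have e2 := (newp_spec I w h2).2.2.1.1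
      rw [hm.congr I _ _ h, e2] at e1
      simp at e1
    · have e1 := (hm.nxt_eq_two I w h2).2
      have e2 := (newp_spec I v h1).2.2.1.1
      rw [← hm.congr I _ _ h, e2] at e1
      simp at e1
    · obtain ⟨-, -, -, e1, e2⟩ := newp_spec I v h1
      obtain ⟨-, -, -, e3, e4⟩ := newp_spec I w h2
      have e5 : X.nxt I v = X.nxt I w := by rw [← e1, ← e3]; exact lead_congr h
      rw [e5, e4] at e2
      exact root_eq_of_led ((N I).inj (Option.some.inj e2)).symm
  · intro I w hw
    rcases two_cases I w hw with h1 | ⟨h0, h1⟩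
    · obtain ⟨v, hv, h⟩ := hm.surj I w h1
      exact ⟨v, by rw [st'_old I v (by rw [hv]; simp), hv], h⟩
    · obtain ⟨a, ha, hpick⟩ := exists_pick h1.2
      obtain ⟨x, hx1, hx2, hx3, hx4⟩ := ha
      refine ⟨x, ?_, ?_⟩
      · rw [st'_new I x hx2.1, if_pos]
        refine ⟨hx1, ⟨?_, ?_⟩, ?_⟩
        · rw [hx3]
          exact h1
        · rw [hx3]
          exact lead_congr (hroot I w)
        · rw [hx3, hx4]
          exact hpick
      · rw [hx3]
        exact hroot I w
  · intro I v h
    rwa [st'_old I v h]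
  · intro I v ha hj
    -- If the proposer was unmatched, its target either was matched already or has now received a
    -- proposal and becomes matched.
    by_cases h0 : st I v = 0
    · right
      by_cases h1 : st I (X.nxt I v) = 0
      · rw [st'_new I _ h1]
        have : item I (X.nxt I v) := ⟨h1, _, v, ha, ⟨h0, hj⟩, rfl, rfl⟩
        have := newa_of I _ _ rfl this
        split_ifs <;> simp
      · rwa [st'_old I _ h1]
    · left
      rwa [st'_old I v h0]

/-- A maximal matching of the active trees. -/
theorem learn_matching [Nonempty W] {b : ℕ} (hP : Fits q W Prop) (hX : Det f X.info)
    (col : Fam N (Ident b)) (hcol : Det f col)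
    (hcc : ∀ I v w, (F I).root v = (F I).root w → col I v = col I w)
    (hne : ∀ I v, X.act I v → col I v ≠ col I (X.nxt I v)) (m : ℕ)
    (hm : ∀ I v, X.act I v → (col I v : ℕ) < m) :
    ∃ st : Fam N (Fin 3), X.IsMatching st ∧
      (∀ I v, X.act I v → st I v ≠ 0 ∨ st I (X.nxt I v) ≠ 0) ∧
      Learn (Option W) (m * (6 * H + 4 * q + 5)) f st := by
  have key : ∀ k, ∃ st : Fam N (Fin 3), X.IsMatching st ∧
      (∀ I v, X.act I v → (col I v : ℕ) < k → st I v ≠ 0 ∨ st I (X.nxt I v) ≠ 0) ∧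
      Learn (Option W) (k * (6 * H + 4 * q + 5)) f st := by
    intro k
    induction k with
    | zero =>
      refine ⟨fun _ _ => 0, ⟨fun _ _ _ _ => rfl, fun I v h => ?_, fun I v w h => ?_,
        fun I w h => ?_⟩, fun I v _ h => by omega, ?_⟩
      · simp at h
      · simp at h
      · simp at h
      · rw [Nat.zero_mul]
        exact (Det.refl f).pair (Det.const _)
    | succ k ih =>
      obtain ⟨st, h1, h2, h3⟩ := ih
      obtain ⟨st', h4, h5, h6, h7⟩ := learn_matching_step
        (f := fun I v => (f I v, st I v)) hP hX.mono (fun I v => (col I v : ℕ))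
        (hcol.mono.map fun x => (x : ℕ)) (fun I v w h => by rw [hcc I v w h])
        (fun I v h e => hne I v h (Fin.ext e)) k st Det.snd h1
      refine ⟨st', h4, fun I v ha hk => ?_, ?_⟩
      · by_cases hlt : (col I v : ℕ) < k
        · exact (h2 I v ha hlt).imp (h5 I _) (h5 I _)
        · exact h6 I v ha (by omega)
      · rw [Nat.succ_mul]
        exact (h3.trans h7).det (Det.snd.map Prod.snd)
  obtain ⟨st, h1, h2, h3⟩ := key m
  exact ⟨st, h1, fun I v h => h2 I v h (hm I v h), h3⟩

end Pointed

end Pointed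

/-! ### Balanced colors for the unmatched trees -/

/-- The sign of a truth value. -/
def sgn (p : Prop) : ℤ := if p then 1 else -1

theorem sgn_not (p : Prop) : sgn (¬ p) = -sgn p := by
  by_cases h : p <;> simp [sgn, h]

/-- Labels are assigned alternately: a new element gets `o` if the set so far is even, and cancels
the surplus with the opposite label if it is odd. -/
theorem exists_balanced {A : Type} (t : Finset A) (o : Prop) :
    ∃ g : A → Prop, ∑ a ∈ t, sgn (g a) = if Odd t.card then sgn o else 0 := by
  induction t using Finset.induction_on with
  | empty => exact ⟨fun _ => True, by simp⟩
  | insert a t ha ih =>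
    obtain ⟨g, hg⟩ := ih
    refine ⟨fun x => if x = a then (if Odd t.card then ¬ o else o) else g x, ?_⟩
    rw [Finset.sum_insert ha, Finset.card_insert_of_notMem ha]
    have e : ∑ x ∈ t, sgn (if x = a then (if Odd t.card then ¬ o else o) else g x) =
        ∑ x ∈ t, sgn (g x) := by
      refine Finset.sum_congr rfl fun x hx => ?_
      rw [if_neg]
      rintro rfl
      exact ha hx
    rw [e, hg]
    simp only [if_true, Nat.odd_add_one]
    by_cases h : Odd t.card
    · simp [h, sgn_not]
    · simp [h]

/-- A labelling of a finite set in which both labels occur equally often, up to one occurrence of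
the label `o`. -/
def split {A : Type} (T : Set A) (o : Prop) : A → Prop :=
  if h : ∃ t : Finset A, (t : Set A) = T then (exists_balanced h.choose o).choose else fun _ => True

theorem sum_split {A : Type} (t : Finset A) (o : Prop) :
    ∑ a ∈ t, sgn (split (t : Set A) o a) = if Odd t.card then sgn o else 0 := by
  have h : ∃ s : Finset A, (s : Set A) = t := ⟨t, rfl⟩
  have e : h.choose = t := Finset.coe_injective h.choose_spec
  have := (exists_balanced h.choose o).choose_spec
  rw [split, dif_pos h]
  convert this using 2
  · exact e.symm
  · rw [e]

section Pointed

variable {Addr : Type} {J : Type 1} {N : J → Net Addr} {F : ∀ I, Forest (N I)} {H : ℕ}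
  {X : Pointed F H} {W α : Type} {f : Fam N α} {q : ℕ}

namespace Pointed

/-- The active trees with the property `p` are labelled such that the labels are balanced among
those that point to the same tree. -/
theorem learn_split [Nonempty W] [∀ I, Fintype (N I).V] (hP : Fits q W Prop) (hX : Det f X.info)
    (p : Fam N Prop) (hp : Det f p)
    (hpc : ∀ I v w, (F I).root v = (F I).root w → p I v = p I w) :
    ∃ bit : Fam N Prop, (∀ I v w, (F I).root v = (F I).root w → bit I v = bit I w) ∧
      (∀ I s, |∑ v : (N I).V with (F I).root v = v ∧ X.act I v ∧ p I v ∧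
        (F I).root (X.nxt I v) = s, sgn (bit I v)| ≤ 1) ∧
      Learn (Option W) (4 * H + 2 * q + 5) f bit := by
  have l1 := learn_requests (W := W) hX p hp hpc
  let R : Fam N (Set Addr) := X.requests p
  let f1 := (fun I v => (f I v, R I v) : Fam N _)
  have d1 : Det f1 f := Det.fst
  have dR1 : Det f1 R := Det.snd
  -- The objects to be paired at a node: trees that point to it and tokens left over by its
  -- children. If their number is odd, the node passes one token to its parent.
  let T : Set Addr → Set Addr → Set (Addr ⊕ Addr) := fun A B => {x | Sum.elim (· ∈ A) (· ∈ B) x}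
  obtain ⟨g, hg, l2⟩ := Learn.up (W := W) F X.depth_le (known_par (d1.trans hX))
    (fun I v S => Odd (T (R I v) S).ncard) (dR1.map fun x S => Odd (T x S).ncard)
  let S : Fam N (Set Addr) := fun I v => (F I).childSet (g I) v
  let f2 := (fun I v => (f1 I v, S I v) : Fam N _)
  have d21 : Det f2 f1 := Det.fst
  have d2 : Det f2 f := d21.trans d1
  have dT : Det f2 (fun I v => T (R I v) (S I v)) := (d21.trans dR1).map₂ Det.snd T
  -- Signs return: a node splits its objects so that their sum is the sign given to its own token.
  -- The root has no parent and takes the arbitrary sign `True`.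
  obtain ⟨o, ho0, ho1, l3⟩ := Learn.down (W := W) F X.depth_le (known_par (d2.trans hX))
    (fun _ _ => True) (Det.const True) (fun I v x a => split (T (R I v) (S I v)) x (Sum.inr a))
    (dT.map fun y x a => split y x (Sum.inr a))
  let f3 := (fun I v => (f2 I v, o I v) : Fam N _)
  have d32 : Det f3 f2 := Det.fst
  let ans : Fam N (Addr → Prop) := fun I v a => split (T (R I v) (S I v)) (o I v) (Sum.inl a)
  have l4 := learn_answer (f := f3) hP ((d32.trans d2).trans hX) ans
    ((d32.trans dT).map₂ Det.snd fun y x a => split y x (Sum.inl a))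
  let bit : Fam N Prop := fun I v => X.act I v ∧ ans I (X.nxt I v) ((N I).addr (X.led I v))
  have l5 : Learn (Option W) (4 * H + 2 * q + 5) f bit := by
    have := (((l1.comp l2).comp l3).comp l4 :
      Solves (Option W) _ f (fun I v => (f3 I v, bit I v) : Fam N _))
    rw [show 1 + (H + 2) + (H + 1) + (1 + 2 * (H + q)) = 4 * H + 2 * q + 5 by ring] at this
    exact this.post ((Det.fst.trans (d32.trans d2)).pair Det.snd)
  refine ⟨bit, fun I v w h => ?_, fun I s => ?_, l5⟩
  · simp only [bit, X.act_congr I v w h, nxt_congr h, led_congr h]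
  -- The signed value of the token of `v`, zero if there is none. At each node the incoming tokens
  -- and the requesting trees sum to the outgoing token.
  let τ : (N I).V → ℤ := fun v => if g I v then sgn (o I v) else 0
  have local_balance : ∀ y : (N I).V,
      (∑ v : (N I).V with (F I).root v = v ∧ X.act I v ∧ p I v ∧ X.nxt I v = y, sgn (bit I v)) +
      (∑ c : (N I).V with (F I).par c = some y, τ c) = τ y := by
    intro y
    let A : Finset (N I).V := {v | (F I).root v = v ∧ X.act I v ∧ p I v ∧ X.nxt I v = y}
    let B : Finset (N I).V := {c | (F I).par c = some y ∧ g I c}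
    let tA : Finset Addr := A.image fun v => (N I).addr (X.led I v)
    let tB : Finset Addr := B.image (N I).addr
    have hA : (tA : Set Addr) = R I y := by
      ext a
      simp only [tA, A, Finset.coe_image, Finset.coe_filter, Finset.mem_univ, true_and,
        Set.mem_image, Set.mem_ofPred_eq, R, requests]
      constructor
      · rintro ⟨v, ⟨-, h1, h2, h3⟩, rfl⟩
        exact ⟨v, h1, h2, h3, rfl⟩
      · rintro ⟨v, h1, h2, h3, rfl⟩
        have e := (F I).root_root v
        refine ⟨(F I).root v, ⟨e, ?_, ?_, ?_⟩, ?_⟩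
        · rwa [X.act_congr I _ _ e]
        · rwa [hpc I _ _ e]
        · rwa [nxt_congr e]
        · rw [led_congr e]
    have hB : (tB : Set Addr) = S I y := by
      ext a
      simp only [tB, B, Finset.coe_image, Finset.coe_filter, Finset.mem_univ, true_and,
        Set.mem_image, Set.mem_ofPred_eq, S, Forest.childSet]
      exact ⟨fun ⟨v, ⟨h1, h2⟩, h3⟩ => ⟨v, h1, h3, h2⟩, fun ⟨v, h1, h3, h2⟩ => ⟨v, ⟨h1, h2⟩, h3⟩⟩
    have hT : ((tA.disjSum tB : Finset (Addr ⊕ Addr)) : Set (Addr ⊕ Addr)) =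
        T (R I y) (S I y) := by
      rw [← hA, ← hB]
      ext x
      cases x <;> simp [T]
    have key := sum_split (tA.disjSum tB) (o I y)
    rw [hT, Finset.sum_disjSum] at key
    have hcard : Odd (tA.disjSum tB).card = g I y := by
      rw [hg I y, ← Set.ncard_coe_finset, hT]
    have e1 : ∑ a ∈ tA, sgn (split (T (R I y) (S I y)) (o I y) (Sum.inl a)) =
        ∑ v ∈ A, sgn (bit I v) := by
      rw [Finset.sum_image]
      · refine Finset.sum_congr rfl fun v hv => ?_
        simp only [A, Finset.mem_filter, Finset.mem_univ, true_and] at hv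
        simp only [bit, ans, hv.2.2.2, hv.2.1, true_and]
      · intro v hv w hw h
        simp only [A, Finset.coe_filter, Finset.mem_univ, true_and, Set.mem_ofPred_eq] at hv hw
        have := root_eq_of_led ((N I).inj h)
        rwa [hv.1, hw.1] at this
    have e2 : ∑ a ∈ tB, sgn (split (T (R I y) (S I y)) (o I y) (Sum.inr a)) =
        ∑ c : (N I).V with (F I).par c = some y, τ c := by
      rw [Finset.sum_image fun _ _ _ _ h => (N I).inj h]
      have : ∀ c, (F I).par c = some y → τ c = if g I c then
          sgn (split (T (R I y) (S I y)) (o I y) (Sum.inr ((N I).addr c))) else 0 := by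
        intro c hc
        simp only [τ, ho1 I c y hc]
      rw [Finset.sum_congr rfl fun c hc => this c (Finset.mem_filter.1 hc).2, ← Finset.sum_filter,
        Finset.filter_filter]
    rw [e1, e2] at key
    rw [key]
    simp only [τ]
    by_cases h : g I y
    · rw [if_pos h, if_pos (hcard ▸ h)]
    · rw [if_neg h, if_neg (hcard ▸ h)]
  -- Summed over a whole tree, the local identities telescope: every token of a non-root is counted
  -- once as outgoing and once as incoming, so only the token of the root remains.
  have total : ∑ v : (N I).V with (F I).root v = v ∧ X.act I v ∧ p I v ∧
      (F I).root (X.nxt I v) = s, sgn (bit I v) =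
      ∑ y : (N I).V with (F I).root y = s ∧ (F I).par y = none, τ y := by
    have e1 : ∑ y : (N I).V with (F I).root y = s, τ y =
        ∑ y : (N I).V with (F I).root y = s, ((∑ v : (N I).V with (F I).root v = v ∧ X.act I v ∧
          p I v ∧ X.nxt I v = y, sgn (bit I v)) +
          ∑ c : (N I).V with (F I).par c = some y, τ c) :=
      Finset.sum_congr rfl fun y _ => (local_balance y).symm
    rw [Finset.sum_add_distrib] at e1
    have e2 : ∑ y : (N I).V with (F I).root y = s, (∑ v : (N I).V with (F I).root v = v ∧
        X.act I v ∧ p I v ∧ X.nxt I v = y, sgn (bit I v)) =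
        ∑ v : (N I).V with (F I).root v = v ∧ X.act I v ∧ p I v ∧
          (F I).root (X.nxt I v) = s, sgn (bit I v) := by
      rw [← Finset.sum_fiberwise_of_maps_to (g := X.nxt I)
        (s := Finset.univ.filter fun v => (F I).root v = v ∧ X.act I v ∧ p I v ∧
          (F I).root (X.nxt I v) = s) (t := Finset.univ.filter fun y => (F I).root y = s)]
      · refine Finset.sum_congr rfl fun y hy => Finset.sum_congr ?_ fun _ _ => rfl
        ext v
        simp only [Finset.mem_filter, Finset.mem_univ, true_and] at hy ⊢
        constructor
        · rintro ⟨h1, h2, h3, rfl⟩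
          exact ⟨⟨h1, h2, h3, hy⟩, rfl⟩
        · rintro ⟨⟨h1, h2, h3, -⟩, h4⟩
          exact ⟨h1, h2, h3, h4⟩
      · intro v hv
        simp only [Finset.mem_filter, Finset.mem_univ, true_and] at hv ⊢
        exact hv.2.2.2
    have e3 : ∑ y : (N I).V with (F I).root y = s,
        (∑ c : (N I).V with (F I).par c = some y, τ c) =
        ∑ c : (N I).V with (F I).root c = s ∧ (F I).par c ≠ none, τ c := by
      rw [← Finset.sum_fiberwise_of_maps_to (g := fun c => ((F I).par c).getD c)
        (s := Finset.univ.filter fun c => (F I).root c = s ∧ (F I).par c ≠ none)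
        (t := Finset.univ.filter fun y => (F I).root y = s)]
      · refine Finset.sum_congr rfl fun y hy => Finset.sum_congr ?_ fun _ _ => rfl
        ext c
        simp only [Finset.mem_filter, Finset.mem_univ, true_and] at hy ⊢
        constructor
        · intro h
          refine ⟨⟨?_, by rw [h]; simp⟩, by rw [h]; rfl⟩
          rw [(F I).root_some h, hy]
        · rintro ⟨⟨-, h1⟩, h2⟩
          obtain ⟨z, hz⟩ := Option.ne_none_iff_exists'.1 h1
          rw [hz] at h2 ⊢
          rw [← h2]
          rfl
      · intro c hc
        simp only [Finset.mem_filter, Finset.mem_univ, true_and] at hc ⊢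
        obtain ⟨z, hz⟩ := Option.ne_none_iff_exists'.1 hc.2
        rw [hz, Option.getD_some, ← (F I).root_some hz, hc.1]
    have e4 := Finset.sum_filter_add_sum_filter_not
      (Finset.univ.filter fun y : (N I).V => (F I).root y = s) (fun y => (F I).par y = none) τ
    rw [Finset.filter_filter, Finset.filter_filter] at e4
    rw [e2, e3] at e1
    linarith
  rw [total]
  have hsub : ∀ y : (N I).V, y ∈ (Finset.univ.filter fun y : (N I).V =>
      (F I).root y = s ∧ (F I).par y = none) → y = s := by
    intro y hy
    simp only [Finset.mem_filter, Finset.mem_univ, true_and] at hy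
    rw [← hy.1, (F I).root_none hy.2]
  have hτ : ∀ y, |τ y| ≤ 1 := by
    intro y
    simp only [τ, sgn]
    split_ifs <;> simp
  refine (Finset.abs_sum_le_sum_abs _ _).trans
    ((Finset.sum_le_card_nsmul _ _ 1 fun y _ => hτ y).trans ?_)
  have : (Finset.univ.filter fun y : (N I).V =>
      (F I).root y = s ∧ (F I).par y = none).card ≤ 1 :=
    Finset.card_le_one.2 fun x hx y hy => (hsub x hx).trans (hsub y hy).symm
  simpa using this

end Pointed

end Pointed

/-! ### Counting colors -/

/-- Each element of nonzero status is charged for its fiber under `ρ`: if $k$ status-0 elements are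
assigned to it, balance allows at most $(k+1)/2$ with the label, and four times that integer is at
most $3k+1$, also for $k=0$. -/
theorem four_mul_card_filter_le {V : Type} (Q : Finset V) (st : V → Fin 3) (bit : V → Prop)
    [DecidablePred bit] (ρ : V → V) (hρ : ∀ v ∈ Q, st v = 0 → ρ v ∈ Q ∧ st (ρ v) ≠ 0)
    (hb : ∀ s ∈ Q, |∑ v ∈ Q with st v = 0 ∧ ρ v = s, sgn (bit v)| ≤ 1) :
    4 * (Q.filter fun v => st v = 0 ∧ bit v).card ≤
      3 * (Q.filter fun v => st v = 0).card + (Q.filter fun s => st s ≠ 0).card := by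
  have e1 : (Q.filter fun v => st v = 0 ∧ bit v).card =
      ∑ s ∈ Q with st s ≠ 0, (Q.filter fun v => (st v = 0 ∧ ρ v = s) ∧ bit v).card := by
    rw [Finset.card_eq_sum_card_fiberwise (f := ρ) (t := Q.filter fun s => st s ≠ 0)]
    · refine Finset.sum_congr rfl fun s _ => ?_
      rw [Finset.filter_filter]
      congr 1
      ext v
      simp only [Finset.mem_filter]
      tauto
    · intro v hv
      simp only [Finset.coe_filter, Set.mem_ofPred_eq] at hv ⊢
      exact hρ v hv.1 hv.2.1
  have e2 : (Q.filter fun v => st v = 0).card =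
      ∑ s ∈ Q with st s ≠ 0, (Q.filter fun v => st v = 0 ∧ ρ v = s).card := by
    rw [Finset.card_eq_sum_card_fiberwise (f := ρ) (t := Q.filter fun s => st s ≠ 0)]
    · refine Finset.sum_congr rfl fun s _ => ?_
      rw [Finset.filter_filter]
    · intro v hv
      simp only [Finset.coe_filter, Set.mem_ofPred_eq] at hv ⊢
      exact hρ v hv.1 hv.2
  rw [e1, e2, Finset.mul_sum, Finset.mul_sum, Finset.card_eq_sum_ones, ← Finset.sum_add_distrib]
  refine Finset.sum_le_sum fun s hs => ?_
  have h1 := hb s (Finset.mem_filter.1 hs).1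
  have h2 : ∑ v ∈ Q with st v = 0 ∧ ρ v = s, sgn (bit v) =
      ((Q.filter fun v => (st v = 0 ∧ ρ v = s) ∧ bit v).card : ℤ) -
      (Q.filter fun v => (st v = 0 ∧ ρ v = s) ∧ ¬ bit v).card := by
    have : ∀ v, sgn (bit v) = if bit v then 1 else -1 := fun v => by simp only [sgn]; congr
    simp only [this]
    rw [Finset.sum_ite, Finset.sum_const, Finset.sum_const, Finset.filter_filter,
      Finset.filter_filter]
    simp
    ring
  have h3 := Finset.card_filter_add_card_filter_not (s := Q.filter fun v => st v = 0 ∧ ρ v = s) bit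
  rw [Finset.filter_filter, Finset.filter_filter] at h3
  rw [h2, abs_le] at h1
  omega

/-- If there are as many trees of status `1` as of status `2`, and the trees of status `0` are
assigned to the others such that their labels are balanced among those with the same assignment,
then no color is given to more than three quarters of the trees. -/
theorem four_mul_card_le {V : Type} (Q : Finset V) (st : V → Fin 3) (bit : V → Prop) (ρ : V → V)
    (h12 : (Q.filter fun v => st v = 1).card = (Q.filter fun v => st v = 2).card)
    (hρ : ∀ v ∈ Q, st v = 0 → ρ v ∈ Q ∧ st (ρ v) ≠ 0)
    (hb : ∀ s ∈ Q, |∑ v ∈ Q with st v = 0 ∧ ρ v = s, sgn (bit v)| ≤ 1) :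
    4 * (Q.filter fun v => st v = 1 ∨ st v = 0 ∧ bit v).card ≤ 3 * Q.card ∧
    4 * (Q.filter fun v => st v = 2 ∨ st v = 0 ∧ ¬ bit v).card ≤ 3 * Q.card := by
  have hQ : Q.card = (Q.filter fun v => st v = 1).card + (Q.filter fun v => st v = 2).card +
      (Q.filter fun v => st v = 0).card := by
    have h1 := Finset.card_filter_add_card_filter_not (s := Q) fun v => st v = 0
    have h2 := Finset.card_filter_add_card_filter_not (s := Q.filter fun v => ¬ st v = 0)
      fun v => st v = 1
    rw [Finset.filter_filter, Finset.filter_filter] at h2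
    have h3 : (Q.filter fun v => ¬ st v = 0 ∧ st v = 1) = Q.filter fun v => st v = 1 := by
      ext v; simp only [Finset.mem_filter]; constructor
      · tauto
      · rintro ⟨h, h'⟩; exact ⟨h, by rw [h']; simp, h'⟩
    have h4 : (Q.filter fun v => ¬ st v = 0 ∧ ¬ st v = 1) = Q.filter fun v => st v = 2 := by
      ext v; simp only [Finset.mem_filter]
      refine and_congr_right fun _ => ?_
      generalize st v = x
      fin_cases x <;> simp
    rw [h3, h4] at h2
    omega
  have hne : (Q.filter fun s => st s ≠ 0).card =
      (Q.filter fun v => st v = 1).card + (Q.filter fun v => st v = 2).card := by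
    have h1 := Finset.card_filter_add_card_filter_not (s := Q) fun v => st v = 0
    simp only [ne_eq]
    omega
  constructor
  · have h1 := four_mul_card_filter_le Q st bit ρ hρ hb
    have h2 : (Q.filter fun v => st v = 1 ∨ st v = 0 ∧ bit v).card ≤
        (Q.filter fun v => st v = 1).card + (Q.filter fun v => st v = 0 ∧ bit v).card := by
      rw [Finset.filter_or]
      exact Finset.card_union_le _ _
    omega
  · have h1 := four_mul_card_filter_le Q st (fun v => ¬ bit v) ρ hρ (fun s hs => by
      simp only [sgn_not, Finset.sum_neg_distrib, abs_neg]
      exact hb s hs)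
    have h2 : (Q.filter fun v => st v = 2 ∨ st v = 0 ∧ ¬ bit v).card ≤
        (Q.filter fun v => st v = 2).card + (Q.filter fun v => st v = 0 ∧ ¬ bit v).card := by
      rw [Finset.filter_or]
      exact Finset.card_union_le _ _
    omega

/-! ### Balanced coloring of the trees of a forest -/

section

variable {Addr : Type} {J : Type 1} {N : J → Net Addr} {F : ∀ I, Forest (N I)} {H : ℕ}
  {W α : Type} {f : Fam N α} {q : ℕ}

/-- Every tree with an edge of `Cross` to another tree selects such an edge. -/
theorem Pointed.learn_info [Nonempty W] {b : ℕ} (hq : 0 < q) (hId : Fits q W (Ident b))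
    (hProp : Fits q W Prop) (hH : ∀ I v, (F I).depth v ≤ H)
    (hFa : Det f (fun I v => (F I).parAddr v)) (Cross : ∀ I, (N I).V → (N I).V → Prop)
    (hsymm : ∀ I x y, Cross I x y → Cross I y x) (hadj : ∀ I x y, Cross I x y → (N I).G.Adj x y)
    (hcr : Det f (fun I v => ({a | ∃ y, Cross I v y ∧ (N I).addr y = a} : Set Addr)))
    (cid : Fam N (Ident b)) (hcid : Det f cid)
    (hcc : ∀ I v w, (F I).root v = (F I).root w → cid I v = cid I w)
    (hne : ∀ I x y, Cross I x y → (F I).root x ≠ (F I).root y → cid I x ≠ cid I y) :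
    ∃ X : Pointed F H,
      (∀ I v, X.act I v ↔ ∃ x y, (F I).root x = (F I).root v ∧ Cross I x y ∧
        (F I).root y ≠ (F I).root v) ∧
      (∀ I v, X.act I v → Cross I (X.led I v) (X.nxt I v)) ∧
      Learn (Option W) (4 * H + 3 * q + 3) f X.info := by
  have : Inhabited (Ident b) := ⟨⟨0, by positivity⟩⟩
  have l1 := Learn.recv hId hq (f := f) (fun I v _ => cid I v : Fam N (Addr → Ident b))
    (hcid.map fun x _ => x)
  let r : Fam N (Addr → Ident b) := fun I v => (N I).recv (fun v _ => cid I v) v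
  let cr : Fam N (Set Addr) := fun I v => {a | ∃ y, Cross I v y ∧ (N I).addr y = a}
  let f1 := (fun I v => (f I v, r I v) : Fam N _)
  have d1 : Det f1 f := Det.fst
  -- Neighbors cannot see each other's roots; comparing the tree identifiers detects whether an edge
  -- of `Cross` leaves the tree.
  let cand : Fam N (Set Addr) := fun I v => {a | a ∈ cr I v ∧ r I v a ≠ cid I v}
  have dcand : Det f1 cand := (d1.trans hcr).map₃ (Det.snd (g := r)) (d1.trans hcid)
    fun (A : Set Addr) g c => {a | a ∈ A ∧ g a ≠ c}
  have mem_cand : ∀ I v a, a ∈ cand I v ↔ ∃ y, Cross I v y ∧ (F I).root y ≠ (F I).root v ∧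
      (N I).addr y = a := by
    intro I v a
    simp only [cand, cr, Set.mem_ofPred_eq]
    constructor
    · rintro ⟨⟨y, hy, rfl⟩, h⟩
      refine ⟨y, hy, fun e => h ?_, rfl⟩
      simp only [r]
      rw [Net.recv_adj _ _ (hadj I _ _ hy)]
      exact hcc I _ _ e
    · rintro ⟨y, hy, h, rfl⟩
      refine ⟨⟨y, hy, rfl⟩, ?_⟩
      simp only [r]
      rw [Net.recv_adj _ _ (hadj I _ _ hy)]
      exact (hne I _ _ hy (Ne.symm h)).symm
  let item : Fam N Prop := fun I v => (cand I v).Nonempty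
  have ditem : Det f1 item := dcand.map fun (A : Set Addr) => A.Nonempty
  obtain ⟨P, hP, hroot, hsel, l2⟩ := Learn.select (W := W) hH (d1.trans hFa) item ditem
  let sel : Fam N Prop := fun I v => item I v ∧ lead (F I) (P I) v = v
  let f2 := (fun I v => (f1 I v, ((P I).parAddr v, sel I v)) : Fam N _)
  have d21 : Det f2 f1 := Det.fst
  have d2 : Det f2 f := d21.trans d1
  have dP : Det f2 (fun I v => (P I).parAddr v) := Det.snd.map Prod.fst
  have dsel : Det f2 sel := Det.snd.map Prod.snd
  have l3 := Learn.leadcast (f := f2) hProp hH hP (d2.trans hFa) dP item (d21.trans ditem)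
  let act : Fam N Prop := fun I v => item I (lead (F I) (P I) v)
  let out : ∀ I, (N I).V → (N I).V := fun I v =>
    if h : ∃ y, pick (cand I v) = some ((N I).addr y) then h.choose else v
  have out_spec : ∀ I v, item I v → pick (cand I v) = some ((N I).addr (out I v)) ∧
      Cross I v (out I v) ∧ (F I).root (out I v) ≠ (F I).root v := by
    intro I v hv
    obtain ⟨a, ha, hp⟩ := exists_pick hv
    obtain ⟨y, hy, hr, rfl⟩ := (mem_cand I v a).1 ha
    have hex : ∃ y, pick (cand I v) = some ((N I).addr y) := ⟨y, hp⟩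
    have e : out I v = y := by
      simp only [out, dif_pos hex]
      exact (N I).inj (Option.some.inj (hex.choose_spec.symm.trans hp))
    rw [e]
    exact ⟨hp, hy, hr⟩
  have act_of : ∀ I v x, (F I).root x = (F I).root v → item I x → act I v := by
    intro I v x h hx
    have := hsel I x hx
    rwa [lead_congr h] at this
  let X : Pointed F H :=
    { depth_le := hH
      P := P
      depth_le' := hP
      root_lead := hroot
      act := act
      act_congr := fun I v w h => by simp only [act, lead_congr h]
      out := out
      adj := fun I v h => hadj I _ _ (out_spec I _ h).2.1
      -- By symmetry of `Cross`, the other endpoint is a candidate of its own tree, which is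
      -- therefore active as well.
      act_out := fun I v h => by
        obtain ⟨-, h2, h3⟩ := out_spec I _ h
        exact act_of I _ _ rfl ⟨_, (mem_cand I _ _).2 ⟨_, hsymm I _ _ h2, Ne.symm h3, rfl⟩⟩
      out_ne := fun I v h => by
        have := (out_spec I _ h).2.2
        rwa [hroot] at this }
  refine ⟨X, fun I v => ⟨fun h => ?_, ?_⟩, fun I v h => (out_spec I _ h).2.1, ?_⟩
  · obtain ⟨-, h2, h3⟩ := out_spec I _ h
    rw [hroot] at h3
    exact ⟨_, _, hroot I v, h2, h3⟩
  · rintro ⟨x, y, h1, h2, h3⟩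
    refine act_of I v x h1 ⟨_, (mem_cand I _ _).2 ⟨y, h2, ?_, rfl⟩⟩
    rwa [h1]
  · have := ((l1.comp l2).comp l3 : Solves (Option W) _ f (fun I v => (f2 I v, act I v) : Fam N _))
    rw [show q + (2 * H + 3) + 2 * (H + q) = 4 * H + 3 * q + 3 by ring] at this
    refine this.post ((Det.fst.trans d2).pair ?_)
    let pk : Prop → Set Addr → Option Addr := fun x A => if x then pick A else none
    have hinfo : X.info = fun I v => ((F I).parAddr v, (P I).parAddr v, act I v,
        pk (sel I v) (cand I v)) := by
      funext I v
      have e : (X.act I v ∧ X.led I v = v) ↔ sel I v := by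
        show (item I (lead (F I) (P I) v) ∧ lead (F I) (P I) v = v) ↔
          (item I v ∧ lead (F I) (P I) v = v)
        constructor
        · rintro ⟨h1, h2⟩
          rw [h2] at h1
          exact ⟨h1, h2⟩
        · rintro ⟨h1, h2⟩
          rw [h2]
          exact ⟨h1, rfl⟩
      by_cases h : sel I v
      · simp only [Pointed.info, if_pos (e.2 h), pk, if_pos h, (out_spec I v h.1).1]
        rfl
      · simp only [Pointed.info, if_neg (fun h' => h (e.1 h')), pk, if_neg h]
        rfl
    rw [hinfo]
    have df : Det (fun I v => (f2 I v, act I v) : Fam N _) f2 := Det.fst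
    exact (df.trans (d2.trans hFa)).pair ((df.trans dP).pair (Det.snd.pair
      ((df.trans dsel).map₂ (df.trans (d21.trans dcand)) pk)))

/-- The color of a tree, given whether it is active, its status in the matching, and its label. -/
def colorOf (act : Prop) (st : Fin 3) (bit : Prop) : Option Color :=
  if act then some (if st = 1 ∨ st = 0 ∧ bit then Color.red else Color.blue) else none

theorem colorOf_red {act : Prop} {st : Fin 3} {bit : Prop} :
    colorOf act st bit = some Color.red ↔ act ∧ (st = 1 ∨ st = 0 ∧ bit) := by
  unfold colorOf
  by_cases h1 : act <;> by_cases h2 : st = 1 ∨ st = 0 ∧ bit <;> simp [h1, h2]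

theorem colorOf_blue {act : Prop} {st : Fin 3} {bit : Prop} :
    colorOf act st bit = some Color.blue ↔ act ∧ (st = 2 ∨ st = 0 ∧ ¬ bit) := by
  unfold colorOf
  fin_cases st <;> by_cases h1 : act <;> by_cases h2 : bit <;> simp [h1, h2]

/-- The number of rounds of the coloring algorithm for forests. -/
def colorRounds (b H q : ℕ) : ℕ :=
  H + q + (4 * H + 3 * q + 3) + logStar b * (q + 2 * (H + q)) + 8 * (6 * H + 4 * q + 5) +
    (4 * H + 2 * q + 5)

/-- A balanced coloring of the trees that have an edge of `Cross` to another tree. -/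
theorem Learn.balanced [Nonempty W] [∀ I, Fintype (N I).V] {b : ℕ} (hb : 1 ≤ b) (hq : 0 < q)
    (hId : Fits q W (Ident b)) (hProp : Fits q W Prop) (hH : ∀ I v, (F I).depth v ≤ H)
    (hFa : Det f (fun I v => (F I).parAddr v)) (Cross : ∀ I, (N I).V → (N I).V → Prop)
    (hsymm : ∀ I x y, Cross I x y → Cross I y x) (hadj : ∀ I x y, Cross I x y → (N I).G.Adj x y)
    (hcr : Det f (fun I v => ({a | ∃ y, Cross I v y ∧ (N I).addr y = a} : Set Addr)))
    (cid : Fam N (Ident b)) (hcid : Det f cid)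
    (hne : ∀ I x y, Cross I x y → (F I).root x ≠ (F I).root y →
      cid I ((F I).root x) ≠ cid I ((F I).root y)) :
    ∃ χ : Fam N (Option Color),
      (∀ I v w, (F I).root v = (F I).root w → χ I v = χ I w) ∧
      (∀ I v, χ I v ≠ none ↔ ∃ x y, (F I).root x = (F I).root v ∧ Cross I x y ∧
        (F I).root y ≠ (F I).root v) ∧
      (∀ I (Q : Finset (N I).V), (∀ v ∈ Q, (F I).root v = v) → (∀ v ∈ Q, χ I v ≠ none) →
        (∀ x y, Cross I x y → (F I).root x ∈ Q → (F I).root y ∈ Q) →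
        ∀ c : Color, 4 * (Q.filter fun v => χ I v = some c).card ≤ 3 * Q.card) ∧
      Learn (Option W) (colorRounds b H q) f χ := by
  have : Nonempty (Ident b) := ⟨⟨0, by positivity⟩⟩
  let rid : Fam N (Ident b) := fun I v => cid I ((F I).root v)
  have l1 := Learn.broadcast hId F hH hFa cid hcid
  let f1 := (fun I v => (f I v, rid I v) : Fam N _)
  have d1 : Det f1 f := Det.fst
  obtain ⟨X, hact, hcross, l2⟩ := Pointed.learn_info (f := f1) hq hId hProp hH (d1.trans hFa) Cross
    hsymm hadj (d1.trans hcr) rid Det.snd (fun I v w h => by simp only [rid, h]) hne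
  let f2 := (fun I v => (f1 I v, X.info I v) : Fam N _)
  have hX2 : Det f2 X.info := Det.snd
  obtain ⟨col, hcol1, hcol2, hcol3, l3⟩ := Pointed.learn_coloring (f := f2) hb hq hId hX2 rid
    ((Det.fst (f := f1)).trans (Det.snd (g := rid))) (fun I v w h => by simp only [rid, h])
    (fun I v h => hne I _ _ (hcross I v h) (by
      rw [Pointed.root_led]
      exact Ne.symm (X.out_ne I v h)) |> fun e => by
        simpa only [rid, Pointed.root_led] using e)
  let f3 := (fun I v => (f2 I v, col I v) : Fam N _)
  have hX3 : Det f3 X.info := (Det.fst (f := f2)).trans hX2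
  obtain ⟨st, hm, hmax, l4⟩ := Pointed.learn_matching (f := f3) hProp hX3 col Det.snd hcol1 hcol2 8
    hcol3
  let f4 := (fun I v => (f3 I v, st I v) : Fam N _)
  have d43 : Det f4 f3 := Det.fst
  have dst4 : Det f4 st := Det.snd
  obtain ⟨bit, hbit, hbal, l5⟩ := Pointed.learn_split (f := f4) hProp (d43.trans hX3)
    (fun I v => st I v = 0) (dst4.map fun x => x = 0) (fun I v w h => by rw [hm.congr I v w h])
  let f5 := (fun I v => (f4 I v, bit I v) : Fam N _)
  have d54 : Det f5 f4 := Det.fst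
  let χ : Fam N (Option Color) := fun I v => colorOf (X.act I v) (st I v) (bit I v)
  have hχ : ∀ I v, χ I v ≠ none ↔ X.act I v := by
    intro I v
    simp only [χ, colorOf]
    split_ifs with h <;> simp [h]
  refine ⟨χ, fun I v w h => ?_, fun I v => (hχ I v).trans (hact I v), ?_, ?_⟩
  · simp only [χ, X.act_congr I v w h, hm.congr I v w h, hbit I v w h]
  · intro I Q hQr hQa hQc
    have hQact : ∀ v ∈ Q, X.act I v := fun v hv => (hχ I v).1 (hQa v hv)
    -- Pointers follow `Cross`, so they neither leave nor enter `Q`. Hence the matching and the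
    -- assignment of unmatched trees restrict to `Q`, and the count can be made there.
    have hfwd : ∀ v, X.act I v → (F I).root v ∈ Q → (F I).root (X.nxt I v) ∈ Q := by
      intro v hv h
      refine hQc _ _ (hcross I v hv) ?_
      rwa [Pointed.root_led]
    have hbwd : ∀ v, X.act I v → (F I).root (X.nxt I v) ∈ Q → (F I).root v ∈ Q := by
      intro v hv h
      have := hQc _ _ (hsymm I _ _ (hcross I v hv)) h
      rwa [Pointed.root_led] at this
    have hcount := four_mul_card_le Q (st I) (bit I) (fun v => (F I).root (X.nxt I v)) ?_ ?_ ?_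
    · intro c
      cases c with
      | red =>
        refine le_trans (Nat.mul_le_mul_left 4 (Finset.card_le_card ?_)) hcount.1
        intro v hv
        simp only [Finset.mem_filter, χ, colorOf_red] at hv ⊢
        exact ⟨hv.1, hv.2.2⟩
      | blue =>
        refine le_trans (Nat.mul_le_mul_left 4 (Finset.card_le_card ?_)) hcount.2
        intro v hv
        simp only [Finset.mem_filter, χ, colorOf_blue] at hv ⊢
        exact ⟨hv.1, hv.2.2⟩
    -- The matching is a bijection from proposers to acceptors, so red and blue are equally frequent
    -- among matched trees.
    · refine Finset.card_bij (fun v _ => (F I).root (X.nxt I v)) ?_ ?_ ?_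
      · intro v hv
        rw [Finset.mem_filter] at hv ⊢
        obtain ⟨h1, h2⟩ := hm.nxt_eq_two I v hv.2
        refine ⟨hfwd v h1 (by rw [hQr v hv.1]; exact hv.1), ?_⟩
        rw [hm.congr I _ _ ((F I).root_root _), h2]
      · intro v hv w hw h
        rw [Finset.mem_filter] at hv hw
        have := hm.inj I v w hv.2 hw.2 h
        rwa [hQr v hv.1, hQr w hw.1] at this
      · intro w hw
        rw [Finset.mem_filter] at hw
        obtain ⟨v, hv, h⟩ := hm.surj I w hw.2
        have e := (F I).root_root v
        have hva := (hm.nxt_eq_two I v hv).1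
        refine ⟨(F I).root v, ?_, ?_⟩
        · rw [Finset.mem_filter, hm.congr I _ _ e]
          refine ⟨hbwd v hva ?_, hv⟩
          rw [h, hQr w hw.1]
          exact hw.1
        · rw [Pointed.nxt_congr e, h, hQr w hw.1]
    · intro v hv h0
      have ha := hQact v hv
      refine ⟨hfwd v ha (by rw [hQr v hv]; exact hv), ?_⟩
      rw [hm.congr I _ _ ((F I).root_root _)]
      exact (hmax I v ha).resolve_left fun h => h h0
    · intro s hs
      convert hbal I s using 3
      ext v
      simp only [Finset.mem_filter, Finset.mem_univ, true_and]
      constructor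
      · rintro ⟨h1, h2, h3⟩
        exact ⟨hQr v h1, hQact v h1, h2, h3⟩
      · rintro ⟨h1, h2, h3, h4⟩
        refine ⟨?_, h3, h4⟩
        rw [← h1]
        exact hbwd v h2 (by rw [h4]; exact hs)
  · have := ((((l1.comp l2).comp l3).comp l4).comp l5 : Solves (Option W) _ f f5)
    refine this.post ?_
    have d5 : Det f5 f := d54.trans (d43.trans ((Det.fst (f := f2)).trans
      ((Det.fst (f := f1)).trans d1)))
    exact d5.pair ((d54.trans (Pointed.known_act (d43.trans hX3))).map₃ (d54.trans dst4) Det.snd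
      colorOf)

end

/-! ### Several channels per edge -/

/-- The network in which every node is replaced by one node for each channel. Nodes that come from
the same node are adjacent, and nodes on the same channel are adjacent if they come from adjacent
nodes and the edge between these carries the channel. -/
def Net.virtual {A Ch : Type} (N : Net A) (E : N.V → A → Set Ch)
    (hE : ∀ v u, N.G.Adj v u → E v (N.addr u) = E u (N.addr v)) : Net (A × Ch) where
  V := N.V × Ch
  G :=
    { Adj := fun x y => (x.1 = y.1 ∧ x.2 ≠ y.2) ∨
        (N.G.Adj x.1 y.1 ∧ x.2 = y.2 ∧ x.2 ∈ E x.1 (N.addr y.1))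
      symm := ⟨by
        rintro ⟨v, a⟩ ⟨u, a'⟩ (⟨h1, h2⟩ | ⟨h1, h2, h3⟩)
        · exact Or.inl ⟨h1.symm, Ne.symm h2⟩
        · refine Or.inr ⟨h1.symm, h2.symm, ?_⟩
          have h2 : a = a' := h2
          subst h2
          have h3 : a ∈ E v (N.addr u) := h3
          rwa [hE v u h1] at h3⟩
      loopless := ⟨by
        rintro ⟨v, a⟩ (⟨-, h⟩ | ⟨h, -⟩)
        · exact h rfl
        · exact N.G.loopless.irrefl _ h⟩ }
  addr x := (N.addr x.1, x.2)
  inj := by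
    rintro ⟨v, a⟩ ⟨u, a'⟩ h
    simp only [Prod.mk.injEq] at h
    rw [N.inj h.1, h.2]

/-- Only the channels that the edge actually carries need to be recoverable, so the message length
depends on `S` and not on the total number of channels. -/
theorem exists_code {Ch M : Type} [Finite Ch] [Fintype M] [Nonempty M] {S B : ℕ}
    (hB : Fintype.card M ^ S ≤ 2 ^ B) :
    ∃ code : Set Ch → (Ch → M) → Message B, ∀ E : Set Ch, E.ncard ≤ S →
      ∀ x y, code E x = code E y → ∀ a ∈ E, x a = y a := by
  have key : ∀ E : Set Ch, ∃ e : (Ch → M) → Message B, E.ncard ≤ S →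
      ∀ x y, e x = e y → ∀ a ∈ E, x a = y a := by
    intro E
    by_cases h : E.ncard ≤ S
    · have := Fintype.ofFinite E
      have hc : Fintype.card (E → M) ≤ Fintype.card (Message B) := by
        rw [Fintype.card_fun, Fintype.card_fun, Fintype.card_bool, Fintype.card_fin]
        refine le_trans (Nat.pow_le_pow_right Fintype.card_pos ?_) hB
        rwa [← Nat.card_eq_fintype_card, Nat.card_coe_set_eq]
      obtain ⟨e⟩ := Function.Embedding.nonempty_of_card_le hc
      refine ⟨fun x => e fun a => x a, fun _ x y hxy a ha => ?_⟩
      exact congrFun (e.injective hxy) ⟨a, ha⟩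
    · exact ⟨fun _ _ => false, fun h' => (h h').elim⟩
  choose code hcode using key
  exact ⟨code, hcode⟩

/-- An algorithm for the network with channels can be simulated in the original network. -/
theorem Solves.simulate {A Ch : Type} [Finite Ch] {J : Type 1} {N : J → Net A}
    {E : ∀ I, (N I).V → A → Set Ch}
    {hE : ∀ I v u, (N I).G.Adj v u → E I v ((N I).addr u) = E I u ((N I).addr v)}
    {S B : ℕ} (hS : ∀ I v u, (N I).G.Adj v u → (E I v ((N I).addr u)).ncard ≤ S)
    {M : Type} [Fintype M] [Nonempty M] (hB : Fintype.card M ^ S ≤ 2 ^ B)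
    {α₀ : Type} {loc : Fam N α₀} (hlocE : Det loc (fun I v => E I v))
    (hloca : Det loc (fun I v => (N I).addr v)) {t : ℕ} {α β : Type}
    {f : Fam (fun I => (N I).virtual (E I) (hE I)) α}
    {g : Fam (fun I => (N I).virtual (E I) (hE I)) β} (h : Solves M t f g) :
    Solves (Message B) t (fun I v => (loc I v, fun a => f I (v, a)) : Fam N (α₀ × (Ch → α)))
      (fun I v => (loc I v, fun a => g I (v, a)) : Fam N (α₀ × (Ch → β))) := by
  induction t generalizing α with
  | zero =>
    obtain ⟨φ, hφ⟩ := h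
    exact ⟨fun x => (x.1, fun a => φ (x.2 a)), fun I v => by
      simp only [Prod.mk.injEq, true_and]
      funext a
      exact hφ I (v, a)⟩
  | succ t ih =>
    obtain ⟨η, m, u, h⟩ := h
    have ih := ih h
    obtain ⟨code, hcode⟩ := exists_code (Ch := Ch) (M := M) hB
    obtain ⟨lE, hlE⟩ := hlocE
    obtain ⟨la, hla⟩ := hloca
    let msg : Fam N (A → Message B) := fun I v j =>
      code (E I v j) fun a => m (f I (v, a)) (j, a)
    have hmsg : Det (fun I v => (loc I v, fun a => f I (v, a)) : Fam N (α₀ × (Ch → α))) msg :=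
      ⟨fun x j => code (lE x.1 j) fun a => m (x.2 a) (j, a), fun I v => by
        simp only [msg, hlE]⟩
    have hround := Learn.inbox msg hmsg
    let dec : Set Ch → Message B → Ch → M := fun E y =>
      Classical.epsilon fun x => code E x = y
    have hdec : ∀ (E : Set Ch) (x : Ch → M), E.ncard ≤ S → ∀ a ∈ E, dec E (code E x) a = x a := by
      intro E x hE a ha
      have : code E (dec E (code E x)) = code E x :=
        Classical.epsilon_spec (p := fun z => code E z = code E x) ⟨x, rfl⟩
      exact hcode E hE _ _ this a ha
    rw [Nat.add_comm]
    refine Solves.comp (hround.post ?_) ih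
    -- A real node reconstructs the inbox of each of its copies. Messages between its own copies are
    -- computed locally; those from neighbors are decoded on the channel of the copy.
    let upd : (α₀ × (Ch → α)) × (A → Option (Message B)) → α₀ × (Ch → η) := fun x =>
      (x.1.1, fun a => u (x.1.2 a) fun j =>
        if j.1 = la x.1.1 then
          if j.2 ≠ a then some (m (x.1.2 j.2) (la x.1.1, a)) else none
        else if j.2 = a ∧ a ∈ lE x.1.1 j.1 then
          (x.2 j.1).map fun y => dec (lE x.1.1 j.1) y a
        else none)
    refine ⟨upd, fun I v => ?_⟩
    simp only [upd, Prod.mk.injEq, true_and]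
    funext a
    congr 1
    funext j
    obtain ⟨j, a'⟩ := j
    have hla' : la (loc I v) = (N I).addr v := (hla I v).symm
    have hlE' : lE (loc I v) = E I v := (hlE I v).symm
    simp only [hla', hlE']
    set VN := (N I).virtual (E I) (hE I)
    by_cases hj : j = (N I).addr v
    · subst hj
      rw [if_pos rfl]
      by_cases ha : a' ≠ a
      · rw [if_pos ha]
        exact VN.inbox_adj (fun w => m (f I w)) (v := (v, a)) (u := (v, a'))
          (Or.inl ⟨rfl, Ne.symm ha⟩)
      · rw [if_neg ha]
        refine VN.inbox_none _ ?_
        rintro ⟨⟨w', a''⟩, h1 | h1, h2⟩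
        · obtain ⟨h2, h3⟩ : (N I).addr w' = _ ∧ a'' = a' := Prod.mk.inj h2
          exact h1.2 ((h3.trans (not_not.1 ha)).symm)
        · obtain ⟨h2, h3⟩ : (N I).addr w' = _ ∧ a'' = a' := Prod.mk.inj h2
          rw [(N I).inj h2] at h1
          exact (N I).G.loopless.irrefl _ h1.1
    · rw [if_neg hj]
      by_cases hex : ∃ w, (N I).G.Adj v w ∧ (N I).addr w = j
      · obtain ⟨w, hw, rfl⟩ := hex
        rw [Net.inbox_adj _ _ hw, Option.map_some]
        by_cases ha : a' = a ∧ a ∈ E I v ((N I).addr w)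
        · rw [if_pos ha]
          obtain ⟨rfl, ha⟩ := ha
          refine (VN.inbox_adj (fun w => m (f I w)) (v := (v, a')) (u := (w, a'))
            (Or.inr ⟨hw, rfl, ha⟩)).trans ?_
          simp only [msg]
          rw [hE I v w hw, hdec _ _ (by rw [← hE I v w hw]; exact hS I v w hw) a'
            (by rwa [← hE I v w hw])]
          rfl
        · rw [if_neg ha]
          refine VN.inbox_none _ ?_
          rintro ⟨⟨w', a''⟩, h1 | h1, h2⟩
          · obtain ⟨h2, h3⟩ : (N I).addr w' = _ ∧ a'' = a' := Prod.mk.inj h2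
            apply hj
            rw [show v = w' from h1.1, h2]
          · obtain ⟨h2, h3⟩ : (N I).addr w' = _ ∧ a'' = a' := Prod.mk.inj h2
            rw [(N I).inj h2] at h1
            exact ha ⟨h3.symm.trans h1.2.1.symm, h1.2.2⟩
      · rw [Net.inbox_none _ _ hex, Option.map_none, ite_self]
        refine VN.inbox_none _ ?_
        rintro ⟨⟨w', a''⟩, h1 | h1, h2⟩
        · obtain ⟨h2, h3⟩ : (N I).addr w' = _ ∧ a'' = a' := Prod.mk.inj h2
          apply hj
          rw [show v = w' from h1.1, h2]
        · obtain ⟨h2, h3⟩ : (N I).addr w' = _ ∧ a'' = a' := Prod.mk.inj h2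
          exact hex ⟨w', h1.1, h2⟩

/-! ### Steiner trees and search trees as a forest -/

/-- A channel belongs to the Steiner tree of a cluster, given by its identifier, or to a level. -/
abbrev Chan (b L : ℕ) : Type := Ident b ⊕ Fin L

/-- The channels of the edge to the neighbor `j`. -/
def chans {b : ℕ} (L : ℕ) (l : LocalInput b) (j : Ident b) : Set (Chan b L) :=
  {x | Sum.elim (fun k => ∃ tv, l.trees k = some tv ∧ (tv.parent = some j ∨ j ∈ tv.children))
    (fun _ => True) x}

namespace ClusteredNetwork

variable {V C : Type} {G : SimpleGraph V} {b : ℕ} (I : ClusteredNetwork G C b)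

/-- The network, with the identifiers as addresses. -/
def toNet : Net (Ident b) := ⟨V, G, I.ident, I.ident_injective⟩

theorem trees_eq_some {v : V} {k : Ident b} {tv : TreeView b} :
    (I.localInput v).trees k = some tv ↔
      ∃ κ, I.clusterIdent κ = k ∧ v ∈ (I.tree κ).verts ∧ I.treeView κ v = tv := by
  simp only [localInput]
  constructor
  · intro h
    split_ifs at h with hex
    exact ⟨hex.choose, hex.choose_spec.1, hex.choose_spec.2, Option.some.inj h⟩
  · rintro ⟨κ, h1, h2, h3⟩
    have hex : ∃ κ, I.clusterIdent κ = k ∧ v ∈ (I.tree κ).verts := ⟨κ, h1, h2⟩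
    have e : hex.choose = κ := I.clusterIdent_injective (hex.choose_spec.1.trans h1.symm)
    rw [dif_pos hex, e, h3]

theorem treeView_parent {κ : C} {v u : V} :
    (I.treeView κ v).parent = some (I.ident u) ↔
      v ≠ (I.tree κ).root ∧ (I.tree κ).parent v = u := by
  simp only [treeView]
  split_ifs with h
  · simp [h]
  · simp [h, I.ident_injective.eq_iff]

theorem inl_mem_chans {L : ℕ} {v u : V} {k : Ident b} :
    Sum.inl k ∈ chans L (I.localInput v) (I.ident u) ↔
      ∃ κ, I.clusterIdent κ = k ∧ v ∈ (I.tree κ).verts ∧ u ∈ (I.tree κ).verts ∧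
        (v ≠ (I.tree κ).root ∧ (I.tree κ).parent v = u ∨
          u ≠ (I.tree κ).root ∧ (I.tree κ).parent u = v) := by
  simp only [chans, Set.mem_ofPred_eq, Sum.elim_inl, trees_eq_some]
  constructor
  · rintro ⟨tv, ⟨κ, h1, h2, rfl⟩, h3 | h3⟩
    · rw [treeView_parent] at h3
      exact ⟨κ, h1, h2, h3.2 ▸ (I.tree κ).parent_mem v h2 h3.1, Or.inl h3⟩
    · obtain ⟨w, hw1, hw2, hw3, hw4⟩ := h3
      cases I.ident_injective hw4
      exact ⟨κ, h1, h2, hw1, Or.inr ⟨hw2, hw3⟩⟩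
  · rintro ⟨κ, h1, h2, h3, h4⟩
    refine ⟨_, ⟨κ, h1, h2, rfl⟩, h4.imp (I.treeView_parent).2 fun h => ?_⟩
    exact ⟨u, h3, h.1, h.2, rfl⟩

/-- Sender and receiver must use the same code, so both endpoints have to derive the same channel
set from their own inputs. Each sees a tree edge, one from its parent and the other from its
children. -/
theorem chans_symm (L : ℕ) (v u : V) :
    chans L (I.localInput v) (I.ident u) = chans L (I.localInput u) (I.ident v) := by
  ext x
  cases x with
  | inl k =>
    rw [inl_mem_chans, inl_mem_chans]
    refine exists_congr fun κ => ?_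
    tauto
  | inr i => exact ⟨fun _ => trivial, fun _ => trivial⟩

theorem ncard_chans_le [Finite C] (L S : ℕ) (v u : V)
    (h : {κ | v ∈ (I.tree κ).verts}.ncard ≤ S) :
    (chans L (I.localInput v) (I.ident u)).ncard ≤ S + L := by
  have hsub : chans L (I.localInput v) (I.ident u) ⊆
      (fun κ => Sum.inl (I.clusterIdent κ)) '' {κ | v ∈ (I.tree κ).verts} ∪
        Set.range Sum.inr := by
    intro x hx
    cases x with
    | inl k =>
      obtain ⟨κ, h1, h2, -⟩ := I.inl_mem_chans.1 hx
      exact Or.inl ⟨κ, h2, congrArg Sum.inl h1⟩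
    | inr i => exact Or.inr ⟨i, rfl⟩
  refine (Set.ncard_le_ncard hsub).trans ((Set.ncard_union_le _ _).trans ?_)
  refine Nat.add_le_add ((Set.ncard_image_le).trans h) ?_
  rw [← Set.image_univ]
  refine (Set.ncard_image_le).trans ?_
  rw [Set.ncard_univ, Nat.card_eq_fintype_card, Fintype.card_fin]

/-- The network in which the Steiner trees and the levels have separate channels. -/
def vnet (L : ℕ) : Net (Ident b × Chan b L) :=
  I.toNet.virtual (fun v j => chans L (I.localInput v) j) (fun v u _ => I.chans_symm L v u)

theorem vnet_adj_same {L : ℕ} {v : V} {x y : Chan b L} (h : x ≠ y) :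
    (I.vnet L).G.Adj (v, x) (v, y) := Or.inl ⟨rfl, h⟩

theorem vnet_adj_level {L : ℕ} {v u : V} (h : G.Adj v u) (i : Fin L) :
    (I.vnet L).G.Adj (v, Sum.inr i) (u, Sum.inr i) := Or.inr ⟨h, rfl, trivial⟩

theorem vnet_adj_of_ne {L : ℕ} {v u : V} {x y : Chan b L} (hne : v ≠ u)
    (h : (I.vnet L).G.Adj (v, x) (u, y)) : G.Adj v u ∧ x = y := by
  rcases h with h | h
  · exact (hne h.1).elim
  · exact ⟨h.1, h.2.1⟩

/-- The vertices at distance at most `t` from the clusters of level `i` in the subgraph induced by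
the vertices of level at least `i`. -/
def reach (i : ℕ) : ℕ → V → Prop
  | 0, v => I.level (I.cluster v) = i
  | t + 1, v => reach i t v ∨ (i ≤ I.level (I.cluster v) ∧ ∃ u, G.Adj v u ∧ reach i t u)

variable {I}

theorem reach_mono {i s t : ℕ} (h : s ≤ t) {v : V} (hv : I.reach i s v) : I.reach i t v := by
  induction t, h using Nat.le_induction with
  | base => exact hv
  | succ t _ ih => exact Or.inl ih

theorem le_level_of_reach {i t : ℕ} {v : V} (h : I.reach i t v) : i ≤ I.level (I.cluster v) := by
  induction t with
  | zero => exact h.ge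
  | succ t ih => exact h.elim ih fun h => h.1

variable (I)

/-- The distance from the clusters of level `i`. -/
def levelDist (i : ℕ) (v : V) : ℕ := sInf {t | I.reach i t v}

variable {I}

theorem reach_levelDist {i t : ℕ} {v : V} (h : I.reach i t v) : I.reach i (I.levelDist i v) v :=
  Nat.sInf_mem (s := {t | I.reach i t v}) ⟨t, h⟩

theorem levelDist_le {i t : ℕ} {v : V} (h : I.reach i t v) : I.levelDist i v ≤ t :=
  Nat.sInf_le (s := {t | I.reach i t v}) h

theorem exists_closer {i t : ℕ} {v : V} (h : I.reach i t v) (h0 : I.levelDist i v ≠ 0) :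
    ∃ u, G.Adj v u ∧ I.reach i (I.levelDist i v - 1) u := by
  obtain ⟨d, hd⟩ : ∃ d, I.levelDist i v = d + 1 := ⟨I.levelDist i v - 1, by omega⟩
  have h1 := reach_levelDist h
  rw [hd] at h1 ⊢
  rcases h1 with h1 | h1
  · have := levelDist_le h1
    omega
  · exact h1.2

variable (I)

/-- The identifiers of the neighbors at distance at most `t` from the clusters of level `i`. -/
def near (i t : ℕ) (v : V) : Set (Ident b) := {j | ∃ u, G.Adj v u ∧ I.ident u = j ∧ I.reach i t u}

/-- The parent in the forest: the Steiner trees are extended by search trees to depth `D` from the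
vertices of the clusters. -/
def vpar {L : ℕ} (D : ℕ) : V × Chan b L → Option (V × Chan b L)
  | (v, Sum.inl k) =>
    if h : ∃ κ, I.clusterIdent κ = k ∧ v ∈ (I.tree κ).verts ∧ v ≠ (I.tree κ).root then
      some ((I.tree h.choose).parent v, Sum.inl k)
    else none
  | (v, Sum.inr i) =>
    if I.reach i D v then
      if I.levelDist i v = 0 then some (v, Sum.inl (I.clusterIdent (I.cluster v)))
      else if h : ∃ u, G.Adj v u ∧ I.reach i (I.levelDist i v - 1) u ∧
          pick (I.near i (I.levelDist i v - 1) v) = some (I.ident u) then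
        some (h.choose, Sum.inr i)
      else none
    else none

variable {I} {L D : ℕ}

theorem vpar_inl {κ : C} {v : V} (hv : v ∈ (I.tree κ).verts) (hr : v ≠ (I.tree κ).root) :
    I.vpar (L := L) D (v, Sum.inl (I.clusterIdent κ)) =
      some ((I.tree κ).parent v, Sum.inl (I.clusterIdent κ)) := by
  have hex : ∃ κ', I.clusterIdent κ' = I.clusterIdent κ ∧ v ∈ (I.tree κ').verts ∧
      v ≠ (I.tree κ').root := ⟨κ, rfl, hv, hr⟩
  have e : hex.choose = κ := I.clusterIdent_injective hex.choose_spec.1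
  rw [vpar, dif_pos hex, e]

theorem vpar_inl_none {k : Ident b} {v : V}
    (h : ¬ ∃ κ, I.clusterIdent κ = k ∧ v ∈ (I.tree κ).verts ∧ v ≠ (I.tree κ).root) :
    I.vpar (L := L) D (v, Sum.inl k) = none := by
  rw [vpar, dif_neg h]

theorem vpar_root (κ : C) :
    I.vpar (L := L) D ((I.tree κ).root, Sum.inl (I.clusterIdent κ)) = none := by
  refine vpar_inl_none ?_
  rintro ⟨κ', h1, -, h2⟩
  cases I.clusterIdent_injective h1
  exact h2 rfl

theorem vpar_inr_zero {i : Fin L} {v : V} (h : I.reach i D v) (h0 : I.levelDist i v = 0) :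
    I.vpar D (v, Sum.inr i) = some (v, Sum.inl (I.clusterIdent (I.cluster v))) := by
  rw [vpar, if_pos h, if_pos h0]

theorem vpar_inr_pos {i : Fin L} {v : V} (h : I.reach i D v) (h0 : I.levelDist i v ≠ 0) :
    ∃ u, I.vpar D (v, Sum.inr i) = some (u, Sum.inr i) ∧ G.Adj v u ∧
      I.reach i (I.levelDist i v - 1) u ∧
      pick (I.near i (I.levelDist i v - 1) v) = some (I.ident u) := by
  obtain ⟨u, hu1, hu2⟩ := exists_closer h h0
  -- The parent is chosen among identifiers rather than vertices, so that a node can reproduce the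
  -- choice from what it has heard (`det_parAddr`).
  obtain ⟨j, ⟨w, hw1, rfl, hw3⟩, hj⟩ := exists_pick
    (S := I.near i (I.levelDist i v - 1) v) ⟨_, u, hu1, rfl, hu2⟩
  have hex : ∃ u, G.Adj v u ∧ I.reach i (I.levelDist i v - 1) u ∧
      pick (I.near i (I.levelDist i v - 1) v) = some (I.ident u) := ⟨w, hw1, hw3, hj⟩
  refine ⟨hex.choose, ?_, hex.choose_spec⟩
  rw [vpar, if_pos h, if_neg h0, dif_pos hex]

theorem vpar_inr_none {i : Fin L} {v : V} (h : ¬ I.reach i D v) :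
    I.vpar D (v, Sum.inr i) = none := by
  rw [vpar, if_neg h]

variable (I) in
/-- A rank that decreases along the parent pointers of the forest. -/
def vrank (R D : ℕ) : V × Chan b L → ℕ
  | (v, Sum.inl k) =>
    if h : ∃ κ, I.clusterIdent κ = k ∧ v ∈ (I.tree κ).verts then (I.tree h.choose).depth v else 0
  | (v, Sum.inr i) => if I.reach i D v then R + 1 + I.levelDist i v else 0

theorem vrank_inl {R : ℕ} {κ : C} {v : V} (hv : v ∈ (I.tree κ).verts) :
    I.vrank (L := L) R D (v, Sum.inl (I.clusterIdent κ)) = (I.tree κ).depth v := by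
  have hex : ∃ κ', I.clusterIdent κ' = I.clusterIdent κ ∧ v ∈ (I.tree κ').verts := ⟨κ, rfl, hv⟩
  have e : hex.choose = κ := I.clusterIdent_injective hex.choose_spec.1
  rw [vrank, dif_pos hex, e]

theorem vrank_le {R : ℕ} (hR : ∀ κ, ∀ v ∈ (I.tree κ).verts, (I.tree κ).depth v ≤ R)
    (x : V × Chan b L) : I.vrank R D x ≤ R + D + 1 := by
  rcases x with ⟨v, k | i⟩
  · rw [vrank]
    split_ifs with h
    · have := hR _ v h.choose_spec.2
      omega
    · omega
  · rw [vrank]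
    split_ifs with h
    · have := levelDist_le h
      omega
    · omega

theorem vpar_cases {x y : V × Chan b L} (h : I.vpar D x = some y) :
    (∃ κ v, v ∈ (I.tree κ).verts ∧ v ≠ (I.tree κ).root ∧ x = (v, Sum.inl (I.clusterIdent κ)) ∧
      y = ((I.tree κ).parent v, Sum.inl (I.clusterIdent κ))) ∨
    (∃ v, ∃ i : Fin L, I.reach i D v ∧ I.levelDist i v = 0 ∧ x = (v, Sum.inr i) ∧
      y = (v, Sum.inl (I.clusterIdent (I.cluster v)))) ∨
    (∃ v u, ∃ i : Fin L, I.reach i D v ∧ I.levelDist i v ≠ 0 ∧ x = (v, Sum.inr i) ∧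
      y = (u, Sum.inr i) ∧ G.Adj v u ∧ I.reach i (I.levelDist i v - 1) u) := by
  rcases x with ⟨v, k | i⟩
  · left
    by_cases hex : ∃ κ, I.clusterIdent κ = k ∧ v ∈ (I.tree κ).verts ∧ v ≠ (I.tree κ).root
    · obtain ⟨κ, rfl, h1, h2⟩ := hex
      rw [vpar_inl h1 h2] at h
      exact ⟨κ, v, h1, h2, rfl, (Option.some.inj h).symm⟩
    · rw [vpar_inl_none hex] at h
      cases h
  · right
    by_cases hr : I.reach i D v
    · by_cases h0 : I.levelDist i v = 0
      · rw [vpar_inr_zero hr h0] at h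
        exact Or.inl ⟨v, i, hr, h0, rfl, (Option.some.inj h).symm⟩
      · obtain ⟨u, h1, h2, h3, -⟩ := vpar_inr_pos hr h0
        rw [h1] at h
        exact Or.inr ⟨v, u, i, hr, h0, rfl, (Option.some.inj h).symm, h2, h3⟩
    · rw [vpar_inr_none hr] at h
      cases h

theorem vpar_adj {x y : V × Chan b L} (h : I.vpar D x = some y) : (I.vnet L).G.Adj x y := by
  rcases vpar_cases h with ⟨κ, v, h1, h2, rfl, rfl⟩ | ⟨v, i, -, -, rfl, rfl⟩ |
    ⟨v, u, i, -, -, rfl, rfl, h3, -⟩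
  · exact Or.inr ⟨(I.tree κ).adj_parent v h1 h2, rfl, I.inl_mem_chans.2
      ⟨κ, rfl, h1, (I.tree κ).parent_mem v h1 h2, Or.inl ⟨h2, rfl⟩⟩⟩
  · exact I.vnet_adj_same (by simp)
  · exact I.vnet_adj_level h3 i

/-- The offset `R + 1` puts all search nodes above every Steiner depth, which covers the step from a
search tree into its Steiner tree. -/
theorem vrank_lt {R : ℕ} (hR : ∀ κ, ∀ v ∈ (I.tree κ).verts, (I.tree κ).depth v ≤ R)
    {x y : V × Chan b L} (h : I.vpar D x = some y) : I.vrank R D y < I.vrank R D x := by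
  rcases vpar_cases h with ⟨κ, v, h1, h2, rfl, rfl⟩ | ⟨v, i, h1, -, rfl, rfl⟩ |
    ⟨v, u, i, h1, h2, rfl, rfl, -, h3⟩
  · rw [vrank_inl h1, vrank_inl ((I.tree κ).parent_mem v h1 h2),
      (I.tree κ).depth_eq v h1 h2]
    exact Nat.lt_succ_self _
  · rw [vrank_inl (I.mem_tree v), vrank, if_pos h1]
    have := hR _ v (I.mem_tree v)
    omega
  · have h4 := levelDist_le h3
    have h5 := levelDist_le h1
    have hu : I.reach i D u := reach_mono (by omega) h3
    simp only [vrank, if_pos h1, if_pos hu]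
    omega

variable (I) in
/-- The forest of the extended Steiner trees. -/
def forest (L R D : ℕ) (hR : ∀ κ, ∀ v ∈ (I.tree κ).verts, (I.tree κ).depth v ≤ R) :
    Forest (I.vnet L) :=
  Forest.ofRank (N := I.vnet L) (I.vpar D) (I.vrank R D) vpar_adj (vrank_lt hR)

/-! ### Trees of the forest versus clusters, crossing edges versus short paths -/

section Forest

variable {R : ℕ} {hR : ∀ κ, ∀ v ∈ (I.tree κ).verts, (I.tree κ).depth v ≤ R}

theorem forest_depth_le (x : V × Chan b L) : (I.forest L R D hR).depth x ≤ R + D + 1 :=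
  (Forest.ofRank_depth_le (N := I.vnet L) (I.vpar D) (I.vrank R D) vpar_adj
    (vrank_lt hR) x).trans (vrank_le hR x)

variable (I L) in
/-- The root of the extended Steiner tree of a cluster. -/
def clusterRoot (κ : C) : V × Chan b L := ((I.tree κ).root, Sum.inl (I.clusterIdent κ))

theorem clusterRoot_injective : Function.Injective (I.clusterRoot L) := by
  intro κ κ' h
  exact I.clusterIdent_injective (Sum.inl.inj (congrArg Prod.snd h))

theorem root_inl {κ : C} {v : V} (hv : v ∈ (I.tree κ).verts) :
    (I.forest L R D hR).root (v, Sum.inl (I.clusterIdent κ)) = I.clusterRoot L κ := by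
  induction hd : (I.tree κ).depth v generalizing v with
  | zero =>
    have e : v = (I.tree κ).root := by
      by_contra hne
      have := (I.tree κ).depth_eq v hv hne
      omega
    subst e
    exact Forest.root_none _ (vpar_root (D := D) κ)
  | succ d ih =>
    by_cases e : v = (I.tree κ).root
    · subst e
      exact Forest.root_none _ (vpar_root (D := D) κ)
    · refine (Forest.root_some _ (vpar_inl (D := D) hv e)).trans
        (ih ((I.tree κ).parent_mem v hv e) ?_)
      have := (I.tree κ).depth_eq v hv e
      omega

theorem root_clusterRoot (κ : C) :
    (I.forest L R D hR).root (I.clusterRoot L κ) = I.clusterRoot L κ :=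
  root_inl (I.tree κ).root_mem

theorem root_inr_of_level {i : Fin L} {v : V} (h : I.level (I.cluster v) = i) :
    (I.forest L R D hR).root (v, Sum.inr i) = I.clusterRoot L (I.cluster v) := by
  have h0 : I.reach i 0 v := h
  have hd : I.levelDist i v = 0 := Nat.le_zero.1 (levelDist_le h0)
  exact (Forest.root_some _ (vpar_inr_zero (reach_mono (Nat.zero_le _) h0) hd)).trans
    (root_inl (I.mem_tree v))

/-- Each search-tree step reduces the distance by at least one, so the parent path ends in a nearest
cluster and is itself a short walk inside $U_{i+}$. -/
theorem exists_root_inr {i : Fin L} {v : V} (h : I.reach i D v) :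
    ∃ κ, (I.forest L R D hR).root (v, Sum.inr i) = I.clusterRoot L κ ∧ I.level κ = i ∧
      ∃ (u : I.upperSet i) (hv : v ∈ I.upperSet i), I.cluster u = κ ∧
        ∃ p : (G.induce (I.upperSet i)).Walk u ⟨v, hv⟩, p.length ≤ I.levelDist i v := by
  induction hd : I.levelDist i v using Nat.strong_induction_on generalizing v with
  | _ d ih =>
    by_cases h0 : I.levelDist i v = 0
    · have hl : I.level (I.cluster v) = i := by
        have := reach_levelDist h
        rwa [h0] at this
      refine ⟨I.cluster v, root_inr_of_level hl, hl, ⟨v, hl.ge⟩, hl.ge, rfl,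
        SimpleGraph.Walk.nil, Nat.zero_le _⟩
    · obtain ⟨u, h1, h2, h3, -⟩ := vpar_inr_pos h h0
      have h4 := levelDist_le h3
      have h5 := levelDist_le h
      obtain ⟨κ, e1, e2, w, hu, e3, p, hp⟩ := ih (I.levelDist i u) (by omega)
        (reach_mono (by omega) h3) rfl
      have hv : v ∈ I.upperSet i := le_level_of_reach h
      refine ⟨κ, (Forest.root_some _ h1).trans e1, e2, w, hv, e3, ?_⟩
      have hadj : (G.induce (I.upperSet i)).Adj ⟨u, hu⟩ ⟨v, hv⟩ := h2.symm
      refine ⟨p.concat hadj, ?_⟩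
      rw [SimpleGraph.Walk.length_concat]
      omega

variable (I) in
/-- The edges between search trees that lie on short paths between clusters. -/
def Cross (D : ℕ) (x y : V × Chan b L) : Prop :=
  G.Adj x.1 y.1 ∧ ∃ i : Fin L, x.2 = Sum.inr i ∧ y.2 = Sum.inr i ∧
    ∃ s t, s + t + 1 ≤ D ∧ I.reach i s x.1 ∧ I.reach i t y.1

theorem cross_symm {x y : V × Chan b L} (h : I.Cross D x y) : I.Cross D y x := by
  obtain ⟨h1, i, h2, h3, s, t, h4, h5, h6⟩ := h
  exact ⟨h1.symm, i, h3, h2, t, s, by omega, h6, h5⟩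

theorem adj_of_cross {x y : V × Chan b L} (h : I.Cross D x y) : (I.vnet L).G.Adj x y := by
  obtain ⟨v, c⟩ := x
  obtain ⟨u, c'⟩ := y
  obtain ⟨h1, i, rfl, rfl, -⟩ := h
  exact I.vnet_adj_level h1 i

/-- The two parent paths joined by the edge form a walk of length at most $s+t+1\le D$ between the
clusters that own the cells. -/
theorem exists_of_cross {x y : V × Chan b L} (h : I.Cross D x y) :
    ∃ i : ℕ, ∃ κ κ' : {κ : C // I.level κ = i},
      (I.forest L R D hR).root x = I.clusterRoot L κ ∧
      (I.forest L R D hR).root y = I.clusterRoot L κ' ∧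
      ∃ u v : I.upperSet i, I.cluster u = κ ∧ I.cluster v = κ' ∧
        ∃ p : (G.induce (I.upperSet i)).Walk u v, p.length ≤ D := by
  obtain ⟨v, c⟩ := x
  obtain ⟨u, c'⟩ := y
  obtain ⟨h1, i, rfl, rfl, s, t, h2, h3, h4⟩ := h
  have h3 : I.reach i s v := h3
  have h4 : I.reach i t u := h4
  have d1 := levelDist_le h3
  have d2 := levelDist_le h4
  have hv : I.reach i D v := reach_mono (by omega) h3
  have hu : I.reach i D u := reach_mono (by omega) h4
  obtain ⟨κ, e1, e2, a, ha, e3, p, hp⟩ := exists_root_inr (hR := hR) hv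
  obtain ⟨κ', e1', e2', a', ha', e3', p', hp'⟩ := exists_root_inr (hR := hR) hu
  refine ⟨i, ⟨κ, e2⟩, ⟨κ', e2'⟩, e1, e1', a, a', e3, e3', ?_⟩
  have hadj : (G.induce (I.upperSet i)).Adj ⟨v, ha⟩ ⟨u, ha'⟩ := h1
  refine ⟨(p.concat hadj).append p'.reverse, ?_⟩
  rw [SimpleGraph.Walk.length_append, SimpleGraph.Walk.length_concat,
    SimpleGraph.Walk.length_reverse]
  omega

theorem reach_of_walk {i : ℕ} {u v : I.upperSet i} (p : (G.induce (I.upperSet i)).Walk u v)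
    (hv : I.level (I.cluster v) = i) : I.reach i p.length u := by
  induction p with
  | nil => exact hv
  | @cons a c d h p ih => exact Or.inr ⟨a.2, c, h, ih hv⟩

/-- The wanted edge is the first one on the walk that leaves the cell of `κ`. The number of steps
before it and the number of remaining steps are the witnesses `s` and `t`. -/
theorem exists_cross_of_walk {i : Fin L} {κ : C} {u v : I.upperSet i}
    (p : (G.induce (I.upperSet i)).Walk u v) (hv : I.level (I.cluster v) = i)
    (hne : I.cluster v ≠ κ) {s : ℕ} (hs : s + p.length ≤ D) (hu : I.reach i s u)
    (hroot : (I.forest L R D hR).root ((u : V), Sum.inr i) = I.clusterRoot L κ) :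
    ∃ x y, (I.forest L R D hR).root x = I.clusterRoot L κ ∧ I.Cross D x y ∧
      (I.forest L R D hR).root y ≠ I.clusterRoot L κ := by
  induction p generalizing s with
  | nil =>
    rw [root_inr_of_level hv] at hroot
    exact (hne (clusterRoot_injective hroot)).elim
  | @cons a c d h p ih =>
    rw [SimpleGraph.Walk.length_cons] at hs
    by_cases hc : (I.forest L R D hR).root ((c : V), Sum.inr i) = I.clusterRoot L κ
    · exact ih hv hne (s := s + 1) (by omega) (Or.inr ⟨c.2, a, h.symm, hu⟩) hc
    · exact ⟨((a : V), Sum.inr i), ((c : V), Sum.inr i), hroot,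
        ⟨h, i, rfl, rfl, s, p.length, by omega, hu, reach_of_walk p hv⟩, hc⟩

end Forest

end ClusteredNetwork

/-! ### The algorithm -/

/-- The admissible inputs for given global parameters. -/
structure Instance (c b n₀ R D : ℕ) : Type 1 where
  V : Type
  C : Type
  finV : Fintype V
  finC : Fintype C
  G : SimpleGraph V
  I : ClusteredNetwork G C b
  h : ℝ
  two_le : 2 ≤ Fintype.card V
  card_le : Fintype.card V ≤ n₀
  le_pow : n₀ ≤ Fintype.card V ^ c
  one_le : 1 ≤ h
  threshold : D = ⌊h * Real.logb 2 (Fintype.card V) ^ 2⌋₊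
  depth_le : ∀ κ, ∀ v ∈ (I.tree κ).verts, (I.tree κ).depth v ≤ R
  congestion : ∀ v, ({κ | v ∈ (I.tree κ).verts}.ncard : ℝ) ≤ c * Real.logb 2 (Fintype.card V)
  level_le : ∀ κ, 1 ≤ I.level κ ∧ (I.level κ : ℝ) ≤ c * Real.logb 2 (Fintype.card V)

section Search

variable {c b n₀ R D L : ℕ} {W : Type}

/-- What a node knows on one of its channels in the beginning. -/
def chanInput (L : ℕ) : Fam (fun J : Instance c b n₀ R D => J.I.vnet L)
    (LocalInput b × Chan b L) :=
  fun J (x : J.V × Chan b L) => (J.I.localInput x.1, x.2)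

/-- Whether the node on a level channel is at distance at most `s` from the clusters of this
level. -/
def reached (J : Instance c b n₀ R D) (x : J.V × Chan b L) (s : ℕ) : Prop :=
  ∃ i : Fin L, x.2 = Sum.inr i ∧ J.I.reach i s x.1

/-- What is known after `t` rounds of breadth-first search. -/
def searched (L t : ℕ) : Fam (fun J : Instance c b n₀ R D => J.I.vnet L)
    ((ℕ → Prop) × (ℕ → Set (Ident b))) :=
  fun J (x : J.V × Chan b L) => (fun s => s ≤ t ∧ reached J x s,
    fun s => {j | s < t ∧ ∃ u, J.G.Adj x.1 u ∧ J.I.ident u = j ∧ reached J (u, x.2) s})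

theorem reached_succ (J : Instance c b n₀ R D) (x : J.V × Chan b L) (t : ℕ) :
    reached J x (t + 1) ↔ reached J x t ∨ ((∃ i : Fin L, x.2 = Sum.inr i ∧
      (i : ℕ) ≤ (J.I.localInput x.1).level) ∧
        {j | ∃ u, J.G.Adj x.1 u ∧ J.I.ident u = j ∧ reached J (u, x.2) t}.Nonempty) := by
  constructor
  · rintro ⟨i, h1, h2 | ⟨h2, u, h3, h4⟩⟩
    · exact Or.inl ⟨i, h1, h2⟩
    · exact Or.inr ⟨⟨i, h1, h2⟩, _, u, h3, rfl, i, h1, h4⟩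
  · rintro (⟨i, h1, h2⟩ | ⟨⟨i, h1, h2⟩, j, u, h3, -, i', h4, h5⟩)
    · exact ⟨i, h1, Or.inl h2⟩
    · have h4 : x.2 = Sum.inr i' := h4
      rw [h1] at h4
      cases h4
      exact ⟨i, h1, Or.inr ⟨h2, u, h3, h5⟩⟩

/-- A copy also hears the other copies of its own node; keeping only its channel and foreign
identifiers leaves exactly the neighbors in `G`. -/
theorem mem_heard (J : Instance c b n₀ R D) (x : J.V × Chan b L) (t : ℕ) :
    {j | j ≠ (J.I.localInput x.1).ident ∧
      (j, x.2) ∈ (J.I.vnet L).heard (fun y _ => reached J y t) x} =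
    {j | ∃ u, J.G.Adj x.1 u ∧ J.I.ident u = j ∧ reached J (u, x.2) t} := by
  obtain ⟨v, a⟩ := x
  ext j
  constructor
  · rintro ⟨h1, ⟨u, a'⟩, h2, h3, h4⟩
    obtain ⟨h3, h5⟩ : J.I.ident u = j ∧ a' = a := Prod.mk.inj h3
    subst h3 h5
    have hne : v ≠ u := by
      rintro rfl
      exact h1 rfl
    exact ⟨u, (J.I.vnet_adj_of_ne hne h2).1, rfl, h4⟩
  · rintro ⟨u, h1, rfl, i, h2, h3⟩
    have h2 : a = Sum.inr i := h2
    subst h2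
    refine ⟨fun h => ?_, (u, Sum.inr i), J.I.vnet_adj_level h1 i, rfl, i, rfl, h3⟩
    have : u = v := J.I.ident_injective h
    subst this
    exact J.G.loopless.irrefl _ h1

/-- Breadth-first search on all levels. -/
theorem Learn.search [Nonempty W] (t : ℕ) :
    Learn (Option W) t (chanInput (c := c) (b := b) (n₀ := n₀) (R := R) (D := D) L)
      (searched L t) := by
  induction t with
  | zero =>
    refine (Det.refl _).pair ⟨fun x => (fun s => s = 0 ∧ ∃ i : Fin L, x.2 = Sum.inr i ∧
      x.1.level = i, fun _ => ∅), ?_⟩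
    rintro J ⟨v, a⟩
    refine Prod.ext ?_ ?_
    · funext s
      apply propext
      constructor
      · rintro ⟨h1, i, h2, h3⟩
        obtain rfl : s = 0 := by omega
        exact ⟨rfl, i, h2, h3⟩
      · rintro ⟨rfl, i, h2, h3⟩
        exact ⟨le_rfl, i, h2, h3⟩
    · funext s
      ext j
      constructor
      · rintro ⟨h, -⟩
        exact absurd h (Nat.not_lt_zero _)
      · intro h
        exact h.elim
  | succ t ih =>
    have h1 := Learn.heard (W := W)
      (f := fun (J : Instance c b n₀ R D) x => (chanInput L J x, searched L t J x))
      (fun J x _ => reached J x t)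
      ((Det.snd (g := searched L t)).trans ⟨fun y _ => y.1 t, fun J x => by
        funext a
        exact propext ⟨fun h => ⟨le_rfl, h⟩, fun h => h.2⟩⟩)
    refine (ih.trans h1).det ?_
    let newB : LocalInput b × Chan b L → Set (Ident b × Chan b L) → Set (Ident b) := fun l y =>
      {j | j ≠ l.1.ident ∧ (j, l.2) ∈ y}
    refine ⟨fun y => (fun s => if s ≤ t then y.2.1.1 s else s = t + 1 ∧ (y.2.1.1 t ∨
      ((∃ i : Fin L, y.1.2 = Sum.inr i ∧ (i : ℕ) ≤ y.1.1.level) ∧ (newB y.1 y.2.2).Nonempty)),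
      fun s => if s = t then newB y.1 y.2.2 else y.2.1.2 s), ?_⟩
    rintro J ⟨v, a⟩
    have hB : newB (chanInput L J (v, a)) ((J.I.vnet L).heard (fun y _ => reached J y t) (v, a)) =
        {j | ∃ u, J.G.Adj v u ∧ J.I.ident u = j ∧ reached J (u, a) t} := mem_heard J (v, a) t
    refine Prod.ext ?_ ?_
    · funext s
      simp only [hB]
      split_ifs with hs
      · exact propext ⟨fun h => ⟨hs, h.2⟩, fun h => ⟨by omega, h.2⟩⟩
      · apply propext
        constructor
        · rintro ⟨h1, h2⟩
          obtain rfl : s = t + 1 := by omega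
          refine ⟨rfl, ?_⟩
          exact ((reached_succ J (v, a) t).1 h2).imp (fun h => ⟨le_rfl, h⟩) id
        · rintro ⟨rfl, h⟩
          exact ⟨le_rfl, (reached_succ J (v, a) t).2 (h.imp (fun h => h.2) id)⟩
    · funext s
      simp only [hB]
      split_ifs with hs
      · subst hs
        ext j
        exact ⟨fun h => h.2, fun h => ⟨Nat.lt_succ_self _, h⟩⟩
      · ext j
        exact ⟨fun h => ⟨by have := h.1; omega, h.2⟩, fun h => ⟨by have := h.1; omega, h.2⟩⟩

/-- After the search, the nodes know their parents in the forest. -/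
theorem det_parAddr : Det
    (fun (J : Instance c b n₀ R D) x => (chanInput L J x, searched L (D + 1) J x))
    (fun J x => (J.I.forest L R D J.depth_le).parAddr x) := by
  refine ⟨fun y => match y.1.2 with
    | Sum.inl k => (y.1.1.trees k).bind fun tv => tv.parent.map fun p => (p, Sum.inl k)
    | Sum.inr i => if y.2.1 D then
        if sInf {s | y.2.1 s} = 0 then some (y.1.1.ident, Sum.inl y.1.1.clusterIdent)
        else (pick (y.2.2 (sInf {s | y.2.1 s} - 1))).map fun j => (j, Sum.inr i)
      else none, ?_⟩
  rintro J ⟨v, k | i⟩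
  · change J.V at v
    show (J.I.vpar D (v, Sum.inl k)).map (J.I.vnet L).addr =
      ((J.I.localInput v).trees k).bind fun tv => tv.parent.map fun p => (p, Sum.inl k)
    by_cases hex : ∃ κ, J.I.clusterIdent κ = k ∧ v ∈ (J.I.tree κ).verts ∧ v ≠ (J.I.tree κ).root
    · obtain ⟨κ, rfl, h1, h2⟩ := hex
      rw [ClusteredNetwork.vpar_inl h1 h2, J.I.trees_eq_some.2 ⟨κ, rfl, h1, rfl⟩]
      simp only [Option.bind_some]
      rw [J.I.treeView_parent.2 ⟨h2, rfl⟩]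
      rfl
    · rw [ClusteredNetwork.vpar_inl_none hex]
      cases ht : (J.I.localInput v).trees k with
      | none => rfl
      | some tv =>
        obtain ⟨κ, h1, h2, rfl⟩ := J.I.trees_eq_some.1 ht
        have h3 : v = (J.I.tree κ).root := by
          by_contra h3
          exact hex ⟨κ, h1, h2, h3⟩
        simp only [ClusteredNetwork.treeView, if_pos h3]
        rfl
  · change J.V at v
    have hA : ∀ s, (searched L (D + 1) J (v, Sum.inr i)).1 s ↔ s ≤ D + 1 ∧ J.I.reach i s v := by
      intro s
      refine and_congr_right fun _ => ⟨?_, fun h => ⟨i, rfl, h⟩⟩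
      rintro ⟨i', h1, h2⟩
      cases (h1 : (Sum.inr i : Chan b L) = Sum.inr i')
      exact h2
    -- Neighbor sets are known one step later than the node's own status, so `D + 1` rounds give
    -- them up to distance `D`.
    have hB : ∀ s ≤ D, (searched L (D + 1) J (v, Sum.inr i)).2 s = J.I.near i s v := by
      intro s hs
      ext j
      constructor
      · rintro ⟨-, u, h1, h2, i', h3, h4⟩
        cases (h3 : (Sum.inr i : Chan b L) = Sum.inr i')
        exact ⟨u, h1, h2, h4⟩
      · rintro ⟨u, h1, h2, h3⟩
        exact ⟨by omega, u, h1, h2, i, rfl, h3⟩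
    show (J.I.vpar D (v, Sum.inr i)).map (J.I.vnet L).addr =
      if (searched L (D + 1) J (v, Sum.inr i)).1 D then
        if sInf {s | (searched L (D + 1) J (v, Sum.inr i)).1 s} = 0 then
          some (J.I.ident v, Sum.inl (J.I.clusterIdent (J.I.cluster v)))
        else (pick ((searched L (D + 1) J (v, Sum.inr i)).2
          (sInf {s | (searched L (D + 1) J (v, Sum.inr i)).1 s} - 1))).map fun j => (j, Sum.inr i)
      else none
    by_cases hr : J.I.reach i D v
    · have hd : sInf {s | (searched L (D + 1) J (v, Sum.inr i)).1 s} = J.I.levelDist i v := by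
        have h1 := ClusteredNetwork.levelDist_le hr
        have h2 := ClusteredNetwork.reach_levelDist hr
        apply le_antisymm
        · exact Nat.sInf_le (s := {s | (searched L (D + 1) J (v, Sum.inr i)).1 s})
            ((hA _).2 ⟨by omega, h2⟩)
        · have := Nat.sInf_mem (s := {s | (searched L (D + 1) J (v, Sum.inr i)).1 s})
            ⟨D, (hA D).2 ⟨by omega, hr⟩⟩
          exact ClusteredNetwork.levelDist_le ((hA _).1 this).2
      rw [if_pos ((hA D).2 ⟨by omega, hr⟩), hd]
      by_cases h0 : J.I.levelDist i v = 0
      · rw [if_pos h0, ClusteredNetwork.vpar_inr_zero hr h0]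
        rfl
      · obtain ⟨u, h1, -, -, h2⟩ := ClusteredNetwork.vpar_inr_pos hr h0
        have := ClusteredNetwork.levelDist_le hr
        rw [if_neg h0, h1, hB _ (by omega), h2]
        rfl
    · rw [if_neg fun h => hr ((hA D).1 h).2, ClusteredNetwork.vpar_inr_none hr]
      rfl

/-- After the search, the nodes know the edges between search trees. -/
theorem det_cross : Det
    (fun (J : Instance c b n₀ R D) x => (chanInput L J x, searched L (D + 1) J x))
    (fun J x => ({a | ∃ y, J.I.Cross D x y ∧ (J.I.vnet L).addr y = a} :
      Set (Ident b × Chan b L))) := by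
  refine ⟨fun y => {a | a.2 = y.1.2 ∧ ∃ s t, s + t + 1 ≤ D ∧ y.2.1 s ∧ a.1 ∈ y.2.2 t}, ?_⟩
  rintro J ⟨v, a⟩
  ext ⟨j, a'⟩
  constructor
  · rintro ⟨⟨u, a''⟩, ⟨h1, i, h2, h3, s, t, h4, h5, h6⟩, h7⟩
    obtain ⟨h7, h8⟩ : J.I.ident u = j ∧ a'' = a' := Prod.mk.inj h7
    have h2 : a = Sum.inr i := h2
    have h3 : a'' = Sum.inr i := h3
    subst h2 h7 h8 h3
    exact ⟨rfl, s, t, h4, ⟨by omega, i, rfl, h5⟩, by omega, u, h1, rfl, i, rfl, h6⟩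
  · rintro ⟨h0, s, t, h1, ⟨-, i, h2, h3⟩, -, u, h4, h5, i', h6, h7⟩
    have h0 : a' = a := h0
    have h2 : a = Sum.inr i := h2
    subst h0 h2
    cases (h6 : (Sum.inr i : Chan b L) = Sum.inr i')
    refine ⟨(u, Sum.inr i), ⟨h4, i, rfl, rfl, s, t, h1, h3, h7⟩, ?_⟩
    exact Prod.ext h5 rfl

end Search

/-! ### Correctness -/

section Correctness

variable {c b n₀ R D : ℕ}

namespace Instance

variable (J : Instance c b n₀ R D)

/-- The real distance threshold. -/
def θ : ℝ := J.h * Real.logb 2 (@Fintype.card J.V J.finV) ^ 2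

theorem le_θ_iff (m : ℕ) : (m : ℝ) ≤ J.θ ↔ m ≤ D := by
  have h0 : 0 ≤ J.θ := mul_nonneg (zero_le_one.trans J.one_le) (sq_nonneg _)
  rw [← Nat.le_floor_iff h0, θ, ← J.threshold]

theorem isBalanced {L : ℕ} (hL : ∀ κ, J.I.level κ < L) (χ : J.V × Chan b L → Option Color)
    (hχ : ∀ v, χ v ≠ none ↔ ∃ x y, (J.I.forest L R D J.depth_le).root x =
      (J.I.forest L R D J.depth_le).root v ∧ J.I.Cross D x y ∧
        (J.I.forest L R D J.depth_le).root y ≠ (J.I.forest L R D J.depth_le).root v)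
    (hbal : ∀ Q : Finset (J.V × Chan b L),
      (∀ v ∈ Q, (J.I.forest L R D J.depth_le).root v = v) → (∀ v ∈ Q, χ v ≠ none) →
        (∀ x y, J.I.Cross D x y → (J.I.forest L R D J.depth_le).root x ∈ Q →
          (J.I.forest L R D J.depth_le).root y ∈ Q) →
        ∀ c : Color, 4 * (Q.filter fun v => χ v = some c).card ≤ 3 * Q.card) :
    J.I.IsBalanced J.θ fun κ => χ (J.I.clusterRoot L κ) := by
  have := J.finC
  -- Having a crossing edge to another tree is the same as being non-isolated in the cluster graph,
  -- although not every adjacency yields a direct crossing edge.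
  have hcol : ∀ (i : ℕ) (κ : {κ : J.C // J.I.level κ = i}), χ (J.I.clusterRoot L κ) ≠ none ↔
      ∃ κ', (J.I.clusterGraph J.θ i).Adj κ κ' := by
    intro i κ
    rw [hχ, ClusteredNetwork.root_clusterRoot]
    constructor
    · rintro ⟨x, y, h1, h2, h3⟩
      obtain ⟨j, κ₁, κ₂, e1, e2, u, v, hu, hv, p, hp⟩ :=
        ClusteredNetwork.exists_of_cross (hR := J.depth_le) h2
      have e : (κ₁ : J.C) = κ := ClusteredNetwork.clusterRoot_injective (e1.symm.trans h1)
      have hij : j = i := by rw [← κ₁.2, e, κ.2]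
      subst hij
      have e : κ₁ = κ := Subtype.ext e
      subst e
      refine ⟨κ₂, fun h => h3 ?_, u, v, hu, hv, p, (J.le_θ_iff _).2 hp⟩
      rw [e2, ← h]
    · rintro ⟨κ', hne, u, v, hu, hv, p, hp⟩
      have hiL : i < L := κ.2 ▸ hL κ
      have hlu : J.I.level (J.I.cluster u) = i := by rw [hu, κ.2]
      have hlv : J.I.level (J.I.cluster v) = i := by rw [hv, κ'.2]
      refine ClusteredNetwork.exists_cross_of_walk (i := ⟨i, hiL⟩) (s := 0) p hlv ?_ ?_ hlu ?_
      · rw [hv]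
        exact fun h => hne (Subtype.ext h.symm)
      · rw [Nat.zero_add]
        exact (J.le_θ_iff _).1 hp
      · rw [ClusteredNetwork.root_inr_of_level hlu, hu]
  -- One bound for all closed sets of non-isolated clusters; it serves both a single component and
  -- the set of all non-isolated clusters of a level.
  have hclosed : ∀ (i : ℕ) (S : Finset {κ : J.C // J.I.level κ = i}),
      (∀ κ ∈ S, ∃ κ', (J.I.clusterGraph J.θ i).Adj κ κ') →
      (∀ κ κ', (J.I.clusterGraph J.θ i).Adj κ κ' → κ ∈ S → κ' ∈ S) →
      ∀ x : Color, 4 * (S.filter fun κ : {κ : J.C // J.I.level κ = i} =>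
        χ (J.I.clusterRoot L κ) = some x).card ≤ 3 * S.card := by
    intro i S hS1 hS2 x
    have hinj : Function.Injective fun κ : {κ : J.C // J.I.level κ = i} => J.I.clusterRoot L κ :=
      ClusteredNetwork.clusterRoot_injective.comp Subtype.val_injective
    have h := hbal (S.map ⟨_, hinj⟩) ?_ ?_ ?_ x
    · rwa [Finset.filter_map, Finset.card_map, Finset.card_map] at h
    · intro v hv
      obtain ⟨κ, -, rfl⟩ := Finset.mem_map.1 hv
      exact ClusteredNetwork.root_clusterRoot _
    · intro v hv
      obtain ⟨κ, hκ, rfl⟩ := Finset.mem_map.1 hv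
      exact (hcol i κ).2 (hS1 κ hκ)
    · intro y z hyz hy
      obtain ⟨κ, hκ, hκy⟩ := Finset.mem_map.1 hy
      obtain ⟨j, κ₁, κ₂, e1, e2, u, v, hu, hv, p, hp⟩ :=
        ClusteredNetwork.exists_of_cross (hR := J.depth_le) hyz
      have e : (κ₁ : J.C) = κ := ClusteredNetwork.clusterRoot_injective (e1.symm.trans hκy.symm)
      have hij : j = i := by rw [← κ₁.2, e, κ.2]
      subst hij
      have e : κ₁ = κ := Subtype.ext e
      subst e
      rw [e2]
      refine Finset.mem_map.2 ⟨κ₂, ?_, rfl⟩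
      by_cases hne : κ₁ = κ₂
      · rwa [← hne]
      · exact hS2 κ₁ κ₂ ⟨hne, u, v, hu, hv, p, (J.le_θ_iff _).2 hp⟩ hκ
  have hcast : ∀ m n : ℕ, 4 * m ≤ 3 * n → (m : ℝ) ≤ 3 / 4 * (n : ℝ) := by
    intro m n h
    have : (4 : ℝ) * m ≤ 3 * n := by exact_mod_cast h
    linarith
  have hadj : ∀ (i : ℕ) (P : (J.I.clusterGraph J.θ i).ConnectedComponent),
      2 ≤ P.supp.ncard → ∀ κ ∈ P.supp, ∃ κ', (J.I.clusterGraph J.θ i).Adj κ κ' := by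
    intro i P h2 κ hκ
    obtain ⟨κ', hκ', hne⟩ := Set.exists_ne_of_one_lt_ncard (by omega : 1 < P.supp.ncard) κ
    have hr : (J.I.clusterGraph J.θ i).Reachable κ κ' := by
      rw [SimpleGraph.ConnectedComponent.mem_supp_iff] at hκ hκ'
      exact SimpleGraph.ConnectedComponent.exact (hκ.trans hκ'.symm)
    obtain ⟨p⟩ := hr
    cases p with
    | nil => exact (hne rfl).elim
    | cons h _ => exact ⟨_, h⟩
  refine ⟨fun i P h1 κ hκ => ?_, fun i P h2 κ hκ => ?_, fun i P x h2 => ?_, fun i x => ?_⟩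
  · by_contra hne
    obtain ⟨κ', h⟩ := (hcol i κ).1 hne
    have hκ' : κ' ∈ P.supp := P.mem_supp_of_adj_mem_supp hκ h
    obtain ⟨a, ha⟩ := Set.ncard_eq_one.1 h1
    rw [ha] at hκ hκ'
    exact h.ne (hκ.trans hκ'.symm)
  · exact (hcol i κ).2 (hadj i P h2 κ hκ)
  · apply hcast
    have h := hclosed i P.supp.toFinset
      (fun κ hκ => hadj i P h2 κ (Set.mem_toFinset.1 hκ))
      (fun κ κ' h hκ => Set.mem_toFinset.2
        (P.mem_supp_of_adj_mem_supp (Set.mem_toFinset.1 hκ) h)) x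
    rw [← Set.ncard_coe_finset, ← Set.ncard_coe_finset, Finset.coe_filter, Set.coe_toFinset] at h
    simpa only [Set.mem_toFinset] using h
  · apply hcast
    have h := hclosed i (Finset.univ.filter fun κ : {κ : J.C // J.I.level κ = i} =>
        ∃ κ', (J.I.clusterGraph J.θ i).Adj κ κ')
      (fun κ hκ => (Finset.mem_filter.1 hκ).2)
      (fun κ κ' h _ => Finset.mem_filter.2 ⟨Finset.mem_univ _, κ, h.symm⟩) x
    have e1 : {κ | J.I.level κ = i ∧ χ (J.I.clusterRoot L κ) = some x}.ncard ≤
        (Finset.filter (fun κ : {κ : J.C // J.I.level κ = i} => χ (J.I.clusterRoot L κ) = some x)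
          (Finset.univ.filter fun κ : {κ : J.C // J.I.level κ = i} =>
        ∃ κ', (J.I.clusterGraph J.θ i).Adj κ κ')).card := by
      rw [← Finset.card_image_of_injective _ Subtype.val_injective, ← Set.ncard_coe_finset]
      refine Set.ncard_le_ncard ?_
      rintro κ ⟨h1, h2⟩
      refine Finset.mem_coe.2 (Finset.mem_image.2 ⟨⟨κ, h1⟩, ?_, rfl⟩)
      rw [Finset.mem_filter, Finset.mem_filter]
      refine ⟨⟨Finset.mem_univ _, (hcol i ⟨κ, h1⟩).1 ?_⟩, h2⟩
      show χ (J.I.clusterRoot L κ) ≠ none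
      rw [h2]
      simp
    have e2 : (Finset.univ.filter fun κ : {κ : J.C // J.I.level κ = i} =>
        ∃ κ', (J.I.clusterGraph J.θ i).Adj κ κ').card ≤
        {κ | J.I.level κ = i}.ncard := by
      rw [← Finset.card_image_of_injective _ Subtype.val_injective, ← Set.ncard_coe_finset]
      refine Set.ncard_le_ncard ?_
      intro κ hκ
      obtain ⟨κ', -, rfl⟩ := Finset.mem_image.1 (Finset.mem_coe.1 hκ)
      exact κ'.2
    omega

/-! ### Comparison of the logarithms of the size, of its estimate, and of the identifier length -/

theorem one_le_b (J : Instance c b n₀ R D) : 1 ≤ b := by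
  have h1 := @Fintype.card_le_of_injective _ _ J.finV _ _ J.I.ident_injective
  have h2 := J.two_le
  rw [Fintype.card_fin] at h1
  by_contra h
  obtain rfl : b = 0 := by omega
  rw [Nat.pow_zero] at h1
  omega

theorem log_le (J : Instance c b n₀ R D) : Nat.log 2 n₀ ≤ c * b := by
  have h1 := @Fintype.card_le_of_injective _ _ J.finV _ _ J.I.ident_injective
  rw [Fintype.card_fin] at h1
  have h2 : n₀ ≤ 2 ^ (c * b) := by
    refine J.le_pow.trans ?_
    rw [mul_comm, pow_mul]
    exact Nat.pow_le_pow_left h1 c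
  calc Nat.log 2 n₀ ≤ Nat.log 2 (2 ^ (c * b)) := Nat.log_mono_right h2
    _ = c * b := Nat.log_pow one_lt_two _

/-- The binary logarithm of the number of nodes. -/
def lg : ℝ := Real.logb 2 (@Fintype.card J.V J.finV)

theorem one_le_lg : 1 ≤ J.lg := by
  have h := J.two_le
  rw [lg, Real.le_logb_iff_rpow_le one_lt_two (by positivity), Real.rpow_one]
  exact_mod_cast h

theorem lg_le : J.lg ≤ (Nat.log 2 n₀ + 1 : ℕ) := by
  have h := J.two_le
  have h1 := J.card_le.trans (Nat.lt_pow_succ_log_self one_lt_two n₀).le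
  rw [lg, Real.logb_le_iff_le_rpow one_lt_two (by positivity), Real.rpow_natCast]
  exact_mod_cast h1

theorem log_le_lg : (Nat.log 2 n₀ : ℝ) ≤ c * J.lg := by
  have h := J.two_le
  have hn : n₀ ≠ 0 := by
    have := J.card_le
    omega
  have h1 : 2 ^ Nat.log 2 n₀ ≤ @Fintype.card J.V J.finV ^ c :=
    (Nat.pow_log_le_self 2 hn).trans J.le_pow
  have h2 : ((2 : ℝ) ^ Nat.log 2 n₀) ≤ (@Fintype.card J.V J.finV : ℝ) ^ c := by exact_mod_cast h1
  have h3 := Real.logb_le_logb_of_le one_lt_two (by positivity) h2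
  rwa [Real.logb_pow, Real.logb_pow, Real.logb_self_eq_one one_lt_two, mul_one] at h3

theorem level_lt (κ : J.C) : J.I.level κ < c * (Nat.log 2 n₀ + 1) + 1 := by
  have h1 := (J.level_le κ).2
  have h2 : (c : ℝ) * J.lg ≤ c * (Nat.log 2 n₀ + 1 : ℕ) :=
    mul_le_mul_of_nonneg_left J.lg_le (Nat.cast_nonneg _)
  have h3 : (J.I.level κ : ℝ) ≤ (c * (Nat.log 2 n₀ + 1) : ℕ) := by
    rw [Nat.cast_mul]
    exact h1.trans h2
  exact Nat.lt_succ_of_le (by exact_mod_cast h3)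

theorem ncard_le (v : J.V) :
    {κ | v ∈ (J.I.tree κ).verts}.ncard ≤ c * (Nat.log 2 n₀ + 1) := by
  have h2 : (c : ℝ) * J.lg ≤ c * (Nat.log 2 n₀ + 1 : ℕ) :=
    mul_le_mul_of_nonneg_left J.lg_le (Nat.cast_nonneg _)
  have h3 : ({κ | v ∈ (J.I.tree κ).verts}.ncard : ℝ) ≤ (c * (Nat.log 2 n₀ + 1) : ℕ) := by
    rw [Nat.cast_mul]
    exact (J.congestion v).trans h2
  exact_mod_cast h3

end Instance

theorem fits_of_card_le {q w : ℕ} {M : Type} [Fintype M] (h : Fintype.card M ≤ 2 ^ (w * q)) :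
    Fits q (Fin w → Bool) M := by
  have hc : Fintype.card M ≤ Fintype.card (Fin q → Fin w → Bool) := by
    simpa [← pow_mul] using h
  obtain ⟨e⟩ := Function.Embedding.nonempty_of_card_le hc
  exact ⟨e, e.injective⟩

/-- The number of channels of an edge. -/
def numChans (c n₀ : ℕ) : ℕ := c * (Nat.log 2 n₀ + 1) + (c * (Nat.log 2 n₀ + 1) + 1)

/-- The number of rounds of the algorithm. -/
def totalRounds (c b n₀ R D : ℕ) : ℕ :=
  D + 1 + colorRounds b (R + D + 1) (numChans c n₀)

/-- The algorithm, for messages that are long enough. -/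
theorem exists_algorithm {B : ℕ} (hb : 1 ≤ b)
    (hB : numChans c n₀ * (b / numChans c n₀ + 3) ≤ B) :
    ∃ A : CongestAlgorithm b B (LocalInput b) (Option Color), ∀ J : Instance c b n₀ R D,
      ∃ χ : J.C → Option Color,
        (∀ v, A.output (A.run J.G J.I.ident J.I.localInput (totalRounds c b n₀ R D) v) =
          χ (J.I.cluster v)) ∧ J.I.IsBalanced J.θ χ := by
  let L := c * (Nat.log 2 n₀ + 1) + 1
  let S := numChans c n₀
  -- The digit length: `S` digits of `w` bits hold an identifier. The alphabet `Option` of a channel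
  -- costs one further bit, so `S` channels need `S * (w + 1) = S * (b / S + 3)` bits.
  let w := b / S + 2
  have hS : 0 < S := by simp only [S, numChans]; omega
  have hwS : b ≤ w * S := by
    have h1 := Nat.div_add_mod b S
    have h2 := Nat.mod_lt b hS
    have : w * S = S * (b / S) + 2 * S := by simp only [w]; ring
    omega
  have hId : Fits S (Fin w → Bool) (Ident b) := by
    apply fits_of_card_le
    rw [Fintype.card_fin]
    exact Nat.pow_le_pow_right two_pos hwS
  have hProp : Fits S (Fin w → Bool) Prop := by
    apply fits_of_card_le
    rw [Fintype.card_prop]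
    calc 2 = 2 ^ 1 := rfl
      _ ≤ 2 ^ (w * S) := Nat.pow_le_pow_right two_pos (hb.trans hwS)
  have : ∀ J : Instance c b n₀ R D, Fintype (J.I.vnet L).V := fun J => by
    have := J.finV
    exact (inferInstance : Fintype (J.V × Chan b L))
  obtain ⟨χ, hχ1, hχ2, hχ3, hχ4⟩ := Learn.balanced (W := Fin w → Bool)
    (N := fun J : Instance c b n₀ R D => J.I.vnet L)
    (f := fun J x => (chanInput L J x, searched L (D + 1) J x))
    (F := fun J => J.I.forest L R D J.depth_le) hb hS hId hProp
    (fun J x => ClusteredNetwork.forest_depth_le x) det_parAddr (fun J => J.I.Cross D)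
    (fun J x y h => ClusteredNetwork.cross_symm h) (fun J x y h => ClusteredNetwork.adj_of_cross h)
    -- Initial colors matter only at roots: the root of a cluster's tree lies on a Steiner channel,
    -- whose name is the cluster identifier. The value 0 on level channels is a dummy.
    det_cross (fun J (x : J.V × Chan b L) => Sum.elim id (fun _ => ⟨0, by positivity⟩) x.2)
    (Det.mono ⟨fun y => Sum.elim id (fun _ => ⟨0, by positivity⟩) y.2, fun J x => rfl⟩)
    (by
      intro J x y h hne
      obtain ⟨i, κ, κ', e1, e2, -⟩ := ClusteredNetwork.exists_of_cross (hR := J.depth_le) h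
      rw [e1, e2] at hne ⊢
      intro e
      apply hne
      rw [J.I.clusterIdent_injective e])
  have hsolve : Solves (Option (Fin w → Bool)) (totalRounds c b n₀ R D)
      (chanInput (c := c) (b := b) (n₀ := n₀) (R := R) (D := D) L) χ :=
    ((Learn.search (W := Fin w → Bool) (D + 1)).comp hχ4).post Det.snd
  have hcardM : Fintype.card (Option (Fin w → Bool)) ^ S ≤ 2 ^ B := by
    have h1 : Fintype.card (Option (Fin w → Bool)) ≤ 2 ^ (w + 1) := by
      rw [Fintype.card_option, Fintype.card_fun, Fintype.card_bool, Fintype.card_fin]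
      have h2 : 2 ^ (w + 1) = 2 ^ w * 2 := pow_succ 2 w
      rw [h2]
      have := Nat.one_le_two_pow (n := w)
      omega
    refine (Nat.pow_le_pow_left h1 S).trans ?_
    rw [← pow_mul]
    refine Nat.pow_le_pow_right two_pos (le_trans (le_of_eq ?_) hB)
    simp only [w, S]
    ring
  have hreal := Solves.simulate (N := fun J : Instance c b n₀ R D => J.I.toNet)
    (E := fun J v j => chans L (J.I.localInput v) j)
    (hE := fun J v u _ => J.I.chans_symm L v u) (S := S) (B := B)
    (fun J v u _ => by
      have := J.finC
      exact J.I.ncard_chans_le L _ v u (J.ncard_le v)) hcardM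
    (loc := fun J v => J.I.localInput v) ⟨fun l j => chans L l j, fun _ _ => rfl⟩
    ⟨fun l => l.ident, fun _ _ => rfl⟩ hsolve
  have hfin : Solves (Message B) (totalRounds c b n₀ R D)
      (fun J v => J.I.localInput v : Fam (fun J : Instance c b n₀ R D => J.I.toNet) _)
      (fun J v => χ J (v, Sum.inl (J.I.clusterIdent (J.I.cluster v))) :
        Fam (fun J : Instance c b n₀ R D => J.I.toNet) _) :=
    (Solves.pre (Det.pair (Det.refl _) ⟨fun l a => (l, a), fun _ _ => rfl⟩) hreal).post
      ⟨fun y => y.2 (Sum.inl y.1.clusterIdent), fun _ _ => rfl⟩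
  obtain ⟨A, hA⟩ := hfin.exists_algorithm
  refine ⟨A, fun J => ⟨fun κ => χ J (J.I.clusterRoot L κ), fun v => (hA J v).trans ?_, ?_⟩⟩
  · refine hχ1 J _ _ ?_
    exact (ClusteredNetwork.root_inl (J.I.mem_tree v)).trans
      (ClusteredNetwork.root_clusterRoot _).symm
  · refine J.isBalanced J.level_lt (χ J) (hχ2 J) ?_
    intro Q h1 h2 h3 x
    exact hχ3 J Q h1 h2 h3 x

/-! ### Message size and number of rounds -/

theorem numChans_le (J : Instance c b n₀ R D) : numChans c n₀ ≤ (2 * c * (c + 1) + 1) * b := by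
  have h1 := J.log_le
  have h2 := J.one_le_b
  have h3 : Nat.log 2 n₀ + 1 ≤ (c + 1) * b := by rw [Nat.succ_mul]; omega
  calc numChans c n₀ = 2 * c * (Nat.log 2 n₀ + 1) + 1 := by rw [numChans]; ring
    _ ≤ 2 * c * ((c + 1) * b) + b := by gcongr
    _ = (2 * c * (c + 1) + 1) * b := by ring

theorem messages_fit (J : Instance c b n₀ R D) :
    numChans c n₀ * (b / numChans c n₀ + 3) ≤ (41 * (2 * c * (c + 1) + 1) + 169) * b := by
  have h1 := numChans_le J
  have h2 := Nat.mul_div_le b (numChans c n₀)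
  calc numChans c n₀ * (b / numChans c n₀ + 3)
      = numChans c n₀ * (b / numChans c n₀) + 3 * numChans c n₀ := by ring
    _ ≤ b + 3 * ((2 * c * (c + 1) + 1) * b) := by gcongr
    _ ≤ (41 * (2 * c * (c + 1) + 1) + 169) * b := by nlinarith

theorem totalRounds_le (J : Instance c b n₀ R D) :
    (totalRounds c b n₀ R D : ℝ) ≤ (41 * (2 * c * (c + 1) + 1) + 169 : ℕ) *
      ((R + J.θ) * max 1 (logStar b : ℝ)) := by
  have hlg := J.one_le_lg
  have hD : (D : ℝ) ≤ J.θ := (J.le_θ_iff D).2 le_rfl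
  -- Since $h\ge 1$ and $\log n\ge 1$, the $O(\log n)$ digits of a broadcast are absorbed by the
  -- distance threshold.
  have hsq : J.lg ≤ J.θ := by
    have h1 : J.θ = J.h * J.lg ^ 2 := rfl
    have h2 := J.one_le
    rw [h1]
    nlinarith
  set m : ℝ := max 1 (logStar b : ℝ) with hm
  have hm1 : 1 ≤ m := le_max_left _ _
  have hm2 : (logStar b : ℝ) ≤ m := le_max_right _ _
  set Y : ℝ := R + J.θ with hY
  have hR : (0 : ℝ) ≤ R := Nat.cast_nonneg _
  have hY1 : 1 ≤ Y := by linarith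
  have hH : ((R + D + 1 : ℕ) : ℝ) ≤ 2 * Y := by
    push_cast
    linarith
  have hq : (numChans c n₀ : ℝ) ≤ (2 * c * (c + 1) + 1) * Y := by
    have h1 := J.log_le_lg
    have h2 : (numChans c n₀ : ℝ) = 2 * c * (Nat.log 2 n₀ + 1) + 1 := by
      rw [numChans]
      push_cast
      ring
    have h3 : (Nat.log 2 n₀ : ℝ) + 1 ≤ (c + 1) * Y := by
      have : (c : ℝ) * J.lg ≤ c * Y := by
        apply mul_le_mul_of_nonneg_left _ (Nat.cast_nonneg _)
        linarith
      linarith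
    rw [h2]
    have h4 : (2 * c : ℝ) * (Nat.log 2 n₀ + 1) ≤ 2 * c * ((c + 1) * Y) :=
      mul_le_mul_of_nonneg_left h3 (by positivity)
    linarith
  have hT : (totalRounds c b n₀ R D : ℝ) = (D + 1) +
      (57 * (R + D + 1 : ℕ) + 38 * numChans c n₀ + 48) +
        logStar b * (2 * (R + D + 1 : ℕ) + 3 * numChans c n₀) := by
    rw [totalRounds, colorRounds]
    push_cast
    ring
  set H := R + D + 1 with hHdef
  set q := numChans c n₀
  have hDH : (D : ℝ) + 1 ≤ H := by
    rw [hHdef]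
    push_cast
    linarith
  have hH0 : (0 : ℝ) ≤ H := Nat.cast_nonneg _
  have hq0 : (0 : ℝ) ≤ q := Nat.cast_nonneg _
  have e1 : (logStar b : ℝ) * (2 * H + 3 * q) ≤ m * (2 * H + 3 * q) :=
    mul_le_mul_of_nonneg_right hm2 (by positivity)
  have e2 : (58 * H + 38 * q + 48 : ℝ) ≤ m * (58 * H + 38 * q + 48) :=
    le_mul_of_one_le_left (by positivity) hm1
  -- With $H\le 2Y$ and $1\le Y$, the terms $60H+48$ contribute at most $168Y$; this explains the
  -- constant of the theorem.
  have e3 : (60 * H + 41 * q + 48 : ℝ) ≤ (41 * (2 * c * (c + 1) + 1) + 169) * Y := by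
    linarith
  have e4 : m * (60 * H + 41 * q + 48) ≤ m * ((41 * (2 * c * (c + 1) + 1) + 169) * Y) :=
    mul_le_mul_of_nonneg_left e3 (by linarith)
  rw [hT]
  push_cast
  linarith

end Correctness

end

end BalancedColoring

/-- `c` bounds the constants hidden in the hypotheses; `K`, which depends on `c` only, is the
constant in the message size and in the number of rounds. The algorithm `A` and its running time
`T` depend only on the global parameters that the nodes know: the identifier length `b`, an
estimate `N` of the number of nodes that is tight up to a polynomial, the depth bound `R`, and the
distance threshold `D`. (Unique `b`-bit identifiers force `b ≥ log₂ n`.) -/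
theorem mainTheorem10 (c : ℕ) :
    ∃ K : ℕ, ∀ b N R D : ℕ,
      ∃ (A : BalancedColoring.CongestAlgorithm b (K * b) (BalancedColoring.LocalInput b)
          (Option BalancedColoring.Color)) (T : ℕ),
        ∀ (V C : Type) [Fintype V] [Fintype C] (G : SimpleGraph V)
          (I : BalancedColoring.ClusteredNetwork G C b) (n : ℕ) (h : ℝ),
          n = Fintype.card V → 2 ≤ n → n ≤ N → N ≤ n ^ c →
          1 ≤ h → D = ⌊h * Real.logb 2 n ^ 2⌋₊ →
          (∀ κ, ∀ v ∈ (I.tree κ).verts, (I.tree κ).depth v ≤ R) →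
          (∀ v, ({κ | v ∈ (I.tree κ).verts}.ncard : ℝ) ≤ c * Real.logb 2 n) →
          (∀ κ, 1 ≤ I.level κ ∧ (I.level κ : ℝ) ≤ c * Real.logb 2 n) →
          (T : ℝ) ≤ K * ((R + h * Real.logb 2 n ^ 2) * max 1 (BalancedColoring.logStar b : ℝ)) ∧
          ∃ χ : C → Option BalancedColoring.Color,
            (∀ v, A.output (A.run G I.ident I.localInput T v) = χ (I.cluster v)) ∧
            I.IsBalanced (h * Real.logb 2 n ^ 2) χ := by
  refine ⟨41 * (2 * c * (c + 1) + 1) + 169, fun b N R D => ?_⟩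
  -- An instance is needed to get `1 ≤ b` and a bound on the message length from the global
  -- parameters. If none exists, any algorithm will do.
  by_cases hex : Nonempty (BalancedColoring.Instance c b N R D)
  · obtain ⟨J₀⟩ := hex
    obtain ⟨A, hA⟩ := BalancedColoring.exists_algorithm (R := R) (D := D) J₀.one_le_b
      (BalancedColoring.messages_fit J₀)
    refine ⟨A, BalancedColoring.totalRounds c b N R D, ?_⟩
    intro V C instV instC G I n h hn h2 hN hNc hh hD hR hcong hlev
    subst hn
    let J : BalancedColoring.Instance c b N R D :=
      ⟨V, C, instV, instC, G, I, h, h2, hN, hNc, hh, hD, hR, hcong, hlev⟩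
    exact ⟨BalancedColoring.totalRounds_le J, hA J⟩
  · refine ⟨⟨Unit, fun _ => (), fun _ _ _ => false, fun _ _ => (), fun _ => none⟩, 0, ?_⟩
    intro V C instV instC G I n h hn h2 hN hNc hh hD hR hcong hlev
    subst hn
    exact (hex ⟨⟨V, C, instV, instC, G, I, h, h2, hN, hNc, hh, hD, hR, hcong, hlev⟩⟩).elim
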